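/- **Theorem 4.16 (Leray–Serre spectral sequence for $h^*$-fibrations).** *Setting.* A good subcategory $\mathcal C$ of the category of C*-algebras is a full subcategory that contains $\mathbb C$ and is closed under isomorphisms, ideals, quotients, extensions and suspension $A\mapsto C_0(\mathbb R,A)$. A cohomology theory $h^*=(h^n)_{n\in\mathbb Z}$ on $\mathcal C$ is a sequence of homotopy invariant contravariant functors $h^n$ from $\mathcal C$ to abelian groups together with natural long exact sequences $$\cdots\to h^n(B)\to h^n(A)\to h^n(J)\xrightarrow{\ \partial\ }h^{n+1}(B)\to h^{n+1}(A)\to\cdots$$ for short exact sequences $0\to J\to A\to B\to 0$ in $\mathcal C$. For countable ($c_0$-)direct sums $\bigoplus_i A_i$ in $\mathcal C$ of objects $A_i$ of $\mathcal C$, $h^*$ is called $\sigma$-additive if the projections always induce isomorphisms $\bigoplus_i h^n(A_i)\cong h^n(\bigoplus_iA_i)$, and $\sigma$-multiplicative if the inclusions always induce isomorphisms $h^n(\bigoplus_iA_i)\cong\prod_ih^n(A_i)$. Let $X$ be (the realization of) a simplicial complex that is finite dimensional, has countably many simplices and is locally finite. For each simplex fix an ordering of its vertices. Let $X_p$ be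 the $p$-skeleton ($X_p=\emptyset$ for $p<0$). Let $A=A(X)\in\mathcal C$ be a $C_0(X)$-algebra, i.e. a C*-algebra with a non-degenerate $*$-homomorphism $C_0(X)\to ZM(A)$, with fibres $A_x$. Put $A_p=A|_{X_p}$ and $A_{p,p-1}=A|_{X_p\setminus X_{p-1}}=\ker(A_p\to A_{p-1})$. Suppose that $A(X)$ is an $h^*$-fibration: for every $k\ge 0$, every continuous map $f:\Delta^k\to X$ and every $v\in\Delta^k$, the evaluation $q_v:f^*A\to A_{f(v)}$ induces isomorphisms $h^n(A_{f(v)})\to h^n(f^*A)$ for all $n$. Let $\mathcal H^n=\{h^n(A_x):x\in X\}$ be the associated group bundle, in which a path $\gamma$ from $x$ to $y$ acts by $c_\gamma=(\varepsilon_1^*)^{-1}\circ\varepsilon_0^*:h^n(A_x)\to h^n(\gamma^*A)\to h^n(A_y)$, where $\varepsilon_0,\varepsilon_1$ are the evaluations at the end points. For a group bundle $\mathcal G$ on $X$, $C_p(X;\mathcal G)$ is the group of all, possibly infinite, sums $\sum_\sigma a_\sigma\sigma$ over the $p$-simplices $\sigma$, with $a_\sigma$ a constant (parallel) section of $\mathcal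 G$ over the closed simplex $\sigma$. The boundary is $d(a_\sigma\sigma)=\sum_{l=0}^p(-1)^l\operatorname{sign}(\varphi_l)\,a_\sigma|_{\tau_l}\,\tau_l$, where $\tau_l$ is the $l$-th face of $\sigma$ and $\varphi_l$ is the permutation comparing its chosen vertex ordering with the one inherited from $\sigma$. $H_p(X;\mathcal G)$ is the homology of this complex and $H_p^{\mathrm{fin}}(X;\mathcal G)$ that of the subcomplex of finite sums. *The spectral sequence.* The long exact sequences of $0\to A_{p,p-1}\xrightarrow{\iota}A_p\to A_{p-1}\to0$ form an exact couple with $D_{p,q}=h^q(A_p)$ and $E^1_{p,q}=h^q(A_{p,p-1})$. Its spectral sequence has, for $r\ge1$, the pages $E^r_{p,q}=Z^r_{p,q}/B^r_{p,q}$ with $$Z^r_{p,q}=\partial^{-1}\operatorname{im}\big(h^{q+1}(A_{p-r})\to h^{q+1}(A_{p-1})\big),\qquad B^r_{p,q}=\iota^*\ker\big(h^q(A_p)\to h^q(A_{p+r-1})\big),$$ and the differentials $d^r:E^r_{p,q}\to E^r_{p-r,q+1}$, $[x]\mapsto[\iota^*y]$, where $y\in h^{q+1}(A_{p-r})$ is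 any element with image $\partial x$ in $h^{q+1}(A_{p-1})$. *Claim.* 1. $d^r\circ d^r=0$, and the homology of $(E^r,d^r)$ is $E^{r+1}$, through the isomorphism induced by $Z^{r+1}_{p,q}\subseteq Z^r_{p,q}$. 2. The spectral sequence converges to $h^*(A)$: with $F^p_q=\operatorname{im}(h^q(A_p)\to h^q(A))$ one has $F^{p-1}_q\subseteq F^p_q$ for all $p$, $F^p_q=0$ for $p<0$, $F^p_q=h^q(A)$ for $p\ge\dim X$, and for all $p,q$ there is an $r_0$ with $E^r_{p,q}\cong F^p_q/F^{p-1}_q$ for all $r\ge r_0$. 3. If $h^*$ is $\sigma$-additive or $X$ is finite, then for all $p\ge0$ and $q\in\mathbb Z$ $$E^2_{p,q}\cong H_p^{\mathrm{fin}}(X;\mathcal H^{p+q}).$$ 4. If $h^*$ is $\sigma$-multiplicative, then for all $p\ge0$ and $q\in\mathbb Z$ $$E^2_{p,q}\cong H_p(X;\mathcal H^{p+q}).$$ For $p<0$, $E^2_{p,q}=0$. -/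

import Mathlib

universe u v w

noncomputable section

/-! ### Closed ideals and quotients of C*-algebras -/

/-- A closed two-sided self-adjoint ideal of a C*-algebra. -/
structure ClosedIdeal (A : Type u) [NonUnitalCStarAlgebra A] extends Submodule ℂ A where
  closed : IsClosed carrier
  mul_left : ∀ (a : A) {x : A}, x ∈ carrier → a * x ∈ carrier
  mul_right : ∀ (a : A) {x : A}, x ∈ carrier → x * a ∈ carrier
  star_mem : ∀ {x : A}, x ∈ carrier → star x ∈ carrier

namespace ClosedIdeal

variable {A : Type u} [NonUnitalCStarAlgebra A]

instance : SetLike (ClosedIdeal A) A where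
  coe I := I.carrier
  coe_injective I J h := by
    cases I; cases J; congr; exact SetLike.coe_injective h

instance : AddSubgroupClass (ClosedIdeal A) A where
  add_mem {I} _ _ h h' := I.add_mem h h'
  zero_mem I := I.zero_mem
  neg_mem {I} _ h := I.toSubmodule.neg_mem h

instance : NonUnitalSubringClass (ClosedIdeal A) A where
  mul_mem {I} a _ _ h := I.mul_left a h

instance : SMulMemClass (ClosedIdeal A) ℂ A where
  smul_mem {I} c _ h := I.smul_mem c h

instance : StarMemClass (ClosedIdeal A) A where
  star_mem {I} _ h := I.star_mem h

instance (I : ClosedIdeal A) : IsClosed (I : Set A) := I.closed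

instance (I : ClosedIdeal A) : IsClosed (I.toSubmodule : Set A) := I.closed

/-- A closed ideal is itself a C*-algebra. -/
instance (I : ClosedIdeal A) : NonUnitalCStarAlgebra I :=
  NonUnitalStarSubalgebra.nonUnitalCStarAlgebra I

/-- The inclusion of a closed ideal. -/
def incl (I : ClosedIdeal A) : I →⋆ₙₐ[ℂ] A where
  toFun x := x
  map_smul' _ _ := rfl
  map_zero' := rfl
  map_add' _ _ := rfl
  map_mul' _ _ := rfl
  map_star' _ := rfl

/-- The quotient C*-algebra `A / I`, with the quotient norm. -/
def Quot (I : ClosedIdeal A) : Type u := A ⧸ I.toSubmodule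

variable (I : ClosedIdeal A)

instance : NormedAddCommGroup I.Quot :=
  inferInstanceAs (NormedAddCommGroup (A ⧸ I.toSubmodule))

instance : NormedSpace ℂ I.Quot :=
  inferInstanceAs (NormedSpace ℂ (A ⧸ I.toSubmodule))

instance : CompleteSpace I.Quot :=
  inferInstanceAs (CompleteSpace (A ⧸ I.toSubmodule))

/-- The quotient map on elements. -/
def toQuot (a : A) : I.Quot := Submodule.Quotient.mk a

lemma toQuot_surjective : Function.Surjective I.toQuot :=
  Submodule.Quotient.mk_surjective _

lemma toQuot_eq_iff {a b : A} : I.toQuot a = I.toQuot b ↔ a - b ∈ I :=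
  Submodule.Quotient.eq I.toSubmodule

lemma toQuot_eq_zero {a : A} : I.toQuot a = 0 ↔ a ∈ I :=
  Submodule.Quotient.mk_eq_zero I.toSubmodule

lemma norm_toQuot_le (a : A) : ‖I.toQuot a‖ ≤ ‖a‖ :=
  Submodule.Quotient.norm_mk_le I.toSubmodule a

lemma exists_norm_lt (x : I.Quot) {ε : ℝ} (hε : 0 < ε) :
    ∃ a, I.toQuot a = x ∧ ‖a‖ < ‖x‖ + ε :=
  Submodule.Quotient.norm_mk_lt x hε

instance : Mul I.Quot where
  mul := Quotient.map₂ (· * ·) (by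
    intro a b h c d h'
    have h1 : a - b ∈ I := I.toQuot_eq_iff.1 (_root_.Quotient.sound h)
    have h2 : c - d ∈ I := I.toQuot_eq_iff.1 (_root_.Quotient.sound h')
    apply _root_.Quotient.exact
    refine I.toQuot_eq_iff.2 ?_
    have : a * c - b * d = (a - b) * c + b * (c - d) := by noncomm_ring
    show a * c - b * d ∈ I
    rw [this]
    exact add_mem (I.mul_right c h1) (I.mul_left b h2))

lemma toQuot_mul (a b : A) : I.toQuot (a * b) = I.toQuot a * I.toQuot b := rfl

instance : Star I.Quot where
  star := Quotient.map star (by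
    intro a b h
    have h1 : a - b ∈ I := I.toQuot_eq_iff.1 (_root_.Quotient.sound h)
    apply _root_.Quotient.exact
    refine I.toQuot_eq_iff.2 ?_
    rw [← star_sub]
    exact I.star_mem h1)

lemma toQuot_star (a : A) : I.toQuot (star a) = star (I.toQuot a) := rfl

lemma toQuot_add (a b : A) : I.toQuot (a + b) = I.toQuot a + I.toQuot b := rfl

lemma toQuot_smul (c : ℂ) (a : A) : I.toQuot (c • a) = c • I.toQuot a := rfl

instance : NonUnitalRing I.Quot where
  left_distrib x y z := by
    obtain ⟨a, rfl⟩ := I.toQuot_surjective x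
    obtain ⟨b, rfl⟩ := I.toQuot_surjective y
    obtain ⟨c, rfl⟩ := I.toQuot_surjective z
    simp only [← toQuot_mul, ← toQuot_add, mul_add]
  right_distrib x y z := by
    obtain ⟨a, rfl⟩ := I.toQuot_surjective x
    obtain ⟨b, rfl⟩ := I.toQuot_surjective y
    obtain ⟨c, rfl⟩ := I.toQuot_surjective z
    simp only [← toQuot_mul, ← toQuot_add, add_mul]
  zero_mul x := by
    obtain ⟨a, rfl⟩ := I.toQuot_surjective x
    rw [← I.toQuot_eq_zero.2 (zero_mem I), ← toQuot_mul, zero_mul]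
  mul_zero x := by
    obtain ⟨a, rfl⟩ := I.toQuot_surjective x
    rw [← I.toQuot_eq_zero.2 (zero_mem I), ← toQuot_mul, mul_zero]
  mul_assoc x y z := by
    obtain ⟨a, rfl⟩ := I.toQuot_surjective x
    obtain ⟨b, rfl⟩ := I.toQuot_surjective y
    obtain ⟨c, rfl⟩ := I.toQuot_surjective z
    simp only [← toQuot_mul, mul_assoc]

instance : NonUnitalNormedRing I.Quot where
  dist_eq := dist_eq_norm_neg_add
  norm_mul_le x y := by
    refine le_of_forall_pos_le_add fun ε hε => ?_
    have hc : Filter.Tendsto (fun δ : ℝ => (‖x‖ + δ) * (‖y‖ + δ)) (nhdsWithin 0 (Set.Ioi 0))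
        (nhds (‖x‖ * ‖y‖)) := by
      have : Continuous (fun δ : ℝ => (‖x‖ + δ) * (‖y‖ + δ)) := by fun_prop
      simpa using (this.tendsto 0).mono_left nhdsWithin_le_nhds
    obtain ⟨δ, hδ, hδ0⟩ := ((hc.eventually (gt_mem_nhds (show ‖x‖ * ‖y‖ < ‖x‖ * ‖y‖ + ε by
      linarith))).and self_mem_nhdsWithin).exists
    obtain ⟨a, rfl, ha⟩ := I.exists_norm_lt x hδ0
    obtain ⟨b, rfl, hb⟩ := I.exists_norm_lt y hδ0
    rw [← toQuot_mul]
    calc _ ≤ ‖a * b‖ := I.norm_toQuot_le _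
      _ ≤ ‖a‖ * ‖b‖ := norm_mul_le _ _
      _ ≤ _ := by gcongr
      _ ≤ _ := hδ.le

instance : StarRing I.Quot where
  star_involutive x := by
    obtain ⟨a, rfl⟩ := I.toQuot_surjective x
    rw [← toQuot_star, ← toQuot_star, star_star]
  star_mul x y := by
    obtain ⟨a, rfl⟩ := I.toQuot_surjective x
    obtain ⟨b, rfl⟩ := I.toQuot_surjective y
    simp only [← toQuot_star, ← toQuot_mul, star_mul]
  star_add x y := by
    obtain ⟨a, rfl⟩ := I.toQuot_surjective x
    obtain ⟨b, rfl⟩ := I.toQuot_surjective y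
    simp only [← toQuot_star, ← toQuot_add, star_add]

/-- Near-optimal cut-offs coming from an approximate unit of the ideal. -/
lemma exists_cutoff {j : A} (hj : j ∈ I) {ε : ℝ} (hε : 0 < ε) :
    ∃ u ∈ I, ‖(1 : Unitization ℂ A) - (u : Unitization ℂ A)‖ ≤ 1 ∧
      star u = u ∧ ‖j - j * u‖ < ε := by
  let _ := CStarAlgebra.spectralOrder I
  have := CStarAlgebra.spectralOrderedRing I
  have hl := CStarAlgebra.increasingApproximateUnit I
  have h1 := hl.tendsto_mul_left ⟨j, hj⟩
  have h2 := (Metric.tendsto_nhds.1 h1) ε hε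
  obtain ⟨u, ⟨⟨hu0, hu1⟩, hu2⟩, hu3⟩ :=
    (((hl.eventually_nonneg.and hl.eventually_norm).and h2).and hl.eventually_star_eq).exists
  refine ⟨u, u.2, ?_, congrArg Subtype.val hu3, ?_⟩
  · let _ := CStarAlgebra.spectralOrder (Unitization ℂ A)
    have := CStarAlgebra.spectralOrderedRing (Unitization ℂ A)
    obtain ⟨s, hs⟩ := (CStarAlgebra.nonneg_iff_eq_star_mul_self).1 hu0
    have e : ((u : A) : Unitization ℂ A) = star ((s : A) : Unitization ℂ A) * ((s : A) : Unitization ℂ A) := by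
      rw [hs, ← Unitization.inr_star, ← Unitization.inr_mul]; rfl
    have p0 : 0 ≤ ((u : A) : Unitization ℂ A) := by rw [e]; exact star_mul_self_nonneg _
    have p1 : ((u : A) : Unitization ℂ A) ≤ 1 := by
      rw [← CStarAlgebra.norm_le_one_iff_of_nonneg _ p0, Unitization.norm_inr]
      exact hu1
    rw [CStarAlgebra.norm_le_one_iff_of_nonneg _ (sub_nonneg.2 p1)]
    exact sub_le_self _ p0
  · rw [dist_comm, dist_eq_norm] at hu2
    exact hu2

instance : CStarRing I.Quot where
  norm_mul_self_le x := by
    obtain ⟨a, rfl⟩ := I.toQuot_surjective x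
    rw [← toQuot_star, ← toQuot_mul]
    refine le_of_forall_pos_le_add fun ε hε => ?_
    obtain ⟨b, hb, hb'⟩ := I.exists_norm_lt (I.toQuot (star a * a)) (half_pos hε)
    have hj : star a * a - b ∈ I := I.toQuot_eq_iff.1 hb.symm
    obtain ⟨u, huI, hu1, hus, hu2⟩ := I.exists_cutoff hj (half_pos hε)
    have k1 : ‖I.toQuot a‖ ≤ ‖a - a * u‖ := by
      have : I.toQuot a = I.toQuot (a - a * u) := by
        rw [toQuot_eq_iff]; rw [sub_sub_cancel]; exact I.mul_left a huI
      rw [this]; exact I.norm_toQuot_le _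
    have k2 : ‖a - a * u‖ * ‖a - a * u‖ ≤ ‖star a * a - star a * a * u‖ := by
      rw [← CStarRing.norm_star_mul_self, ← Unitization.norm_inr (𝕜 := ℂ),
        ← Unitization.norm_inr (𝕜 := ℂ) (star a * a - star a * a * u)]
      have : (((star (a - a * u) * (a - a * u) : A)) : Unitization ℂ A)
          = (1 - (u : Unitization ℂ A)) * ((star a * a - star a * a * u : A) : Unitization ℂ A) := by
        rw [sub_mul, one_mul, ← Unitization.inr_mul, ← Unitization.inr_sub, star_sub, star_mul, hus]
        congr 1
        noncomm_ring
      rw [this]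
      exact (norm_mul_le _ _).trans (mul_le_of_le_one_left (norm_nonneg _) hu1)
    have k3 : ‖star a * a - star a * a * u‖ ≤ ‖b‖ + ε / 2 := by
      have e : star a * a - star a * a * u
          = (b - b * u) + ((star a * a - b) - (star a * a - b) * u) := by noncomm_ring
      have k4 : ‖b - b * u‖ ≤ ‖b‖ := by
        rw [← Unitization.norm_inr (𝕜 := ℂ), ← Unitization.norm_inr (𝕜 := ℂ) b]
        have : ((b - b * u : A) : Unitization ℂ A) = (b : Unitization ℂ A) * (1 - (u : Unitization ℂ A)) := by
          rw [mul_sub, mul_one, ← Unitization.inr_mul, ← Unitization.inr_sub]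
        rw [this]
        exact (norm_mul_le _ _).trans (mul_le_of_le_one_right (norm_nonneg _) hu1)
      rw [e]
      exact (norm_add_le _ _).trans (add_le_add k4 hu2.le)
    calc _ ≤ ‖a - a * u‖ * ‖a - a * u‖ := by gcongr
      _ ≤ _ := by linarith

instance : NonUnitalCStarAlgebra I.Quot where
  smul_assoc c x y := by
    obtain ⟨a, rfl⟩ := I.toQuot_surjective x
    obtain ⟨b, rfl⟩ := I.toQuot_surjective y
    simp only [smul_eq_mul, ← toQuot_smul, ← toQuot_mul, smul_mul_assoc]
  smul_comm c x y := by
    obtain ⟨a, rfl⟩ := I.toQuot_surjective x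
    obtain ⟨b, rfl⟩ := I.toQuot_surjective y
    simp only [smul_eq_mul, ← toQuot_smul, ← toQuot_mul, mul_smul_comm]
  star_smul c x := by
    obtain ⟨a, rfl⟩ := I.toQuot_surjective x
    simp only [← toQuot_smul, ← toQuot_star, star_smul]

/-- The quotient `*`-homomorphism `A → A / I`. -/
def proj : A →⋆ₙₐ[ℂ] I.Quot where
  toFun := I.toQuot
  map_smul' _ _ := rfl
  map_zero' := rfl
  map_add' _ _ := rfl
  map_mul' _ _ := rfl
  map_star' _ := rfl

lemma proj_surjective : Function.Surjective I.proj := I.toQuot_surjective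

lemma proj_eq_zero {a : A} : I.proj a = 0 ↔ a ∈ I := I.toQuot_eq_zero

/-- The `*`-homomorphism `A / I → B` induced by a `*`-homomorphism `A → B` that vanishes on `I`. -/
def lift {B : Type v} [NonUnitalCStarAlgebra B] (φ : A →⋆ₙₐ[ℂ] B) (h : ∀ a ∈ I, φ a = 0) :
    I.Quot →⋆ₙₐ[ℂ] B where
  toFun := Quotient.lift φ (by
    intro a b hab
    have h1 : a - b ∈ I := I.toQuot_eq_iff.1 (_root_.Quotient.sound hab)
    rw [← sub_eq_zero, ← map_sub]
    exact h _ h1)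
  map_smul' c x := by
    obtain ⟨a, rfl⟩ := I.toQuot_surjective x
    exact map_smul φ c a
  map_zero' := map_zero φ
  map_add' x y := by
    obtain ⟨a, rfl⟩ := I.toQuot_surjective x
    obtain ⟨b, rfl⟩ := I.toQuot_surjective y
    exact map_add φ a b
  map_mul' x y := by
    obtain ⟨a, rfl⟩ := I.toQuot_surjective x
    obtain ⟨b, rfl⟩ := I.toQuot_surjective y
    exact map_mul φ a b
  map_star' x := by
    obtain ⟨a, rfl⟩ := I.toQuot_surjective x
    exact map_star φ a

@[simp] lemma lift_proj {B : Type v} [NonUnitalCStarAlgebra B] (φ : A →⋆ₙₐ[ℂ] B)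
    (h : ∀ a ∈ I, φ a = 0) (a : A) : I.lift φ h (I.proj a) = φ a := rfl

/-- The kernel of a `*`-homomorphism. -/
def ker {B : Type v} [NonUnitalCStarAlgebra B] (φ : A →⋆ₙₐ[ℂ] B) : ClosedIdeal A where
  carrier := {a | φ a = 0}
  add_mem' {a b} (ha : φ a = 0) (hb : φ b = 0) := show φ (a + b) = 0 by rw [map_add, ha, hb, add_zero]
  zero_mem' := map_zero φ
  smul_mem' c a (ha : φ a = 0) := show φ (c • a) = 0 by rw [map_smul, ha, smul_zero]
  closed := by
    have hc : Continuous φ := AddMonoidHomClass.continuous_of_bound φ 1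
      (fun x => by simpa using NonUnitalStarAlgHom.norm_apply_le φ x)
    exact isClosed_eq hc continuous_const
  mul_left a x (hx : φ x = 0) := show φ (a * x) = 0 by rw [map_mul, hx, mul_zero]
  mul_right a x (hx : φ x = 0) := show φ (x * a) = 0 by rw [map_mul, hx, zero_mul]
  star_mem {x} (hx : φ x = 0) := show φ (star x) = 0 by rw [map_star, hx, star_zero]

end ClosedIdeal
/-! ### `C₀(X)`-algebras -/

/-- A `C₀(X)`-algebra structure on `A`: a non-degenerate `*`-homomorphism from `C₀(X)` to the
center of the multiplier algebra `M(A)`. The multiplier `m` acts on `A` by `m.fst`. -/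
structure C0Algebra (X : Type v) [TopologicalSpace X] (A : Type u) [NonUnitalCStarAlgebra A] where
  Φ : ZeroAtInftyContinuousMap X ℂ →⋆ₙₐ[ℂ] DoubleCentralizer ℂ A
  central : ∀ (f : ZeroAtInftyContinuousMap X ℂ) (m : DoubleCentralizer ℂ A), Φ f * m = m * Φ f
  nondegenerate : Dense (Submodule.span ℂ {b : A | ∃ f a, b = (Φ f).fst a} : Set A)

namespace C0Algebra

variable {X : Type v} [TopologicalSpace X] {A : Type u} [NonUnitalCStarAlgebra A]
  (𝒜 : C0Algebra X A)

lemma mul_act (f : ZeroAtInftyContinuousMap X ℂ) (a b : A) :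
    a * (𝒜.Φ f).fst b = (𝒜.Φ f).fst (a * b) :=
  (congrArg (fun m : DoubleCentralizer ℂ A => m.fst b)
    (𝒜.central f (DoubleCentralizer.coe ℂ a))).symm

lemma act_mul (f : ZeroAtInftyContinuousMap X ℂ) (a b : A) :
    (𝒜.Φ f).fst a * b = (𝒜.Φ f).fst (a * b) := by
  have key : ∀ x : A, x * ((𝒜.Φ f).fst a * b - (𝒜.Φ f).fst (a * b)) = 0 := fun x => by
    rw [mul_sub, ← mul_assoc, ← (𝒜.Φ f).central, ← (𝒜.Φ f).central, mul_assoc, sub_self]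
  exact sub_eq_zero.1 ((CStarRing.star_mul_self_eq_zero_iff _).1 (key _))

lemma snd_eq_fst (f : ZeroAtInftyContinuousMap X ℂ) (a : A) :
    (𝒜.Φ f).snd a = (𝒜.Φ f).fst a := by
  have key : ∀ x : A, ((𝒜.Φ f).snd a - (𝒜.Φ f).fst a) * x = 0 := fun x => by
    rw [sub_mul, (𝒜.Φ f).central, mul_act, act_mul, sub_self]
  exact sub_eq_zero.1 ((CStarRing.mul_star_self_eq_zero_iff _).1 (key _))

lemma star_act (f : ZeroAtInftyContinuousMap X ℂ) (a : A) :
    star ((𝒜.Φ f).fst a) = (𝒜.Φ (star f)).fst (star a) := by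
  rw [map_star 𝒜.Φ f, DoubleCentralizer.star_fst, star_star, snd_eq_fst]

/-- The closed ideal of `A` spanned by the elements `f · a` with `f ∈ C₀(X)` vanishing on `Y`;
for closed `Y` this is the ideal `A|_{X ∖ Y}`, and for `Y = {x}` it is the ideal `I_x`. -/
def vanishing (Y : Set X) : ClosedIdeal A :=
  let S : Submodule ℂ A := Submodule.span ℂ
    {b : A | ∃ f a, (∀ y ∈ Y, f y = 0) ∧ b = (𝒜.Φ f).fst a}
  { S.topologicalClosure with
    closed := S.isClosed_topologicalClosure
    mul_left := by
      intro a x hx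
      refine map_mem_closure (f := fun z => a * z) (continuous_const_mul a) hx fun y hy => ?_
      change a * y ∈ S
      refine Submodule.span_induction ?_ ?_ ?_ ?_ hy
      · rintro _ ⟨f, b, hf, rfl⟩
        exact Submodule.subset_span ⟨f, a * b, hf, 𝒜.mul_act f a b⟩
      · rw [mul_zero]; exact zero_mem S
      · intro x y _ _ h1 h2; rw [mul_add]; exact S.add_mem h1 h2
      · intro c x _ h1; rw [mul_smul_comm]; exact S.smul_mem c h1
    mul_right := by
      intro a x hx
      refine map_mem_closure (f := fun z => z * a) (continuous_mul_const a) hx fun y hy => ?_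
      change y * a ∈ S
      refine Submodule.span_induction ?_ ?_ ?_ ?_ hy
      · rintro _ ⟨f, b, hf, rfl⟩
        exact Submodule.subset_span ⟨f, b * a, hf, 𝒜.act_mul f b a⟩
      · rw [zero_mul]; exact zero_mem S
      · intro x y _ _ h1 h2; rw [add_mul]; exact S.add_mem h1 h2
      · intro c x _ h1; rw [smul_mul_assoc]; exact S.smul_mem c h1
    star_mem := by
      intro x hx
      refine map_mem_closure continuous_star hx fun y hy => ?_
      change star y ∈ S
      refine Submodule.span_induction ?_ ?_ ?_ ?_ hy
      · rintro _ ⟨f, b, hf, rfl⟩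
        refine Submodule.subset_span ⟨star f, star b, fun y hy => ?_, 𝒜.star_act f b⟩
        rw [ZeroAtInftyContinuousMap.star_apply, hf y hy, star_zero]
      · rw [star_zero]; exact zero_mem S
      · intro x y _ _ h1 h2; rw [star_add]; exact S.add_mem h1 h2
      · intro c x _ h1; rw [star_smul]; exact S.smul_mem _ h1 }

lemma vanishing_anti {Y Z : Set X} (h : Y ⊆ Z) {a : A} (ha : a ∈ 𝒜.vanishing Z) :
    a ∈ 𝒜.vanishing Y :=
  closure_mono (Submodule.span_mono (by
    rintro _ ⟨f, b, hf, rfl⟩; exact ⟨f, b, fun y hy => hf y (h hy), rfl⟩)) ha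

/-- The restriction `A|_Y` of the bundle to a closed subset `Y`. -/
abbrev Restrict (Y : Set X) : Type u := (𝒜.vanishing Y).Quot

/-- The fibre `A_x = A / I_x`. -/
abbrev Fibre (x : X) : Type u := 𝒜.Restrict {x}

/-- The quotient map `A|_Z → A|_Y` for closed subsets `Y ⊆ Z`. -/
def res {Y Z : Set X} (h : Y ⊆ Z) : 𝒜.Restrict Z →⋆ₙₐ[ℂ] 𝒜.Restrict Y :=
  (𝒜.vanishing Z).lift (𝒜.vanishing Y).proj
    fun _ ha => (𝒜.vanishing Y).proj_eq_zero.2 (𝒜.vanishing_anti h ha)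

/-- The restriction `A|_{Z ∖ Y}` to the locally closed set `Z ∖ Y`, for closed `Y ⊆ Z`:
the ideal of `A|_Z` which is the kernel of `A|_Z → A|_Y`. -/
def relIdeal {Y Z : Set X} (h : Y ⊆ Z) : ClosedIdeal (𝒜.Restrict Z) := ClosedIdeal.ker (𝒜.res h)

lemma res_surjective {Y Z : Set X} (h : Y ⊆ Z) : Function.Surjective (𝒜.res h) := fun x => by
  obtain ⟨a, rfl⟩ := (𝒜.vanishing Y).proj_surjective x
  exact ⟨(𝒜.vanishing Z).proj a, rfl⟩

/-! #### Pull-backs along maps from compact spaces -/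

section Pullback

variable {Y : Type} [TopologicalSpace Y] [CompactSpace Y]

/-- Composition with a continuous map, as a `*`-homomorphism `C(Y, A) → C(Z, A)`. -/
def precomp (A : Type u) [NonUnitalCStarAlgebra A] {Z : Type} [TopologicalSpace Z] [CompactSpace Z]
    (g : C(Z, Y)) : C(Y, A) →⋆ₙₐ[ℂ] C(Z, A) where
  toFun F := F.comp g
  map_smul' _ _ := rfl
  map_zero' := rfl
  map_add' _ _ := rfl
  map_mul' _ _ := rfl
  map_star' _ := rfl

/-- Evaluation at a point, as a `*`-homomorphism `C(Y, A) → A`. -/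
def evalHom (A : Type u) [NonUnitalCStarAlgebra A] (y : Y) : C(Y, A) →⋆ₙₐ[ℂ] A where
  toFun F := F y
  map_smul' _ _ := rfl
  map_zero' := rfl
  map_add' _ _ := rfl
  map_mul' _ _ := rfl
  map_star' _ := rfl

/-- The ideal `I_f` of `C(Y) ⊗ A = C(Y, A)` of all functions `F` whose value `F y` vanishes in the
fibre `A_{f y}`, for every `y`. -/
def pullbackIdeal (f : C(Y, X)) : ClosedIdeal C(Y, A) where
  carrier := {F | ∀ y, F y ∈ 𝒜.vanishing {f y}}
  add_mem' ha hb y := add_mem (ha y) (hb y)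
  zero_mem' y := zero_mem (𝒜.vanishing {f y})
  smul_mem' c _ ha y := (𝒜.vanishing {f y}).smul_mem c (ha y)
  closed := by
    have : {F : C(Y, A) | ∀ y, F y ∈ 𝒜.vanishing {f y}}
        = ⋂ y, (fun F : C(Y, A) => F y) ⁻¹' (𝒜.vanishing {f y} : Set A) := by
      ext F; simp
    change IsClosed {F : C(Y, A) | ∀ y, F y ∈ 𝒜.vanishing {f y}}
    rw [this]
    exact isClosed_iInter fun y => (𝒜.vanishing {f y}).closed.preimage (continuous_eval_const y)
  mul_left G _ hF y := (𝒜.vanishing {f y}).mul_left (G y) (hF y)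
  mul_right G _ hF y := (𝒜.vanishing {f y}).mul_right (G y) (hF y)
  star_mem hF y := (𝒜.vanishing {f y}).star_mem (hF y)

/-- The pull-back `f^*A = (C(Y) ⊗ A) / I_f`, a `C(Y)`-algebra with fibres `A_{f y}`. -/
abbrev Pullback (f : C(Y, X)) : Type u := (𝒜.pullbackIdeal f).Quot

/-- The evaluation map `q_v : f^*A → A_x`, where `x = f v`. -/
def evalAt (f : C(Y, X)) (v : Y) {x : X} (hx : f v = x) : 𝒜.Pullback f →⋆ₙₐ[ℂ] 𝒜.Fibre x :=
  (𝒜.pullbackIdeal f).lift ((𝒜.vanishing {x}).proj.comp (evalHom A v))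
    fun _ hF => (𝒜.vanishing {x}).proj_eq_zero.2 (hx ▸ hF v)

/-- The canonical map `f^*A → f'^*A` for `f' = f ∘ g`. -/
def pullbackMap {Z : Type} [TopologicalSpace Z] [CompactSpace Z] (f : C(Y, X)) (f' : C(Z, X))
    (g : C(Z, Y)) (hg : ∀ z, f (g z) = f' z) : 𝒜.Pullback f →⋆ₙₐ[ℂ] 𝒜.Pullback f' :=
  (𝒜.pullbackIdeal f).lift ((𝒜.pullbackIdeal f').proj.comp (precomp A g))
    fun _ hF => (𝒜.pullbackIdeal f').proj_eq_zero.2 fun z => hg z ▸ hF (g z)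

end Pullback

end C0Algebra
/-! ### Good subcategories -/

/-- `0 → J → A → B → 0` is a short exact sequence of C*-algebras. -/
structure IsShortExact {J A B : Type u} [NonUnitalCStarAlgebra J] [NonUnitalCStarAlgebra A]
    [NonUnitalCStarAlgebra B] (i : J →⋆ₙₐ[ℂ] A) (q : A →⋆ₙₐ[ℂ] B) : Prop where
  injective : Function.Injective i
  surjective : Function.Surjective q
  exact : ∀ a, q a = 0 ↔ ∃ j, i j = a

/-- A good subcategory of the category of C*-algebras: a full subcategory (given by its class of
objects) that contains `ℂ` and is closed under ideals, quotients, extensions and suspension.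
Closure under isomorphism is the case `B = 0` of `ideal_mem`. -/
structure GoodSubcategory where
  Mem : ∀ (A : Type u) [NonUnitalCStarAlgebra A], Prop
  complex_mem : ∃ (A : Type u) (_ : NonUnitalCStarAlgebra A), Mem A ∧ Nonempty (A ≃⋆ₐ[ℂ] ℂ)
  ideal_mem : ∀ {J A B : Type u} [NonUnitalCStarAlgebra J] [NonUnitalCStarAlgebra A]
    [NonUnitalCStarAlgebra B] (i : J →⋆ₙₐ[ℂ] A) (q : A →⋆ₙₐ[ℂ] B),
    IsShortExact i q → Mem A → Mem J
  quotient_mem : ∀ {J A B : Type u} [NonUnitalCStarAlgebra J] [NonUnitalCStarAlgebra A]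
    [NonUnitalCStarAlgebra B] (i : J →⋆ₙₐ[ℂ] A) (q : A →⋆ₙₐ[ℂ] B),
    IsShortExact i q → Mem A → Mem B
  extension_mem : ∀ {J A B : Type u} [NonUnitalCStarAlgebra J] [NonUnitalCStarAlgebra A]
    [NonUnitalCStarAlgebra B] (i : J →⋆ₙₐ[ℂ] A) (q : A →⋆ₙₐ[ℂ] B),
    IsShortExact i q → Mem J → Mem B → Mem A
  suspension_mem : ∀ (A : Type u) [NonUnitalCStarAlgebra A], Mem A →
    Mem (ZeroAtInftyContinuousMap ℝ A)

lemma ClosedIdeal.shortExact_ker {A B : Type u} [NonUnitalCStarAlgebra A]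
    [NonUnitalCStarAlgebra B] (q : A →⋆ₙₐ[ℂ] B) (hq : Function.Surjective q) :
    IsShortExact (ClosedIdeal.ker q).incl q where
  injective _ _ h := Subtype.ext h
  surjective := hq
  exact a := ⟨fun h => ⟨⟨a, h⟩, rfl⟩, by rintro ⟨j, rfl⟩; exact j.2⟩

lemma ClosedIdeal.shortExact_quot {A : Type u} [NonUnitalCStarAlgebra A] (I : ClosedIdeal A) :
    IsShortExact I.incl I.proj where
  injective _ _ h := Subtype.ext h
  surjective := I.proj_surjective
  exact a := ⟨fun h => ⟨⟨a, I.proj_eq_zero.1 h⟩, rfl⟩, by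
    rintro ⟨j, rfl⟩; exact I.proj_eq_zero.2 j.2⟩

namespace GoodSubcategory

variable (C : GoodSubcategory.{u})

section Membership

variable {A B : Type u} [NonUnitalCStarAlgebra A] [NonUnitalCStarAlgebra B]

lemma mem_of_surjective (q : A →⋆ₙₐ[ℂ] B) (hq : Function.Surjective q) (h : C.Mem A) : C.Mem B :=
  C.quotient_mem _ q (ClosedIdeal.shortExact_ker q hq) h

lemma mem_quot (I : ClosedIdeal A) (h : C.Mem A) : C.Mem I.Quot :=
  C.mem_of_surjective I.proj I.proj_surjective h

lemma mem_ideal (I : ClosedIdeal A) (h : C.Mem A) : C.Mem I :=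
  C.ideal_mem _ _ I.shortExact_quot h

lemma mem_of_ker (q : A →⋆ₙₐ[ℂ] B) (hq : Function.Surjective q)
    (hJ : C.Mem (ClosedIdeal.ker q)) (hB : C.Mem B) : C.Mem A :=
  C.extension_mem _ q (ClosedIdeal.shortExact_ker q hq) hJ hB

lemma mem_of_bijective (q : A →⋆ₙₐ[ℂ] B) (hq : Function.Bijective q) (h : C.Mem B) : C.Mem A := by
  refine C.ideal_mem q (ClosedIdeal.ker (0 : B →⋆ₙₐ[ℂ] B)).proj ⟨hq.1, ?_, fun b => ?_⟩ h
  · exact ClosedIdeal.proj_surjective _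
  · exact ⟨fun _ => hq.2 b, fun _ => (ClosedIdeal.proj_eq_zero _).2 rfl⟩

lemma mem_prod (hA : C.Mem A) (hB : C.Mem B) : C.Mem (A × B) := by
  refine C.mem_of_ker (NonUnitalStarAlgHom.fst ℂ A B) (fun a => ⟨(a, 0), rfl⟩) ?_ hA
  refine C.mem_of_bijective
    ((NonUnitalStarAlgHom.snd ℂ A B).comp (ClosedIdeal.ker (NonUnitalStarAlgHom.fst ℂ A B)).incl)
    ⟨?_, fun b => ⟨⟨(0, b), rfl⟩, rfl⟩⟩ hB
  rintro ⟨⟨a, b⟩, (ha : a = 0)⟩ ⟨⟨a', b'⟩, (ha' : a' = 0)⟩ (h : b = b')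
  subst ha ha' h
  rfl

/-- The compact spaces `Y` such that `C(Y, A)` belongs to the good subcategory for each `A` in it. -/
def Admissible (Y : Type) [TopologicalSpace Y] [CompactSpace Y] : Prop :=
  ∀ (A : Type u) [NonUnitalCStarAlgebra A], C.Mem A → C.Mem C(Y, A)

lemma admissible_of_retract {Y Z : Type} [TopologicalSpace Y] [CompactSpace Y] [TopologicalSpace Z]
    [CompactSpace Z] (s : C(Y, Z)) (r : C(Z, Y)) (h : ∀ y, r (s y) = y) (hZ : C.Admissible Z) :
    C.Admissible Y := fun A _ hA =>
  C.mem_of_surjective (C0Algebra.precomp A s)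
    (fun F => ⟨F.comp r, ContinuousMap.ext fun y => congrArg F (h y)⟩) (hZ A hA)

lemma admissible_unitInterval : C.Admissible unitInterval := by
  intro A _ hA
  let q : C(unitInterval, A) →⋆ₙₐ[ℂ] A × A :=
    NonUnitalStarAlgHom.prod (C0Algebra.evalHom A 0) (C0Algebra.evalHom A 1)
  have hq : Function.Surjective q := by
    rintro ⟨a, b⟩
    refine ⟨⟨fun t => ((1 - t : ℝ) : ℂ) • a + ((t : ℝ) : ℂ) • b, by fun_prop⟩, ?_⟩
    refine Prod.ext ?_ ?_
    · change ((1 - (0 : unitInterval) : ℝ) : ℂ) • a + (((0 : unitInterval) : ℝ) : ℂ) • b = a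
      simp
    · change ((1 - (1 : unitInterval) : ℝ) : ℂ) • a + (((1 : unitInterval) : ℝ) : ℂ) • b = b
      simp
  refine C.mem_of_ker q hq ?_ (C.mem_prod hA hA)
  have hK : ∀ F : ClosedIdeal.ker q, F.1 0 = 0 ∧ F.1 1 = 0 := fun F =>
    ⟨congrArg Prod.fst (show q F.1 = 0 from F.2), congrArg Prod.snd (show q F.1 = 0 from F.2)⟩
  let i : ClosedIdeal.ker q →⋆ₙₐ[ℂ] ZeroAtInftyContinuousMap ℝ A :=
    { toFun F :=
        { toFun := fun x => F.1 (unitInterval.sigmoid x)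
          continuous_toFun := F.1.continuous.comp unitInterval.continuous_sigmoid
          zero_at_infty' := by
            rw [cocompact_eq_atBot_atTop]
            refine Filter.Tendsto.sup ?_ ?_
            · rw [← (hK F).1]
              exact (F.1.continuous.tendsto 0).comp unitInterval.tendsto_sigmoid_atBot
            · rw [← (hK F).2]
              exact (F.1.continuous.tendsto 1).comp unitInterval.tendsto_sigmoid_atTop }
      map_smul' _ _ := rfl
      map_zero' := rfl
      map_add' _ _ := rfl
      map_mul' _ _ := rfl
      map_star' _ := rfl }
  have hi : ∀ F x, i F x = F.1 (unitInterval.sigmoid x) := fun _ _ => rfl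
  have hmem : ∀ t : unitInterval, t = 0 ∨ t = 1 ∨ ∃ x, unitInterval.sigmoid x = t := fun t => by
    by_cases h0 : t = 0
    · exact Or.inl h0
    by_cases h1 : t = 1
    · exact Or.inr (Or.inl h1)
    have : t ∈ Set.range unitInterval.sigmoid := by
      rw [unitInterval.range_sigmoid]
      exact ⟨unitInterval.pos_iff_ne_zero.2 h0, unitInterval.lt_one_iff_ne_one.2 h1⟩
    exact Or.inr (Or.inr this)
  refine C.mem_of_bijective i ⟨?_, ?_⟩ (C.suspension_mem A hA)
  · intro F G h
    refine Subtype.ext (ContinuousMap.ext fun t => ?_)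
    rcases hmem t with rfl | rfl | ⟨x, rfl⟩
    · rw [(hK F).1, (hK G).1]
    · rw [(hK F).2, (hK G).2]
    · rw [← hi, ← hi, h]
  · intro H
    have hemb : Topology.IsOpenEmbedding unitInterval.sigmoid := by
      refine ⟨unitInterval.sigmoid_strictMono.isEmbedding_of_ordConnected ?_, ?_⟩
      · rw [unitInterval.range_sigmoid]; exact Set.ordConnected_Ioo
      · rw [unitInterval.range_sigmoid]; exact isOpen_Ioo
    let G : unitInterval → A := Function.extend unitInterval.sigmoid H 0
    have hG : ∀ x, G (unitInterval.sigmoid x) = H x := fun x =>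
      unitInterval.sigmoid_injective.extend_apply _ _ x
    have hG0 : ∀ t, (¬ ∃ x, unitInterval.sigmoid x = t) → G t = 0 := fun t ht =>
      Function.extend_apply' _ _ _ ht
    have hGc : Continuous G := by
      rw [continuous_iff_continuousAt]
      intro t
      by_cases ht : ∃ x, unitInterval.sigmoid x = t
      · obtain ⟨x, rfl⟩ := ht
        rw [← hemb.continuousAt_iff]
        have : G ∘ unitInterval.sigmoid = H := funext hG
        rw [this]
        exact H.continuous.continuousAt
      · have e : G t = 0 := hG0 t ht
        rw [ContinuousAt, e, Metric.tendsto_nhds]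
        intro ε hε
        have hz := H.zero_at_infty'
        rw [Metric.tendsto_nhds] at hz
        obtain ⟨S, hS, hS'⟩ := Filter.mem_cocompact.1 (hz ε hε)
        have hc : IsClosed (unitInterval.sigmoid '' S) :=
          (hS.image unitInterval.continuous_sigmoid).isClosed
        have hn : t ∈ (unitInterval.sigmoid '' S)ᶜ := fun ⟨x, _, hx⟩ => ht ⟨x, hx⟩
        filter_upwards [hc.isOpen_compl.mem_nhds hn] with s hs
        by_cases hs' : ∃ x, unitInterval.sigmoid x = s
        · obtain ⟨x, rfl⟩ := hs'
          rw [hG]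
          exact hS' (fun hx => hs ⟨x, hx, rfl⟩)
        · rw [hG0 s hs', dist_self]; exact hε
    refine ⟨⟨⟨G, hGc⟩, Prod.ext (hG0 0 ?_) (hG0 1 ?_)⟩, ?_⟩
    · rintro ⟨x, hx⟩; exact (unitInterval.sigmoid_pos x).ne' hx
    · rintro ⟨x, hx⟩; exact (unitInterval.sigmoid_lt_one x).ne hx
    · ext x; exact hG x

lemma admissible_cube (n : ℕ) : C.Admissible (Fin n → unitInterval) := by
  induction n with
  | zero =>
    intro A _ hA
    refine C.mem_of_bijective (C0Algebra.evalHom A (fun i => i.elim0)) ⟨fun F G h => ?_, fun a => ?_⟩ hA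
    · ext x
      rw [Subsingleton.elim x (fun i => i.elim0)]
      exact h
    · exact ⟨ContinuousMap.const _ a, rfl⟩
  | succ n ih =>
    intro A _ hA
    let e : C(Fin (n + 1) → unitInterval, A) →⋆ₙₐ[ℂ] C(unitInterval, C(Fin n → unitInterval, A)) :=
      { toFun F := ContinuousMap.curry (F.comp ⟨fun z => Fin.cons z.1 z.2, by fun_prop⟩)
        map_smul' _ _ := rfl
        map_zero' := rfl
        map_add' _ _ := rfl
        map_mul' _ _ := rfl
        map_star' _ := rfl }
    refine C.mem_of_bijective e ⟨fun F G h => ?_, fun G => ?_⟩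
      (C.admissible_unitInterval _ (ih A hA))
    · ext x
      have := congrArg (fun H : C(unitInterval, C(Fin n → unitInterval, A)) =>
        H (x 0) (Fin.tail x)) h
      change F (Fin.cons (x 0) (Fin.tail x)) = G (Fin.cons (x 0) (Fin.tail x)) at this
      rwa [Fin.cons_self_tail] at this
    · refine ⟨(ContinuousMap.uncurry G).comp ⟨fun x => (x 0, Fin.tail x), ?_⟩, ?_⟩
      · exact (continuous_apply 0).prodMk (continuous_pi fun i => continuous_apply i.succ)
      · ext t z
        rfl

lemma admissible_stdSimplex (p : ℕ) : C.Admissible (stdSimplex ℝ (Fin (p + 1))) := by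
  have hm : ∀ z : Fin (p + 1) → unitInterval, 0 < max 1 (∑ i, (z i : ℝ)) := fun z =>
    lt_max_of_lt_left one_pos
  refine C.admissible_of_retract (Z := Fin (p + 1) → unitInterval)
    ⟨fun t i => ⟨t.1 i, mem_Icc_of_mem_stdSimplex t.2 i⟩, ?_⟩
    ⟨fun z => ⟨fun i => ((z i : ℝ) + max 0 (1 - ∑ j, (z j : ℝ)) / (p + 1)) /
      max 1 (∑ j, (z j : ℝ)), ?_, ?_⟩, ?_⟩ ?_ (C.admissible_cube _)
  · refine continuous_pi fun i => Continuous.subtype_mk ?_ _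
    exact (continuous_apply i).comp continuous_subtype_val
  · intro i
    have := (z i).2.1
    positivity
  · rw [← Finset.sum_div, div_eq_one_iff_eq (hm z).ne', Finset.sum_add_distrib]
    simp only [Finset.sum_const, Finset.card_univ, Fintype.card_fin, nsmul_eq_mul]
    push_cast
    rw [mul_div_cancel₀ _ (by positivity)]
    rcases le_total (∑ j, (z j : ℝ)) 1 with h | h
    · rw [max_eq_right (by linarith), max_eq_left h]; ring
    · rw [max_eq_left (by linarith), max_eq_right h, add_zero]
  · refine Continuous.subtype_mk (continuous_pi fun i => ?_) _
    refine Continuous.div ?_ ?_ (fun z => (hm z).ne') <;> fun_prop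
  · intro t
    have hs : ∑ j, t.1 j = 1 := t.2.2
    refine Subtype.ext (funext fun i => ?_)
    simp [hs]

end Membership

end GoodSubcategory
namespace GoodSubcategory

/-- The objects of a good subcategory; the morphisms are all `*`-homomorphisms. -/
structure Obj (C : GoodSubcategory.{u}) where
  carrier : Type u
  [str : NonUnitalCStarAlgebra carrier]
  mem : C.Mem carrier

instance (C : GoodSubcategory.{u}) : CoeSort C.Obj (Type u) := ⟨Obj.carrier⟩

instance {C : GoodSubcategory.{u}} (A : C.Obj) : NonUnitalCStarAlgebra A := A.str

end GoodSubcategory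

/-! ### Cohomology theories -/

/-- Homotopy of `*`-homomorphisms. -/
def StarHomotopic {A B : Type u} [NonUnitalCStarAlgebra A] [NonUnitalCStarAlgebra B]
    (φ₀ φ₁ : A →⋆ₙₐ[ℂ] B) : Prop :=
  ∃ H : A →⋆ₙₐ[ℂ] C(unitInterval, B), ∀ a, H a 0 = φ₀ a ∧ H a 1 = φ₁ a

/-- A cohomology theory on a good subcategory: a sequence of contravariant functors `hⁿ` to abelian
groups which are homotopy invariant and have natural long exact sequences
`hⁿ(B) → hⁿ(A) → hⁿ(J) → hⁿ⁺¹(B) → hⁿ⁺¹(A)` for short exact sequences `0 → J → A → B → 0`.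
The connecting map is indexed by `n` and `m` with `n + 1 = m`. -/
structure CohomologyTheory (C : GoodSubcategory.{u}) where
  group : ℤ → C.Obj → Type w
  [addCommGroup : ∀ n A, AddCommGroup (group n A)]
  map : ∀ (n : ℤ) {A B : C.Obj}, (A →⋆ₙₐ[ℂ] B) → group n B →+ group n A
  map_id : ∀ n (A : C.Obj) (x : group n A), map n (NonUnitalStarAlgHom.id ℂ A) x = x
  map_comp : ∀ n {A B D : C.Obj} (φ : A →⋆ₙₐ[ℂ] B) (ψ : B →⋆ₙₐ[ℂ] D) (x : group n D),
    map n (ψ.comp φ) x = map n φ (map n ψ x)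
  map_homotopic : ∀ n {A B : C.Obj} (φ ψ : A →⋆ₙₐ[ℂ] B), StarHomotopic φ ψ → map n φ = map n ψ
  δ : ∀ {n m : ℤ}, n + 1 = m → ∀ {J A B : C.Obj} {i : J →⋆ₙₐ[ℂ] A} {q : A →⋆ₙₐ[ℂ] B},
    IsShortExact i q → group n J →+ group m B
  δ_natural : ∀ {n m : ℤ} (hnm : n + 1 = m) {J A B J' A' B' : C.Obj}
    {i : J →⋆ₙₐ[ℂ] A} {q : A →⋆ₙₐ[ℂ] B} {i' : J' →⋆ₙₐ[ℂ] A'} {q' : A' →⋆ₙₐ[ℂ] B'}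
    (h : IsShortExact i q) (h' : IsShortExact i' q')
    (α : J →⋆ₙₐ[ℂ] J') (β : A →⋆ₙₐ[ℂ] A') (γ : B →⋆ₙₐ[ℂ] B'),
    (∀ a, β (i a) = i' (α a)) → (∀ a, γ (q a) = q' (β a)) →
    ∀ x : group n J', map m γ (δ hnm h' x) = δ hnm h (map n α x)
  exact_middle : ∀ n {J A B : C.Obj} {i : J →⋆ₙₐ[ℂ] A} {q : A →⋆ₙₐ[ℂ] B},
    IsShortExact i q → ∀ x, map n i x = 0 ↔ ∃ y, map n q y = x
  exact_left : ∀ {n m : ℤ} (hnm : n + 1 = m) {J A B : C.Obj} {i : J →⋆ₙₐ[ℂ] A} {q : A →⋆ₙₐ[ℂ] B}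
    (h : IsShortExact i q), ∀ x, δ hnm h x = 0 ↔ ∃ y, map n i y = x
  exact_right : ∀ {n m : ℤ} (hnm : n + 1 = m) {J A B : C.Obj} {i : J →⋆ₙₐ[ℂ] A} {q : A →⋆ₙₐ[ℂ] B}
    (h : IsShortExact i q), ∀ x, map m q x = 0 ↔ ∃ y, δ hnm h y = x

/-- `A` is the (`c₀`-)direct sum of the C*-algebras `B i`, with inclusions `inc i` and
projections `pr i`. -/
structure IsDirectSumCStar {ι : Type} {A : Type u} [NonUnitalCStarAlgebra A] {B : ι → Type u}
    [∀ i, NonUnitalCStarAlgebra (B i)] (inc : ∀ i, B i →⋆ₙₐ[ℂ] A) (pr : ∀ i, A →⋆ₙₐ[ℂ] B i) :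
    Prop where
  pr_inc_same : ∀ i b, pr i (inc i b) = b
  pr_inc_ne : ∀ i j, i ≠ j → ∀ b, pr j (inc i b) = 0
  orthogonal : ∀ i j, i ≠ j → ∀ b c, inc i b * inc j c = 0
  dense : Dense (Submodule.span ℂ {a : A | ∃ i b, inc i b = a} : Set A)

namespace CohomologyTheory

variable {C : GoodSubcategory.{u}} (h : CohomologyTheory.{u, w} C)

instance (n : ℤ) (A : C.Obj) : AddCommGroup (h.group n A) := h.addCommGroup n A

/-- `hⁿ(⊕ Bᵢ) = ⊕ hⁿ(Bᵢ)` for countable direct sums, through the projections. -/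
def SigmaAdditive : Prop :=
  ∀ (ι : Type) [Countable ι] [DecidableEq ι] (B : ι → C.Obj) (A : C.Obj)
    (inc : ∀ i, B i →⋆ₙₐ[ℂ] A) (pr : ∀ i, A →⋆ₙₐ[ℂ] B i), IsDirectSumCStar inc pr → ∀ n,
    Function.Bijective
      (DirectSum.toAddMonoid fun i => h.map n (pr i) : DirectSum ι (fun i => h.group n (B i)) →+ _)

/-- `hⁿ(⊕ Bᵢ) = ∏ hⁿ(Bᵢ)` for countable direct sums, through the inclusions. -/
def SigmaMultiplicative : Prop :=
  ∀ (ι : Type) [Countable ι] (B : ι → C.Obj) (A : C.Obj)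
    (inc : ∀ i, B i →⋆ₙₐ[ℂ] A) (pr : ∀ i, A →⋆ₙₐ[ℂ] B i), IsDirectSumCStar inc pr → ∀ n,
    Function.Bijective fun (x : h.group n A) (i : ι) => h.map n (inc i) x

end CohomologyTheory

/-! ### Fibrations and group bundles -/

/-- An abelian group bundle over `X`: a family of abelian groups with an isomorphism along each
path, compatible with homotopy (relative to end points) and composition of paths. -/
structure GroupBundle (X : Type v) [TopologicalSpace X] where
  fibre : X → Type w
  [addCommGroup : ∀ x, AddCommGroup (fibre x)]
  transport : ∀ {x y : X}, Path x y → fibre x ≃+ fibre y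
  transport_homotopic : ∀ {x y : X} (γ γ' : Path x y), γ.Homotopic γ' → transport γ = transport γ'
  transport_trans : ∀ {x y z : X} (γ : Path x y) (γ' : Path y z) (g : fibre x),
    transport (γ.trans γ') g = transport γ' (transport γ g)

instance {X : Type v} [TopologicalSpace X] (G : GroupBundle.{v, w} X) (x : X) :
    AddCommGroup (G.fibre x) := G.addCommGroup x

namespace CohomologyTheory

variable {C : GoodSubcategory.{u}} (h : CohomologyTheory.{u, w} C) {X : Type v} [TopologicalSpace X]
  {A : C.Obj} (𝒜 : C0Algebra X A)

/-- `A|_Y` as an object of the good subcategory. -/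
abbrev restrictObj (𝒜 : C0Algebra X A) (Y : Set X) : C.Obj := ⟨𝒜.Restrict Y, C.mem_quot _ A.mem⟩

/-- `A|_{Z ∖ Y}` as an object of the good subcategory. -/
abbrev relObj (𝒜 : C0Algebra X A) {Y Z : Set X} (hYZ : Y ⊆ Z) : C.Obj :=
  ⟨𝒜.relIdeal hYZ, C.mem_ideal _ (C.mem_quot _ A.mem)⟩

/-- `f^*A` as an object of the good subcategory. -/
abbrev pullbackObj (𝒜 : C0Algebra X A) {Y : Type} [TopologicalSpace Y] [CompactSpace Y]
    (hY : C.Admissible Y) (f : C(Y, X)) : C.Obj :=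
  ⟨𝒜.Pullback f, C.mem_quot _ (hY _ A.mem)⟩

/-- The map `q_v^* : hⁿ(A_x) → hⁿ(f^*A)`, where `x = f v`. -/
def evalMap {Y : Type} [TopologicalSpace Y] [CompactSpace Y] (hY : C.Admissible Y) (n : ℤ)
    (f : C(Y, X)) (v : Y) {x : X} (hx : f v = x) :
    h.group n (restrictObj 𝒜 {x}) →+ h.group n (pullbackObj 𝒜 hY f) :=
  h.map n (A := pullbackObj 𝒜 hY f) (B := restrictObj 𝒜 {x}) (𝒜.evalAt f v hx)

/-- `A(X)` is an `h^*`-fibration: for each `f : Δᵖ → X` and `v ∈ Δᵖ` the quotient map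
`q_v : f^*A → A_{f v}` induces isomorphisms in `h^*`. -/
def IsFibration : Prop :=
  ∀ (p : ℕ) (f : C(stdSimplex ℝ (Fin (p + 1)), X)) (v : stdSimplex ℝ (Fin (p + 1))) (n : ℤ),
    Function.Bijective (h.evalMap 𝒜 (C.admissible_stdSimplex p) n f v rfl)

section Transport

variable {h 𝒜} {Y Z : Type} [TopologicalSpace Y] [CompactSpace Y] [TopologicalSpace Z]
  [CompactSpace Z] (hY : C.Admissible Y) (hZ : C.Admissible Z) (n : ℤ)

lemma map_evalMap (f : C(Y, X)) (f' : C(Z, X)) (g : C(Z, Y)) (hg : ∀ z, f (g z) = f' z) (v : Z)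
    {x : X} (hx : f' v = x) (hx' : f (g v) = x) (a : h.group n (restrictObj 𝒜 {x})) :
    h.map n (A := pullbackObj 𝒜 hY f) (B := pullbackObj 𝒜 hZ f') (𝒜.pullbackMap f f' g hg)
      (h.evalMap 𝒜 hZ n f' v hx a) = h.evalMap 𝒜 hY n f (g v) hx' a := by
  refine (h.map_comp n (A := pullbackObj 𝒜 hY f) (B := pullbackObj 𝒜 hZ f')
    (𝒜.pullbackMap f f' g hg) (𝒜.evalAt f' v hx) a).symm.trans ?_
  refine congrArg (fun φ => h.map n (A := pullbackObj 𝒜 hY f) (B := restrictObj 𝒜 {x}) φ a) ?_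
  refine NonUnitalStarAlgHom.ext fun b => ?_
  obtain ⟨F, rfl⟩ := (𝒜.pullbackIdeal f).proj_surjective b
  rfl

lemma evalMap_bijective_of_retract (s : C(Y, Z)) (r : C(Z, Y)) (hrs : ∀ y, r (s y) = y)
    (H : ∀ (f : C(Z, X)) (v : Z), Function.Bijective (h.evalMap 𝒜 hZ n f v rfl))
    (f : C(Y, X)) (v : Y) {x : X} (hx : f v = x) :
    Function.Bijective (h.evalMap 𝒜 hY n f v hx) := by
  subst hx
  have e1 : ∀ y, f.comp r (s y) = f y := fun y => congrArg f (hrs y)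
  let S := h.map n (A := pullbackObj 𝒜 hZ (f.comp r)) (B := pullbackObj 𝒜 hY f)
    (𝒜.pullbackMap (f.comp r) f s e1)
  let R := h.map n (A := pullbackObj 𝒜 hY f) (B := pullbackObj 𝒜 hZ (f.comp r))
    (𝒜.pullbackMap f (f.comp r) r fun _ => rfl)
  have hRS : ∀ a, R (S a) = a := fun a => by
    refine (h.map_comp n (A := pullbackObj 𝒜 hY f) (B := pullbackObj 𝒜 hZ (f.comp r)) _ _
      a).symm.trans (Eq.trans ?_ (h.map_id n (pullbackObj 𝒜 hY f) a))
    refine congrArg (fun φ => h.map n (A := pullbackObj 𝒜 hY f) (B := pullbackObj 𝒜 hY f) φ a) ?_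
    refine NonUnitalStarAlgHom.ext fun b => ?_
    obtain ⟨F, rfl⟩ := (𝒜.pullbackIdeal f).proj_surjective b
    refine congrArg (𝒜.pullbackIdeal f).proj (ContinuousMap.ext fun y => ?_)
    exact congrArg F (hrs y)
  have hS : ∀ a, S (h.evalMap 𝒜 hY n f v rfl a) = h.evalMap 𝒜 hZ n (f.comp r) (s v) (e1 v) a :=
    fun a => map_evalMap hZ hY n (f.comp r) f s e1 v rfl (e1 v) a
  have hb : Function.Bijective (h.evalMap 𝒜 hZ n (f.comp r) (s v) (e1 v)) := by
    have gen : ∀ (x : X) (hx : f.comp r (s v) = x),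
        Function.Bijective (h.evalMap 𝒜 hZ n (f.comp r) (s v) hx) := by
      rintro _ rfl; exact H _ _
    exact gen _ _
  refine ⟨fun a b hab => hb.1 ?_, fun y => ?_⟩
  · rw [← hS, ← hS, hab]
  · obtain ⟨a, ha⟩ := hb.2 (S y)
    refine ⟨a, ?_⟩
    rw [← hS] at ha
    rw [← hRS y, ← ha, hRS]

/-- The square is an admissible space. -/
lemma admissible_square (C : GoodSubcategory.{u}) : C.Admissible (unitInterval × unitInterval) :=
  C.admissible_of_retract (Z := Fin 2 → unitInterval)
    ⟨fun z => ![z.1, z.2], by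
      refine continuous_pi fun i => ?_
      fin_cases i
      · exact continuous_fst
      · exact continuous_snd⟩
    ⟨fun z => (z 0, z 1), by fun_prop⟩ (fun _ => rfl) (C.admissible_cube 2)

lemma IsFibration.bijective_interval (hA : h.IsFibration 𝒜) (f : C(unitInterval, X))
    (v : unitInterval) {x : X} (hx : f v = x) :
    Function.Bijective (h.evalMap 𝒜 C.admissible_unitInterval n f v hx) :=
  evalMap_bijective_of_retract _ (C.admissible_stdSimplex 1) n
    (stdSimplexHomeomorphUnitInterval.symm : C(unitInterval, stdSimplex ℝ (Fin 2)))
    (stdSimplexHomeomorphUnitInterval : C(stdSimplex ℝ (Fin 2), unitInterval))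
    (fun y => stdSimplexHomeomorphUnitInterval.apply_symm_apply y) (fun f v => hA 1 f v n) f v hx

lemma IsFibration.bijective_square (hA : h.IsFibration 𝒜) (f : C(unitInterval × unitInterval, X))
    (v : unitInterval × unitInterval) {x : X} (hx : f v = x) :
    Function.Bijective (h.evalMap 𝒜 (admissible_square C) n f v hx) := by
  have hs : ∀ z : unitInterval × unitInterval,
      ![(z.1 : ℝ) / 2, (z.2 : ℝ) / 2, 1 - ((z.1 : ℝ) / 2 + (z.2 : ℝ) / 2)]
        ∈ stdSimplex ℝ (Fin 3) := fun z => by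
    have h1 := z.1.2
    have h2 := z.2.2
    refine ⟨fun i => ?_, by simp [Fin.sum_univ_three]⟩
    fin_cases i
    · change (0 : ℝ) ≤ (z.1 : ℝ) / 2; linarith [h1.1]
    · change (0 : ℝ) ≤ (z.2 : ℝ) / 2; linarith [h2.1]
    · change (0 : ℝ) ≤ 1 - ((z.1 : ℝ) / 2 + (z.2 : ℝ) / 2); linarith [h1.2, h2.2]
  have hr : ∀ (t : stdSimplex ℝ (Fin 3)) (i : Fin 3), min 1 (2 * t.1 i) ∈ unitInterval :=
    fun t i => ⟨le_min zero_le_one (mul_nonneg zero_le_two (t.2.1 i)), min_le_left _ _⟩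
  have hc : ∀ i, Continuous fun t : stdSimplex ℝ (Fin 3) => min 1 (2 * t.1 i) := fun i =>
    continuous_const.min (continuous_const.mul
      ((continuous_apply i).comp continuous_subtype_val))
  let s : C(unitInterval × unitInterval, stdSimplex ℝ (Fin 3)) :=
    ⟨fun z => ⟨_, hs z⟩, by
      refine Continuous.subtype_mk (continuous_pi fun i => ?_) _
      fin_cases i
      · change Continuous fun z : unitInterval × unitInterval => (z.1 : ℝ) / 2; fun_prop
      · change Continuous fun z : unitInterval × unitInterval => (z.2 : ℝ) / 2; fun_prop
      · change Continuous fun z : unitInterval × unitInterval =>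
          1 - ((z.1 : ℝ) / 2 + (z.2 : ℝ) / 2)
        fun_prop⟩
  let r : C(stdSimplex ℝ (Fin 3), unitInterval × unitInterval) :=
    ⟨fun t => (⟨_, hr t 0⟩, ⟨_, hr t 1⟩),
      ((hc 0).subtype_mk _).prodMk ((hc 1).subtype_mk _)⟩
  refine evalMap_bijective_of_retract _ (C.admissible_stdSimplex 2) n s r (fun z => ?_)
    (fun f v => hA 2 f v n) f v hx
  have h1 := z.1.2.2
  have h2 := z.2.2.2
  refine Prod.ext (Subtype.ext ?_) (Subtype.ext ?_)
  · change min 1 (2 * ((z.1 : ℝ) / 2)) = z.1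
    rw [mul_div_cancel₀ _ two_ne_zero, min_eq_right h1]
  · change min 1 (2 * ((z.2 : ℝ) / 2)) = z.2
    rw [mul_div_cancel₀ _ two_ne_zero, min_eq_right h2]

/-- The isomorphism `c_γ = (ε_1^*)⁻¹ ∘ ε_0^* : hⁿ(A_x) → hⁿ(γ^*A) → hⁿ(A_y)` for a path `γ` from
`x` to `y`. -/
def transport (hA : h.IsFibration 𝒜) {x y : X} (γ : Path x y) :
    h.group n (restrictObj 𝒜 {x}) ≃+ h.group n (restrictObj 𝒜 {y}) :=
  (AddEquiv.ofBijective (h.evalMap 𝒜 C.admissible_unitInterval n γ.toContinuousMap 0 γ.source)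
    (hA.bijective_interval n _ _ _)).trans
  (AddEquiv.ofBijective (h.evalMap 𝒜 C.admissible_unitInterval n γ.toContinuousMap 1 γ.target)
    (hA.bijective_interval n _ _ _)).symm

lemma transport_eq_iff (hA : h.IsFibration 𝒜) {x y : X} (γ : Path x y)
    (a : h.group n (restrictObj 𝒜 {x})) (b : h.group n (restrictObj 𝒜 {y})) :
    transport n hA γ a = b ↔
      h.evalMap 𝒜 C.admissible_unitInterval n γ.toContinuousMap 0 γ.source a
        = h.evalMap 𝒜 C.admissible_unitInterval n γ.toContinuousMap 1 γ.target b :=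
  (AddEquiv.ofBijective (h.evalMap 𝒜 C.admissible_unitInterval n γ.toContinuousMap 1 γ.target)
    (hA.bijective_interval n _ _ _)).symm_apply_eq

/-- Transport along a path that factors through an admissible space `Y`. -/
lemma evalMap_transport (hA : h.IsFibration 𝒜) {x y : X} (γ : Path x y) (f : C(Y, X))
    (g : C(unitInterval, Y)) (hg : ∀ t, f (g t) = γ t) (v w : Y) (hv : g 0 = v) (hw : g 1 = w)
    (hx : f v = x) (hy : f w = y) (a : h.group n (restrictObj 𝒜 {x})) :
    h.evalMap 𝒜 hY n f w hy (transport n hA γ a) = h.evalMap 𝒜 hY n f v hx a := by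
  subst hv hw
  have e := (transport_eq_iff n hA γ a _).1 rfl
  have e' := congrArg (h.map n (A := pullbackObj 𝒜 hY f)
    (B := pullbackObj 𝒜 C.admissible_unitInterval γ.toContinuousMap)
    (𝒜.pullbackMap f γ.toContinuousMap g hg)) e
  rw [map_evalMap _ _ _ _ _ _ _ _ _ hx, map_evalMap _ _ _ _ _ _ _ _ _ hy] at e'
  exact e'.symm

lemma transport_const (hA : h.IsFibration 𝒜) {x : X} (γ : Path x x) (hγ : ∀ t, γ t = x)
    (a : h.group n (restrictObj 𝒜 {x})) : transport n hA γ a = a :=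
  (hA.bijective_interval n γ.toContinuousMap 0 γ.source).1
    (evalMap_transport C.admissible_unitInterval n hA γ γ.toContinuousMap
      (ContinuousMap.const _ 0) (fun t => (γ.source).trans (hγ t).symm) 0 0 rfl rfl _ _ a)

end Transport

/-- The group bundle `ℋⁿ = {hⁿ(A_x)}` associated to an `h^*`-fibration. -/
def groupBundle {h : CohomologyTheory.{u, w} C} {𝒜 : C0Algebra X A} (hA : h.IsFibration 𝒜)
    (n : ℤ) : GroupBundle.{v, w} X where
  fibre x := h.group n (restrictObj 𝒜 {x})
  transport γ := transport n hA γ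
  transport_homotopic := by
    rintro x y γ γ' ⟨F⟩
    refine AddEquiv.ext fun a => ?_
    let f : C(unitInterval × unitInterval, X) := F.toContinuousMap
    have hF0 : ∀ t, f (0, t) = γ t := F.apply_zero
    have hF1 : ∀ t, f (1, t) = γ' t := F.apply_one
    have hFs : ∀ s, f (s, 0) = x := fun s => F.source s
    have hFt : ∀ s, f (s, 1) = y := fun s => F.target s
    have hsq := admissible_square C
    let left : Path x x := ⟨⟨fun s => f (s, 0), by fun_prop⟩, hFs 0, hFs 1⟩
    let right : Path y y := ⟨⟨fun s => f (s, 1), by fun_prop⟩, hFt 0, hFt 1⟩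
    have k1 := evalMap_transport hsq n hA γ f ⟨fun t => (0, t), by fun_prop⟩ hF0 (0, 0) (0, 1)
      rfl rfl (hFs 0) (hFt 0) a
    have k2 := evalMap_transport hsq n hA γ' f ⟨fun t => (1, t), by fun_prop⟩ hF1 (1, 0) (1, 1)
      rfl rfl (hFs 1) (hFt 1) a
    have k3 := evalMap_transport hsq n hA left f ⟨fun s => (s, 0), by fun_prop⟩ (fun _ => rfl)
      (0, 0) (1, 0) rfl rfl (hFs 0) (hFs 1) a
    have k4 := evalMap_transport hsq n hA right f ⟨fun s => (s, 1), by fun_prop⟩ (fun _ => rfl)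
      (0, 1) (1, 1) rfl rfl (hFt 0) (hFt 1) (transport n hA γ a)
    rw [transport_const n hA left hFs] at k3
    rw [transport_const n hA right hFt] at k4
    exact (hA.bijective_square n f (1, 1) (hFt 1)).1 (by rw [k2, k3, k4, k1])
  transport_trans {x y z} γ γ' a := by
    let f := (γ.trans γ').toContinuousMap
    let half : unitInterval := ⟨1 / 2, by norm_num, by norm_num⟩
    let g₁ : C(unitInterval, unitInterval) :=
      ⟨fun t => ⟨(t : ℝ) / 2, by constructor <;> linarith [t.2.1, t.2.2]⟩, by fun_prop⟩
    let g₂ : C(unitInterval, unitInterval) :=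
      ⟨fun t => ⟨(1 + (t : ℝ)) / 2, by constructor <;> linarith [t.2.1, t.2.2]⟩, by fun_prop⟩
    have h1 : ∀ t, f (g₁ t) = γ t := fun t => by
      change (γ.trans γ') (g₁ t) = γ t
      rw [Path.trans_apply, dif_pos (show (g₁ t : ℝ) ≤ 1 / 2 by
        change (t : ℝ) / 2 ≤ 1 / 2; linarith [t.2.2])]
      congr 1
      refine Subtype.ext ?_
      change 2 * ((t : ℝ) / 2) = t
      ring
    have h2 : ∀ t, f (g₂ t) = γ' t := fun t => by
      change (γ.trans γ') (g₂ t) = γ' t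
      rw [Path.trans_apply]
      split_ifs with hc
      · change (1 + (t : ℝ)) / 2 ≤ 1 / 2 at hc
        have ht : t = 0 := Subtype.ext (le_antisymm (show (t : ℝ) ≤ 0 by linarith) t.2.1)
        subst ht
        have : (⟨2 * (g₂ 0 : ℝ), (unitInterval.mul_pos_mem_iff zero_lt_two).2 ⟨(g₂ 0).2.1, hc⟩⟩ :
          unitInterval) = 1 := Subtype.ext (by change 2 * ((1 + (0 : ℝ)) / 2) = 1; norm_num)
        rw [this, γ.target, γ'.source]
      · congr 1
        refine Subtype.ext ?_
        change 2 * ((1 + (t : ℝ)) / 2) - 1 = t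
        ring
    have hg10 : g₁ 0 = 0 := Subtype.ext (by change (0 : ℝ) / 2 = 0; norm_num)
    have hg11 : g₁ 1 = half := Subtype.ext (by change (1 : ℝ) / 2 = 1 / 2; norm_num)
    have hg20 : g₂ 0 = half := Subtype.ext (by change (1 + (0 : ℝ)) / 2 = 1 / 2; norm_num)
    have hg21 : g₂ 1 = 1 := Subtype.ext (by change (1 + (1 : ℝ)) / 2 = 1; norm_num)
    have e0 : f 0 = x := (γ.trans γ').source
    have e1 : f 1 = z := (γ.trans γ').target
    have eh : f half = y := by rw [← hg11, h1, γ.target]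
    have k1 := evalMap_transport C.admissible_unitInterval n hA γ f g₁ h1 0 half hg10 hg11 e0 eh a
    have k2 := evalMap_transport C.admissible_unitInterval n hA γ' f g₂ h2 half 1 hg20 hg21 eh e1
      (transport n hA γ a)
    refine (transport_eq_iff n hA (γ.trans γ') a _).2 ?_
    exact (k2.trans k1).symm

end CohomologyTheory
/-! ### Exact couples and their spectral sequences -/

/-- A bigraded exact couple, `⋯ → D_{p-1,q} → D_{p,q} → E_{p,q} → D_{p-1,q+1} → ⋯`. The maps `i` are
recorded together with all their iterates `D_{m,q} → D_{n,q}`, `m ≤ n`; the map `k` of degree `1`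
in `q` is indexed by `q` and `q'` with `q + 1 = q'`. -/
structure ExactCouple where
  D : ℤ → ℤ → Type w
  E : ℤ → ℤ → Type w
  [instD : ∀ p q, AddCommGroup (D p q)]
  [instE : ∀ p q, AddCommGroup (E p q)]
  i : ∀ {m n : ℤ}, m ≤ n → ∀ q, D m q →+ D n q
  j : ∀ p q, D p q →+ E p q
  k : ∀ p {q q' : ℤ}, q + 1 = q' → E p q →+ D (p - 1) q'
  i_refl : ∀ p q x, i (le_refl p) q x = x
  i_trans : ∀ {l m n : ℤ} (h : l ≤ m) (h' : m ≤ n) q x, i h' q (i h q x) = i (h.trans h') q x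
  exact_j : ∀ p q x, j p q x = 0 ↔ ∃ y, i (sub_one_lt p).le q y = x
  exact_k : ∀ p {q q' : ℤ} (h : q + 1 = q') x, k p h x = 0 ↔ ∃ y, j p q y = x
  exact_i : ∀ p {q q' : ℤ} (h : q + 1 = q') x, i (sub_one_lt p).le q' x = 0 ↔ ∃ y, k p h y = x

namespace ExactCouple

variable (T : ExactCouple.{w})

instance (p q : ℤ) : AddCommGroup (T.D p q) := T.instD p q
instance (p q : ℤ) : AddCommGroup (T.E p q) := T.instE p q

lemma sub_le_sub_one (r : ℕ+) (p : ℤ) : p - (r : ℕ) ≤ p - 1 := by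
  have := r.pos; omega

lemma le_add_sub_one (r : ℕ+) (p : ℤ) : p ≤ p + (r : ℕ) - 1 := by
  have := r.pos; omega

/-- The cycles `Zʳ_{p,q} = k⁻¹(im(D_{p-r,q+1} → D_{p-1,q+1}))`. -/
def Z (r : ℕ+) (p q : ℤ) : AddSubgroup (T.E p q) :=
  (T.i (sub_le_sub_one r p) (q + 1)).range.comap (T.k p rfl)

/-- The boundaries `Bʳ_{p,q} = j(ker(D_{p,q} → D_{p+r-1,q}))`. -/
def B (r : ℕ+) (p q : ℤ) : AddSubgroup (T.E p q) :=
  (T.i (le_add_sub_one r p) q).ker.map (T.j p q)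

/-- The `r`-th page `Eʳ_{p,q} = Zʳ_{p,q} / Bʳ_{p,q}` of the spectral sequence, `r ≥ 1`. -/
def Page (r : ℕ+) (p q : ℤ) : Type w := T.Z r p q ⧸ (T.B r p q).addSubgroupOf (T.Z r p q)

instance (r : ℕ+) (p q : ℤ) : AddCommGroup (T.Page r p q) :=
  inferInstanceAs (AddCommGroup (T.Z r p q ⧸ (T.B r p q).addSubgroupOf (T.Z r p q)))

/-- The class in `Eʳ_{p,q}` of an element of `Zʳ_{p,q}`. -/
def toPage (r : ℕ+) (p q : ℤ) : T.Z r p q →+ T.Page r p q := QuotientAddGroup.mk' _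

lemma toPage_eq_zero {r : ℕ+} {p q : ℤ} (x : T.Z r p q) :
    T.toPage r p q x = 0 ↔ (x : T.E p q) ∈ T.B r p q :=
  (QuotientAddGroup.eq_zero_iff x).trans AddSubgroup.mem_addSubgroupOf

lemma target_le {r : ℕ+} {p p' : ℤ} (hp : p' + (r : ℕ) = p) : p' ≤ p - 1 := by
  have := r.pos; omega

section Differential

variable {r : ℕ+} {p p' q q' : ℤ} (hp : p' + (r : ℕ) = p) (hq : q + 1 = q')

lemma mem_Z_iff (x : T.E p q) :
    x ∈ T.Z r p q ↔ ∃ y : T.D p' q', T.i (target_le hp) q' y = T.k p hq x := by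
  subst hq
  obtain rfl : p' = p - (r : ℕ) := by omega
  exact Iff.rfl

lemma mem_B_iff {n : ℤ} (hn : n = p + (r : ℕ) - 1) (hpn : p ≤ n) (x : T.E p q) :
    x ∈ T.B r p q ↔ ∃ y : T.D p q, T.i hpn q y = 0 ∧ T.j p q y = x := by
  subst hn; exact Iff.rfl

lemma k_j (y : T.D p q) : T.k p hq (T.j p q y) = 0 := (T.exact_k p hq _).2 ⟨y, rfl⟩

lemma j_mem_Z (y : T.D p q) : T.j p q y ∈ T.Z r p q :=
  ⟨0, by rw [T.k_j rfl, map_zero]⟩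

/-- The element `j y` of `Zʳ_{p',q'}`. -/
def jZ (r : ℕ+) (p q : ℤ) : T.D p q →+ T.Z r p q :=
  (T.j p q).codRestrict _ fun y => T.j_mem_Z y

lemma toPage_jZ_eq_zero (y : T.D p' q') (hy : T.i (target_le hp) q' y = 0) :
    T.toPage r p' q' (T.jZ r p' q' y) = 0 :=
  (T.toPage_eq_zero _).2 ((T.mem_B_iff (show p - 1 = p' + (r : ℕ) - 1 by omega)
    (target_le hp) _).2 ⟨y, hy, rfl⟩)

/-- The map `Zʳ_{p,q} → Eʳ_{p-r,q+1}` sending `x` to the class of `j y`, where `i^{r-1} y = k x`. -/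
def dZ : T.Z r p q →+ T.Page r p' q' where
  toFun x := T.toPage r p' q' (T.jZ r p' q' ((T.mem_Z_iff hp hq x).1 x.2).choose)
  map_zero' := by
    refine T.toPage_jZ_eq_zero hp _ ?_
    rw [((T.mem_Z_iff hp hq _).1 (0 : T.Z r p q).2).choose_spec]
    exact map_zero _
  map_add' x y := by
    rw [← sub_eq_zero, ← map_add, ← map_add, ← map_sub, ← map_sub]
    refine T.toPage_jZ_eq_zero hp _ ?_
    rw [map_sub, map_add, ((T.mem_Z_iff hp hq _).1 (x + y).2).choose_spec,
      ((T.mem_Z_iff hp hq _).1 x.2).choose_spec, ((T.mem_Z_iff hp hq _).1 y.2).choose_spec,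
      sub_eq_zero]
    exact map_add _ _ _

lemma dZ_eq (x : T.Z r p q) (y : T.D p' q') (hy : T.i (target_le hp) q' y = T.k p hq x) :
    T.dZ hp hq x = T.toPage r p' q' (T.jZ r p' q' y) := by
  rw [← sub_eq_zero]
  change T.toPage r p' q' _ - _ = 0
  rw [← map_sub, ← map_sub]
  refine T.toPage_jZ_eq_zero hp _ ?_
  rw [map_sub, ((T.mem_Z_iff hp hq _).1 x.2).choose_spec, hy, sub_self]

/-- The differential `dʳ : Eʳ_{p,q} → Eʳ_{p-r,q+1}`, `[x] ↦ [j y]` where `i^{r-1} y = k x`. The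
target is indexed by `p'`, `q'` with `p' + r = p` and `q + 1 = q'`. -/
def d : T.Page r p q →+ T.Page r p' q' :=
  QuotientAddGroup.lift _ (T.dZ hp hq) (by
    intro x hx
    obtain ⟨z, _, hz⟩ := (AddSubgroup.mem_addSubgroupOf.1 hx : (x : T.E p q) ∈ T.B r p q)
    rw [AddMonoidHom.mem_ker, T.dZ_eq hp hq x 0 (by rw [map_zero, ← hz, T.k_j]), map_zero, map_zero])

lemma d_toPage (x : T.Z r p q) (y : T.D p' q') (hy : T.i (target_le hp) q' y = T.k p hq x) :
    T.d hp hq (T.toPage r p q x) = T.toPage r p' q' (T.jZ r p' q' y) :=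
  T.dZ_eq hp hq x y hy

end Differential

/-- The homology `ker dʳ / im dʳ` of the `r`-th page at `(p, q)`, for the differentials
`Eʳ_{p₀,q₀} → Eʳ_{p,q} → Eʳ_{p₁,q₁}`. -/
abbrev PageHomology (r : ℕ+) {p₀ p p₁ q₀ q q₁ : ℤ} (hp₀ : p + (r : ℕ) = p₀) (hq₀ : q₀ + 1 = q)
    (hp₁ : p₁ + (r : ℕ) = p) (hq₁ : q + 1 = q₁) : Type w :=
  (T.d (r := r) hp₁ hq₁).ker ⧸ ((T.d (r := r) hp₀ hq₀).range).addSubgroupOf (T.d hp₁ hq₁).ker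

end ExactCouple

namespace CohomologyTheory

variable {C : GoodSubcategory.{u}} (h : CohomologyTheory.{u, w} C) {X : Type v} [TopologicalSpace X]
  {A : C.Obj} (𝒜 : C0Algebra X A)

lemma shortExact_rel {Y Z : Set X} (hYZ : Y ⊆ Z) :
    IsShortExact (𝒜.relIdeal hYZ).incl (𝒜.res hYZ) :=
  ClosedIdeal.shortExact_ker _ (𝒜.res_surjective hYZ)

/-- The exact couple of a filtration `F` of `X` by closed subsets, built from the long exact
sequences of `0 → A|_{F p ∖ F (p-1)} → A|_{F p} → A|_{F (p-1)} → 0`: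
`D_{p,q} = h^q(A|_{F p})` and `E_{p,q} = h^q(A|_{F p ∖ F (p-1)})`. -/
def couple (F : ℤ → Set X) (hF : Monotone F) : ExactCouple.{w} where
  D p q := h.group q (restrictObj 𝒜 (F p))
  E p q := h.group q (relObj 𝒜 (hF (sub_one_lt p).le))
  i {m n} hmn q := h.map q (A := restrictObj 𝒜 (F n)) (B := restrictObj 𝒜 (F m)) (𝒜.res (hF hmn))
  j p q := h.map q (A := relObj 𝒜 (hF (sub_one_lt p).le)) (B := restrictObj 𝒜 (F p))
    (𝒜.relIdeal (hF (sub_one_lt p).le)).incl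
  k p {q q'} hq := h.δ hq (J := relObj 𝒜 (hF (sub_one_lt p).le)) (A := restrictObj 𝒜 (F p))
    (B := restrictObj 𝒜 (F (p - 1))) (shortExact_rel 𝒜 (hF (sub_one_lt p).le))
  i_refl p q x := by
    refine Eq.trans ?_ (h.map_id q (restrictObj 𝒜 (F p)) x)
    refine congrArg (fun φ => h.map q (A := restrictObj 𝒜 (F p)) (B := restrictObj 𝒜 (F p)) φ x) ?_
    refine NonUnitalStarAlgHom.ext fun b => ?_
    obtain ⟨a, rfl⟩ := (𝒜.vanishing (F p)).proj_surjective b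
    rfl
  i_trans {l m n} hlm hmn q x := by
    refine (h.map_comp q (A := restrictObj 𝒜 (F n)) (B := restrictObj 𝒜 (F m))
      (D := restrictObj 𝒜 (F l)) _ _ x).symm.trans ?_
    refine congrArg (fun φ => h.map q (A := restrictObj 𝒜 (F n)) (B := restrictObj 𝒜 (F l)) φ x) ?_
    refine NonUnitalStarAlgHom.ext fun b => ?_
    obtain ⟨a, rfl⟩ := (𝒜.vanishing (F n)).proj_surjective b
    rfl
  exact_j p q x := h.exact_middle q (J := relObj 𝒜 (hF (sub_one_lt p).le))
    (A := restrictObj 𝒜 (F p)) (B := restrictObj 𝒜 (F (p - 1)))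
    (shortExact_rel 𝒜 (hF (sub_one_lt p).le)) x
  exact_k p {q q'} hq x := h.exact_left hq (J := relObj 𝒜 (hF (sub_one_lt p).le))
    (A := restrictObj 𝒜 (F p)) (B := restrictObj 𝒜 (F (p - 1)))
    (shortExact_rel 𝒜 (hF (sub_one_lt p).le)) x
  exact_i p {q q'} hq x := h.exact_right hq (J := relObj 𝒜 (hF (sub_one_lt p).le))
    (A := restrictObj 𝒜 (F p)) (B := restrictObj 𝒜 (F (p - 1)))
    (shortExact_rel 𝒜 (hF (sub_one_lt p).le)) x

/-- The subgroup `im(h^q(A|_Y) → h^q(A))` of `h^q(A)`, for a closed subset `Y`. -/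
def imageOf (Y : Set X) (q : ℤ) : AddSubgroup (h.group q A) :=
  (h.map q (A := A) (B := restrictObj 𝒜 Y) (𝒜.vanishing Y).proj).range

end CohomologyTheory
/-! ### Simplicial complexes and homology with local coefficients -/

namespace AbstractSimplicialComplex

variable {V : Type v} (K : AbstractSimplicialComplex V)

/-- Each vertex lies in only finitely many simplices. -/
def LocallyFinite : Prop := ∀ v : V, {s ∈ K.faces | v ∈ s}.Finite

/-- The geometric realisation in barycentric coordinates, with the topology of convergence of all
coordinates (for a locally finite complex this is the weak topology). -/
def Realization : Type v :=
  {t : V → ℝ // (∀ v, 0 ≤ t v) ∧ ∃ s ∈ K.faces, (∀ v, v ∉ s → t v = 0) ∧ ∑ v ∈ s, t v = 1}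

instance : TopologicalSpace K.Realization := instTopologicalSpaceSubtype

/-- The closed simplex of the realisation spanned by `s`. -/
def closedSimplex (s : Finset V) : Set K.Realization := {t | ∀ v, v ∉ s → t.1 v = 0}

lemma closedSimplex_mono {s t : Finset V} (h : s ⊆ t) : K.closedSimplex s ⊆ K.closedSimplex t :=
  fun _ hx v hv => hx v fun hs => hv (h hs)

/-- The `p`-skeleton, empty for `p < 0`. -/
def skeleton (p : ℤ) : Set K.Realization :=
  {t | ∃ s ∈ K.faces, (s.card : ℤ) ≤ p + 1 ∧ t ∈ K.closedSimplex s}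

lemma skeleton_mono : Monotone K.skeleton := fun _ _ h _ ⟨s, hs, hc, ht⟩ =>
  ⟨s, hs, hc.trans (by omega), ht⟩

/-- The `p`-simplices. -/
def Simplex (p : ℕ) : Type v := {s : Finset V // s ∈ K.faces ∧ s.card = p + 1}

/-- A choice of an ordering of the vertices (hence of an affine realisation `Δᵖ → X` and of an
orientation) for each simplex. -/
structure Orientation where
  vert : ∀ {p : ℕ}, K.Simplex p → Fin (p + 1) → V
  range_vert : ∀ {p : ℕ} (σ : K.Simplex p), Set.range (vert σ) = (σ.1 : Set V)

variable {K}

/-- The incidence number of a `p+1`-simplex `σ` and a `p`-simplex `τ`: it is `(-1)^l sign φ` if `τ`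
is the `l`-th face `σ_l` of `σ` and `τ = σ_l ∘ φ` on vertices for the permutation `φ`, and `0`
if `τ` is not a face of `σ`. -/
def Orientation.incidence (o : K.Orientation) {p : ℕ} (σ : K.Simplex (p + 1)) (τ : K.Simplex p) :
    ℤ :=
  open Classical in
  ∑ l : Fin (p + 2), ∑ φ : Equiv.Perm (Fin (p + 1)),
    if ∀ k, o.vert τ k = o.vert σ (l.succAbove (φ k)) then
      (-1) ^ (l : ℕ) * (Equiv.Perm.sign φ : ℤ) else 0

lemma LocallyFinite.finite_cofaces (hK : K.LocallyFinite) {p : ℕ} (τ : K.Simplex p) :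
    Finite {σ : K.Simplex (p + 1) // τ.1 ⊆ σ.1} := by
  obtain ⟨v, hv⟩ : τ.1.Nonempty := Finset.card_pos.1 (by rw [τ.2.2]; omega)
  have := (hK v).to_subtype
  exact Finite.of_injective
    (fun σ : {σ : K.Simplex (p + 1) // τ.1 ⊆ σ.1} =>
      (⟨σ.1.1, σ.1.2.1, σ.2 hv⟩ : {s ∈ K.faces | v ∈ s}))
    (fun σ σ' h => Subtype.ext (Subtype.ext (Subtype.mk.inj h)))

end AbstractSimplicialComplex

namespace GroupBundle

section Constant

variable {X : Type v} [TopologicalSpace X] (G : GroupBundle.{v, w} X)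

/-- The group `Γ_const(Y, G)` of constant sections over `Y`: the sections `g` with
`c_γ (g x) = g y` for all paths `γ` in `Y` from `x` to `y`. -/
def constSections (Y : Set X) : AddSubgroup (∀ y : Y, G.fibre y) where
  carrier := {g | ∀ (x y : Y) (γ : Path (x : X) (y : X)), (∀ t, γ t ∈ Y) →
    G.transport γ (g x) = g y}
  zero_mem' x y γ _ := map_zero (G.transport γ)
  add_mem' {g g'} hg hg' x y γ hγ := by
    rw [Pi.add_apply, map_add, hg x y γ hγ, hg' x y γ hγ, Pi.add_apply]
  neg_mem' {g} hg x y γ hγ := by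
    rw [Pi.neg_apply, map_neg, hg x y γ hγ, Pi.neg_apply]

/-- Restriction of constant sections. -/
def resConst {Y Z : Set X} (h : Z ⊆ Y) : G.constSections Y →+ G.constSections Z where
  toFun g := ⟨fun z => g.1 ⟨z, h z.2⟩, fun x y γ hγ => g.2 ⟨x, h x.2⟩ ⟨y, h y.2⟩ γ
    fun t => h (hγ t)⟩
  map_zero' := rfl
  map_add' _ _ := rfl

end Constant

variable {V : Type v} {K : AbstractSimplicialComplex V} (G : GroupBundle.{v, w} K.Realization)

/-- The group `C_p(X; G)` of (possibly infinite) `p`-chains `∑ a_σ σ`, with coefficients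
`a_σ ∈ Γ_const(Δ_σ, G)`. -/
abbrev Chain (p : ℕ) : Type (max v w) :=
  ∀ σ : K.Simplex p, G.constSections (K.closedSimplex σ.1)

/-- The subgroup of finite chains. -/
def finChain (p : ℕ) : AddSubgroup (G.Chain p) where
  carrier := {a | {σ | a σ ≠ 0}.Finite}
  zero_mem' := by simp
  add_mem' {a b} ha hb := (ha.union hb).subset fun σ hσ => by
    by_contra hc
    simp only [Set.mem_union, Set.mem_ofPred_eq, not_or, not_not] at hc
    exact hσ (by rw [Pi.add_apply, hc.1, hc.2, add_zero])
  neg_mem' {a} ha := ha.subset fun σ hσ h0 => hσ (by rw [Pi.neg_apply, h0, neg_zero])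

/-- The boundary map `d : C_{p+1}(X; G) → C_p(X; G)`,
`d (a_σ σ) = ∑_l (-1)^l sign(φ_{σ,τ_l}) res(a_σ) τ_l`, of a locally finite complex. -/
def boundary (o : K.Orientation) (hK : K.LocallyFinite) (p : ℕ) :
    G.Chain (p + 1) →+ G.Chain p where
  toFun a τ := ∑ᶠ σ : {σ : K.Simplex (p + 1) // τ.1 ⊆ σ.1},
    o.incidence σ.1 τ • G.resConst (K.closedSimplex_mono σ.2) (a σ.1)
  map_zero' := by
    funext τ
    simp
  map_add' a b := by
    funext τ
    have := hK.finite_cofaces τ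
    simp only [Pi.add_apply, map_add, smul_add]
    exact finsum_add_distrib (Set.toFinite _) (Set.toFinite _)

/-- The `p`-cycles. -/
def cycles (o : K.Orientation) (hK : K.LocallyFinite) : ∀ p : ℕ, AddSubgroup (G.Chain p)
  | 0 => ⊤
  | p + 1 => (G.boundary o hK p).ker

/-- The simplicial homology `H_p(X; G)` with (infinite) chains. -/
abbrev Homology (o : K.Orientation) (hK : K.LocallyFinite) (p : ℕ) : Type (max v w) :=
  G.cycles o hK p ⧸ ((G.boundary o hK p).range).addSubgroupOf (G.cycles o hK p)

/-- The simplicial homology `H_p^fin(X; G)` with finite chains. -/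
abbrev HomologyFin (o : K.Orientation) (hK : K.LocallyFinite) (p : ℕ) : Type (max v w) :=
  ↥(G.cycles o hK p ⊓ G.finChain p) ⧸
    ((G.finChain (p + 1)).map (G.boundary o hK p)).addSubgroupOf (G.cycles o hK p ⊓ G.finChain p)

end GroupBundle

end

noncomputable section

/-! ### Quotients of abelian groups -/

namespace AddMonoidHom

/-! For closed sets `Y ⊆ Z` the surjection `A|_Z → A|_Y` induces `h^n(A|_Y) → h^n(A|_Z)`. So on
subcomplexes the contravariant theory `h^*` behaves like a homology theory, with groups `h^n(A|_{|L|
∖ |M|})` for `M ⊆ L`, exact sequences of triples, and connecting maps that lower the dimension of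
simplices while raising `n` by one. Excision already holds for the algebras. Writing `I_Y` for the
ideal of elements vanishing on `Y`, one has `I_Y ∩ I_Z = I_{Y ∪ Z}` by approximate units, and `I_Y +
I_Z` is dense in `I_{Y ∩ Z}` by partitions of unity, so the relevant restriction maps are
isomorphisms (`C0Algebra.relRes_bijective`). These properties are axiomatised in `RelHomology`, over
a partially ordered set of cells, and the combinatorial part of the argument uses nothing else.

That the pages are complexes computing one another is pure algebra of exact couples. For
convergence, `D_{p,q}` vanishes for `p < 0` and maps isomorphically to `h^q(A)` for `p ≥ dim X`. For
large `r` the cycles are therefore the image of `D_{p,q}`, the boundaries come from the kernel of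
`D_{p,q} → h^q(A)`, and the page is the graded piece of the filtration.

For the second page, `d¹ = j ∘ k` is the connecting map of the triple of consecutive skeleta. A
class in `E¹_{p,q}` has a coefficient in `h^q` of the algebra of each open `p`-simplex, and
`RelHomology.coeff_δ` computes the coefficients of a boundary as sums of components `inc` from a
simplex to its facets. Two facts determine these components.

Acyclicity: by the fibration hypothesis, and because `A|_σ` is the pull-back along the affine
parametrisation of `σ`, evaluation at any point `x` of `σ` gives `h^n(A_x) ≅ h^n(A|_σ)`. Hence
inclusions of closed simplices induce isomorphisms, and `h^n(A|_σ)` is the group of constant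
sections of `ℋ^n` over `σ`. Moreover the facets other than a given one form a cone, so each `inc` is
an isomorphism. Removing the vertices of `σ` one at a time identifies `h^q` of the open simplex with
`h^{p+q}(A|_σ)`; this is `RelHomology.ordMap`.

Signs: the two routes from a simplex to a face of codimension two cancel (`RelHomology.inc_inc_add`,
a form of `∂∂ = 0`). So exchanging neighbouring vertices changes the sign of `ordMap`, and moving
the `l`-th vertex to the front yields the incidence number `(-1)^l sign φ`
(`RelHomology.ordMap_face`).

Consequently the coefficients define an injective chain map from the first page to the simplicial
chains with values in `ℋ^{p+q}`. Its image is the group of finite chains if `h^*` is `σ`-additive or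
`X` is finite, and the group of all chains if `h^*` is `σ`-multiplicative, because the algebra of a
layer is the direct sum of the algebras of its open simplices. Passing to subquotients gives both
descriptions of `E²`. -/

lemma exists_quotient_equiv {G : Type*} {H : Type*} [AddCommGroup G] [AddCommGroup H] (φ : G →+ H)
    (hφ : Function.Surjective φ) (N : AddSubgroup G) (hN : ∀ x, φ x = 0 ↔ x ∈ N) :
    ∃ e : G ⧸ N ≃+ H, ∀ x, e (QuotientAddGroup.mk x) = φ x := by
  have hk : φ.ker = N := AddSubgroup.ext hN
  subst hk
  exact ⟨QuotientAddGroup.quotientKerEquivOfSurjective φ hφ, fun _ => rfl⟩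

lemma nonempty_equiv_of_ker_eq {G : Type*} {H : Type*} {H' : Type*} [AddCommGroup G]
    [AddCommGroup H] [AddCommGroup H'] (φ : G →+ H) (ψ : G →+ H') (hφ : Function.Surjective φ)
    (hψ : Function.Surjective ψ) (h : ∀ x, φ x = 0 ↔ ψ x = 0) : Nonempty (H ≃+ H') := by
  obtain ⟨e, -⟩ := φ.exists_quotient_equiv hφ φ.ker fun _ => Iff.rfl
  obtain ⟨e', -⟩ := ψ.exists_quotient_equiv hψ φ.ker fun x => (h x).symm
  exact ⟨e.symm.trans e'⟩

/-- An injective homomorphism identifies a subquotient of its source with the subquotient of its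
target given by the images. -/
lemma nonempty_subquotient_equiv {G : Type*} {H : Type*} [AddCommGroup G] [AddCommGroup H]
    (φ : G →+ H) (hφ : Function.Injective φ) (Z B : AddSubgroup G) (Z' B' : AddSubgroup H)
    (hZ : Z.map φ = Z') (hB : B.map φ = B') :
    Nonempty ((Z ⧸ B.addSubgroupOf Z) ≃+ (Z' ⧸ B'.addSubgroupOf Z')) := by
  subst hZ hB
  have hm : ∀ x : Z, φ x ∈ Z.map φ := fun x => ⟨x, x.2, rfl⟩
  refine nonempty_equiv_of_ker_eq (QuotientAddGroup.mk' (B.addSubgroupOf Z))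
    ((QuotientAddGroup.mk' ((B.map φ).addSubgroupOf (Z.map φ))).comp
      ((φ.comp Z.subtype).codRestrict (Z.map φ) hm))
    (QuotientAddGroup.mk'_surjective _) ?_ fun x => ?_
  · intro y
    obtain ⟨⟨_, z, hz, rfl⟩, rfl⟩ := QuotientAddGroup.mk'_surjective _ y
    exact ⟨⟨z, hz⟩, rfl⟩
  · refine (QuotientAddGroup.eq_zero_iff _).trans (Iff.trans ?_ (QuotientAddGroup.eq_zero_iff _).symm)
    rw [AddSubgroup.mem_addSubgroupOf, AddSubgroup.mem_addSubgroupOf]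
    exact (AddSubgroup.mem_map_iff_mem hφ).symm

end AddMonoidHom

/-! ### The spectral sequence of an exact couple -/

namespace ExactCouple

variable (T : ExactCouple.{w})

lemma toPage_surjective (r : ℕ+) (p q : ℤ) : Function.Surjective (T.toPage r p q) :=
  QuotientAddGroup.mk'_surjective _

/-- The class `d[x]` is represented by some `j y`, and `k ∘ j = 0`, so the second differential may
be computed with the lift `0`. -/
lemma d_d {r : ℕ+} {p₀ p p₁ q₀ q q₁ : ℤ} (hp₀ : p + (r : ℕ) = p₀) (hq₀ : q₀ + 1 = q)
    (hp₁ : p₁ + (r : ℕ) = p) (hq₁ : q + 1 = q₁) (x : T.Page r p₀ q₀) :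
    T.d hp₁ hq₁ (T.d hp₀ hq₀ x) = 0 := by
  obtain ⟨x, rfl⟩ := T.toPage_surjective _ _ _ x
  obtain ⟨y, hy⟩ := (T.mem_Z_iff hp₀ hq₀ _).1 x.2
  rw [T.d_toPage hp₀ hq₀ x y hy, T.d_toPage hp₁ hq₁ _ 0, map_zero, map_zero]
  rw [map_zero]
  exact (T.k_j hq₁ y).symm

lemma Z_succ_le (r : ℕ+) (p q : ℤ) : T.Z (r + 1) p q ≤ T.Z r p q := by
  intro x hx
  obtain ⟨y, hy⟩ := (T.mem_Z_iff (show p - (r + 1 : ℕ+) + ((r + 1 : ℕ+) : ℕ) = p by omega) rfl x).1 hx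
  refine (T.mem_Z_iff (show p - (r : ℕ) + (r : ℕ) = p by omega) rfl x).2
    ⟨T.i (by push_cast; omega) _ y, ?_⟩
  rw [T.i_trans, hy]

/-- With `i^{r-1} y = k x`, the condition `j y ∈ Bʳ` says that `y` lies in `ker i^{r-1} + im i`,
which is the same as `k x ∈ im i^r`. -/
lemma d_toPage_eq_zero_iff {r : ℕ+} {p p' q q' : ℤ} (hp : p' + (r : ℕ) = p) (hq : q + 1 = q')
    (x : T.Z r p q) : T.d hp hq (T.toPage r p q x) = 0 ↔ (x : T.E p q) ∈ T.Z (r + 1) p q := by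
  have hr : p' - 1 + ((r + 1 : ℕ+) : ℕ) = p := by push_cast; omega
  obtain ⟨y, hy⟩ := (T.mem_Z_iff hp hq _).1 x.2
  rw [T.d_toPage hp hq x y hy, T.toPage_eq_zero,
    T.mem_B_iff (show p - 1 = p' + (r : ℕ) - 1 by omega) (target_le hp), T.mem_Z_iff hr hq]
  constructor
  · rintro ⟨z, hz, hzy⟩
    obtain ⟨t, ht⟩ := (T.exact_j p' q' (y - z)).1 (by rw [map_sub, hzy]; exact sub_self _)
    refine ⟨t, ?_⟩
    rw [← T.i_trans (sub_one_lt p').le (target_le hp), ht, map_sub, hz, sub_zero, hy]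
  · rintro ⟨t, ht⟩
    refine ⟨y - T.i (sub_one_lt p').le q' t, ?_, ?_⟩
    · rw [map_sub, T.i_trans, ht, hy, sub_self]
    · rw [map_sub, (T.exact_j p' q' _).2 ⟨t, rfl⟩, sub_zero]
      rfl

/-- The classes in the image of `d` are those of `j y` with `i^{r-1} y ∈ im k = ker i`, that is,
`i^r y = 0`. The indeterminacy `Bʳ` is already contained in `j(ker i^r)`. -/
lemma toPage_mem_range_d_iff {r : ℕ+} {p₀ p q₀ q : ℤ} (hp : p + (r : ℕ) = p₀) (hq : q₀ + 1 = q)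
    (x : T.Z r p q) :
    T.toPage r p q x ∈ (T.d (r := r) hp hq).range ↔ (x : T.E p q) ∈ T.B (r + 1) p q := by
  have hn : p₀ = p + ((r + 1 : ℕ+) : ℕ) - 1 := by push_cast; omega
  have hpn : p ≤ p₀ := by have := r.pos; omega
  have hpn' := target_le hp
  rw [T.mem_B_iff hn hpn]
  constructor
  · rintro ⟨z, hz⟩
    obtain ⟨z, rfl⟩ := T.toPage_surjective _ _ _ z
    obtain ⟨y, hy⟩ := (T.mem_Z_iff hp hq _).1 z.2
    rw [T.d_toPage hp hq z y hy, ← sub_eq_zero, ← map_sub, T.toPage_eq_zero,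
      T.mem_B_iff (show p₀ - 1 = p + (r : ℕ) - 1 by omega) hpn'] at hz
    obtain ⟨t, ht, htx⟩ := hz
    refine ⟨y - t, ?_, ?_⟩
    · rw [map_sub, ← T.i_trans hpn' (sub_one_lt p₀).le, ← T.i_trans hpn' (sub_one_lt p₀).le, ht, hy,
        map_zero, sub_zero]
      exact (T.exact_i p₀ hq _).2 ⟨_, rfl⟩
    · rw [map_sub, htx, sub_eq_iff_eq_add']
      exact (sub_add_cancel _ _).symm
  · rintro ⟨y, hy, hyx⟩
    rw [← T.i_trans hpn' (sub_one_lt p₀).le, T.exact_i p₀ hq] at hy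
    obtain ⟨z, hz⟩ := hy
    refine ⟨T.toPage r p₀ q₀ ⟨z, (T.mem_Z_iff hp hq z).2 ⟨y, hz.symm⟩⟩, ?_⟩
    rw [T.d_toPage hp hq _ y hz.symm]
    exact congrArg _ (Subtype.ext hyx)

/-- The homology of a page is the next page. -/
theorem exists_page_succ_equiv (r : ℕ+) {p₀ p p₁ q₀ q q₁ : ℤ} (hp₀ : p + (r : ℕ) = p₀)
    (hq₀ : q₀ + 1 = q) (hp₁ : p₁ + (r : ℕ) = p) (hq₁ : q + 1 = q₁) :
    ∃ e : T.Page (r + 1) p q ≃+ T.PageHomology r hp₀ hq₀ hp₁ hq₁,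
      ∀ x : T.Z (r + 1) p q, ∃ (hx : (x : T.E p q) ∈ T.Z r p q)
        (hd : T.d hp₁ hq₁ (T.toPage r p q ⟨x, hx⟩) = 0),
        e (T.toPage (r + 1) p q x) =
          QuotientAddGroup.mk (⟨T.toPage r p q ⟨x, hx⟩, hd⟩ : (T.d hp₁ hq₁).ker) := by
  have hd : ∀ x : T.Z (r + 1) p q,
      T.d hp₁ hq₁ (T.toPage r p q (AddSubgroup.inclusion (T.Z_succ_le r p q) x)) = 0 := fun x =>
    (T.d_toPage_eq_zero_iff hp₁ hq₁ _).2 x.2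
  let φ : T.Z (r + 1) p q →+ T.PageHomology r hp₀ hq₀ hp₁ hq₁ :=
    (QuotientAddGroup.mk' _).comp
      (((T.toPage r p q).comp (AddSubgroup.inclusion (T.Z_succ_le r p q))).codRestrict
        (T.d hp₁ hq₁).ker hd)
  have hs : Function.Surjective φ := by
    intro y
    obtain ⟨⟨y, hy⟩, rfl⟩ := QuotientAddGroup.mk'_surjective _ y
    obtain ⟨x, rfl⟩ := T.toPage_surjective _ _ _ y
    exact ⟨⟨x, (T.d_toPage_eq_zero_iff hp₁ hq₁ x).1 hy⟩, rfl⟩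
  obtain ⟨e, he⟩ := φ.exists_quotient_equiv hs ((T.B (r + 1) p q).addSubgroupOf (T.Z (r + 1) p q))
    fun x => by
      refine (QuotientAddGroup.eq_zero_iff _).trans ?_
      rw [AddSubgroup.mem_addSubgroupOf, AddSubgroup.mem_addSubgroupOf]
      exact T.toPage_mem_range_d_iff hp₀ hq₀ (AddSubgroup.inclusion (T.Z_succ_le r p q) x)
  exact ⟨e, fun x => ⟨T.Z_succ_le r p q x.2, hd x, he x⟩⟩

/-- A bounded exact couple converges to the filtration of its abutment `H`. -/
theorem exists_forall_page_equiv {H : Type*} [AddCommGroup H] (q : ℤ) (a : ∀ p, T.D p q →+ H)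
    (ha : ∀ {m n : ℤ} (h : m ≤ n) x, a n (T.i h q x) = a m x) (N : ℤ)
    (hN : ∀ p, N ≤ p → Function.Injective (a p))
    (h0 : ∀ p < 0, ∀ q, Subsingleton (T.D p q)) (p : ℤ) :
    ∃ r₀ : ℕ+, ∀ r ≥ r₀, Nonempty (T.Page r p q ≃+
      (a p).range ⧸ ((a (p - 1)).range).addSubgroupOf (a p).range) := by
  -- The first summand makes `p - r` negative, so that the group `D_{p-r}` in the cycle condition
  -- vanishes; the second makes `p + r - 1 ≥ N`, where `a` is injective.
  refine ⟨⟨(p.toNat + (N - p).toNat + 1), by omega⟩, fun r hr => ?_⟩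
  have hr' : p.toNat + (N - p).toNat + 1 ≤ (r : ℕ) := hr
  have hker : ∀ y : T.D p q, T.i (le_add_sub_one r p) q y = 0 ↔ a p y = 0 := fun y => by
    rw [← ha (le_add_sub_one r p)]
    exact (map_eq_zero_iff _ (hN _ (by omega))).symm
  -- Both groups are quotients of `D_{p,q}`, one through `j` and one through `a p`; the kernel is
  -- `ker (a p) + im i` in either case.
  refine AddMonoidHom.nonempty_equiv_of_ker_eq ((T.toPage r p q).comp (T.jZ r p q))
    ((QuotientAddGroup.mk' _).comp (a p).rangeRestrict) ?_ ?_ fun y => ?_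
  · intro z
    obtain ⟨x, rfl⟩ := T.toPage_surjective _ _ _ z
    obtain ⟨t, ht⟩ := (T.mem_Z_iff (show p - (r : ℕ) + (r : ℕ) = p by omega) rfl _).1 x.2
    have := h0 (p - (r : ℕ)) (by omega) (q + 1)
    rw [Subsingleton.elim t 0, map_zero] at ht
    obtain ⟨y, hy⟩ := (T.exact_k p rfl _).1 ht.symm
    exact ⟨y, congrArg _ (Subtype.ext hy)⟩
  · exact (QuotientAddGroup.mk'_surjective _).comp (a p).rangeRestrict_surjective
  · refine Iff.trans ?_ (QuotientAddGroup.eq_zero_iff _).symm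
    rw [AddSubgroup.mem_addSubgroupOf, AddMonoidHom.comp_apply, T.toPage_eq_zero]
    change T.j p q y ∈ _ ↔ a p y ∈ _
    constructor
    · rintro ⟨z, hz, hzy⟩
      obtain ⟨t, ht⟩ := (T.exact_j p q (y - z)).1 (by rw [map_sub, hzy, sub_self])
      refine ⟨t, ?_⟩
      rw [← ha (sub_one_lt p).le, ht, map_sub, (hker z).1 hz, sub_zero]
    · rintro ⟨t, ht⟩
      refine ⟨y - T.i (sub_one_lt p).le q t, (hker _).2 ?_, ?_⟩
      · rw [map_sub, ha, ht, sub_self]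
      · rw [map_sub, (T.exact_j p q _).2 ⟨t, rfl⟩, sub_zero]

/-- By exactness, `Z²` and `B²` are the kernel and the image of `d¹ = j ∘ k`, so the second page can
be read off from the first without mention of `D`. -/
lemma mem_Z_two_iff {p q q' : ℤ} (hq : q + 1 = q') (x : T.E p q) :
    x ∈ T.Z 2 p q ↔ T.j (p - 1) q' (T.k p hq x) = 0 := by
  rw [T.mem_Z_iff (show p - 1 - 1 + ((2 : ℕ+) : ℕ) = p by push_cast; omega) hq, T.exact_j]

lemma mem_B_two_iff {p q₀ q : ℤ} (hq : q₀ + 1 = q) (x : T.E (p - 1) q) :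
    x ∈ T.B 2 (p - 1) q ↔ ∃ z : T.E p q₀, T.j (p - 1) q (T.k p hq z) = x := by
  rw [T.mem_B_iff (show p = p - 1 + ((2 : ℕ+) : ℕ) - 1 by push_cast; omega) (sub_one_lt p).le]
  constructor
  · rintro ⟨y, hy, rfl⟩
    obtain ⟨z, rfl⟩ := (T.exact_i p hq y).1 hy
    exact ⟨z, rfl⟩
  · rintro ⟨z, rfl⟩
    exact ⟨_, (T.exact_i p hq _).2 ⟨z, rfl⟩, rfl⟩

end ExactCouple

/-! ### Relative homology theories on the lower sets of a partial order -/

/-- A relative homology theory on the pairs `M ≤ L` of lower sets of a partially ordered set of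
cells, with long exact sequences of triples and excision. The connecting maps raise the degree. -/
structure RelHomology (ι : Type v) [PartialOrder ι] where
  G : ℤ → ∀ {M L : LowerSet ι}, M ≤ L → Type w
  [addCommGroup : ∀ n {M L : LowerSet ι} (h : M ≤ L), AddCommGroup (G n h)]
  map : ∀ (n : ℤ) {M L M' L' : LowerSet ι} (h : M ≤ L) (h' : M' ≤ L'), M ≤ M' → L ≤ L' →
    G n h →+ G n h'
  map_id : ∀ n {M L : LowerSet ι} (h : M ≤ L) (x : G n h), map n h h le_rfl le_rfl x = x
  map_map : ∀ n {M L M' L' M'' L'' : LowerSet ι} (h : M ≤ L) (h' : M' ≤ L') (h'' : M'' ≤ L'')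
    (hM : M ≤ M') (hL : L ≤ L') (hM' : M' ≤ M'') (hL' : L' ≤ L'') (x : G n h),
    map n h' h'' hM' hL' (map n h h' hM hL x) = map n h h'' (hM.trans hM') (hL.trans hL') x
  δ : ∀ {n m : ℤ}, n + 1 = m → ∀ {N M L : LowerSet ι} (hN : N ≤ M) (hM : M ≤ L), G n hM →+ G m hN
  δ_map : ∀ {n m : ℤ} (hnm : n + 1 = m) {N M L N' M' L' : LowerSet ι} (hN : N ≤ M) (hM : M ≤ L)
    (hN' : N' ≤ M') (hM' : M' ≤ L') (kN : N ≤ N') (kM : M ≤ M') (kL : L ≤ L') (x : G n hM),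
    map m hN hN' kN kM (δ hnm hN hM x) = δ hnm hN' hM' (map n hM hM' kM kL x)
  exact_mid : ∀ n {N M L : LowerSet ι} (hN : N ≤ M) (hM : M ≤ L) (x : G n (hN.trans hM)),
    map n (hN.trans hM) hM hN le_rfl x = 0 ↔ ∃ y, map n hN (hN.trans hM) le_rfl hM y = x
  exact_top : ∀ {n m : ℤ} (hnm : n + 1 = m) {N M L : LowerSet ι} (hN : N ≤ M) (hM : M ≤ L)
    (x : G n hM), δ hnm hN hM x = 0 ↔ ∃ y, map n (hN.trans hM) hM hN le_rfl y = x
  exact_bot : ∀ {n m : ℤ} (hnm : n + 1 = m) {N M L : LowerSet ι} (hN : N ≤ M) (hM : M ≤ L)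
    (x : G m hN), map m hN (hN.trans hM) le_rfl hM x = 0 ↔ ∃ y, δ hnm hN hM y = x
  excision : ∀ n {M L M' L' : LowerSet ι} (h : M ≤ L) (h' : M' ≤ L') (hM : M ≤ M') (hL : L ≤ L'),
    L' ≤ L ⊔ M' → L ⊓ M' ≤ M → Function.Bijective (map n h h' hM hL)

namespace RelHomology

variable {ι : Type v} [PartialOrder ι] (𝓗 : RelHomology.{v, w} ι)

instance (n : ℤ) {M L : LowerSet ι} (h : M ≤ L) : AddCommGroup (𝓗.G n h) := 𝓗.addCommGroup n h

/-- In the exact sequence of the triple `(M, M, M)` both maps are the identity, so each class is an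
image and hence is sent to zero. -/
lemma eq_zero_of_le {n : ℤ} {M L : LowerSet ι} (h : M ≤ L) (h' : L ≤ M) (x : 𝓗.G n h) : x = 0 := by
  obtain rfl := le_antisymm h h'
  have := (𝓗.exact_mid n (le_refl M) (le_refl M) x).2 ⟨x, 𝓗.map_id _ _ _⟩
  rwa [𝓗.map_id] at this

lemma map_eq_zero_of_le {n : ℤ} {M L M' L' : LowerSet ι} (h : M ≤ L) (h' : M' ≤ L') (hM : M ≤ M')
    (hL : L ≤ L') (k : L ≤ M') (x : 𝓗.G n h) : 𝓗.map n h h' hM hL x = 0 := by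
  rw [← 𝓗.map_map n h (le_refl L) h' h le_rfl k hL, 𝓗.eq_zero_of_le le_rfl le_rfl (𝓗.map _ _ _ _ _ x),
    map_zero]

lemma δ_map_eq_zero {n m : ℤ} (hnm : n + 1 = m) {N M L : LowerSet ι} (hN : N ≤ M) (hM : M ≤ L)
    (y : 𝓗.G n (hN.trans hM)) : 𝓗.δ hnm hN hM (𝓗.map n (hN.trans hM) hM hN le_rfl y) = 0 :=
  (𝓗.exact_top hnm hN hM _).2 ⟨y, rfl⟩

lemma map_δ_eq_zero {n m : ℤ} (hnm : n + 1 = m) {N M L : LowerSet ι} (hN : N ≤ M) (hM : M ≤ L)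
    (y : 𝓗.G n hM) : 𝓗.map m hN (hN.trans hM) le_rfl hM (𝓗.δ hnm hN hM y) = 0 :=
  (𝓗.exact_bot hnm hN hM _).2 ⟨y, rfl⟩

/-! #### Cells -/

/-- `s` is a maximal element of `L` that does not lie in `M`. -/
structure IsTop (s : ι) (M L : LowerSet ι) : Prop where
  mem : s ∈ L
  notMem : s ∉ M
  eq_of_le : ∀ u ∈ L, s ≤ u → u = s

variable {𝓗}

lemma Iio_le_Iic (s : ι) : LowerSet.Iio s ≤ LowerSet.Iic s := fun _ h => le_of_lt h

variable (𝓗) in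
/-- The group `G n (s, ∂s)` of the cell `s`. -/
abbrev cell (n : ℤ) (s : ι) : Type w := 𝓗.G n (Iio_le_Iic s)

lemma le_erase {s : ι} {M L : LowerSet ι} (h : M ≤ L) (hs : s ∉ M) : M ≤ L.erase s :=
  fun _ hu => ⟨h hu, fun hsu => hs (M.lower hsu hu)⟩

lemma IsTop.le_erase {s : ι} {M L : LowerSet ι} (hs : IsTop s M L) (h : M ≤ L) : M ≤ L.erase s :=
  RelHomology.le_erase h hs.notMem

lemma IsTop.Iio_le_erase {s : ι} {M L : LowerSet ι} (hs : IsTop s M L) :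
    LowerSet.Iio s ≤ L.erase s :=
  fun _ hu => ⟨L.lower (le_of_lt hu) hs.mem, not_le_of_gt hu⟩

lemma IsTop.Iic_le {s : ι} {M L : LowerSet ι} (hs : IsTop s M L) : LowerSet.Iic s ≤ L :=
  fun _ hu => L.lower hu hs.mem

lemma erase_le_self (L : LowerSet ι) (s : ι) : L.erase s ≤ L := fun _ h => h.1

lemma erase_mono {L L' : LowerSet ι} (h : L ≤ L') (s : ι) : L.erase s ≤ L'.erase s := by
  intro u hu
  exact And.intro (h hu.1) hu.2

/-- Since `s` is maximal, `L` is covered by the closed cell and `L ∖ s`, and these meet in the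
boundary of `s`. -/
lemma IsTop.excision_bijective {s : ι} {M L : LowerSet ι} (hs : IsTop s M L) (n : ℤ) :
    Function.Bijective (𝓗.map n (Iio_le_Iic s) (erase_le_self L s) hs.Iio_le_erase hs.Iic_le) := by
  refine 𝓗.excision n _ _ _ _ (fun u hu => ?_) fun u hu => ?_
  · by_cases h : s ≤ u
    · exact Or.inl (hs.eq_of_le u hu h).le
    · exact Or.inr ⟨hu, h⟩
  · exact lt_of_le_of_ne hu.1 fun e => hu.2.2 (show s ≤ u from e.ge)

variable (𝓗) in
/-- The coefficient at the maximal cell `s`. -/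
def coeff (n : ℤ) {s : ι} {M L : LowerSet ι} (h : M ≤ L) (hs : IsTop s M L) :
    𝓗.G n h →+ 𝓗.cell n s :=
  (AddEquiv.ofBijective _ (hs.excision_bijective n)).symm.toAddMonoidHom.comp
    (𝓗.map n h (erase_le_self L s) (hs.le_erase h) le_rfl)

lemma map_coeff (n : ℤ) {s : ι} {M L : LowerSet ι} (h : M ≤ L) (hs : IsTop s M L) (x : 𝓗.G n h) :
    𝓗.map n (Iio_le_Iic s) (erase_le_self L s) hs.Iio_le_erase hs.Iic_le (𝓗.coeff n h hs x) =
      𝓗.map n h (erase_le_self L s) (hs.le_erase h) le_rfl x :=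
  (AddEquiv.ofBijective _ (hs.excision_bijective n)).apply_symm_apply _

lemma coeff_eq_iff (n : ℤ) {s : ι} {M L : LowerSet ι} (h : M ≤ L) (hs : IsTop s M L) (x : 𝓗.G n h)
    (m : 𝓗.cell n s) : 𝓗.coeff n h hs x = m ↔
      𝓗.map n h (erase_le_self L s) (hs.le_erase h) le_rfl x =
      𝓗.map n (Iio_le_Iic s) (erase_le_self L s) hs.Iio_le_erase hs.Iic_le m := by
  rw [← map_coeff]
  exact ((hs.excision_bijective n).1.eq_iff).symm

lemma coeff_map (n : ℤ) {s : ι} {M L M' L' : LowerSet ι} (h : M ≤ L) (h' : M' ≤ L') (hM : M ≤ M')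
    (hL : L ≤ L') (hs : IsTop s M L) (hs' : IsTop s M' L') (x : 𝓗.G n h) :
    𝓗.coeff n h' hs' (𝓗.map n h h' hM hL x) = 𝓗.coeff n h hs x := by
  have hle : L.erase s ≤ L'.erase s := erase_mono hL s
  rw [coeff_eq_iff, 𝓗.map_map, ← 𝓗.map_map n _ (erase_le_self L s) _ hs.Iio_le_erase hs.Iic_le hle hL,
    map_coeff, 𝓗.map_map]

/-- The subcomplex `L` lies in `L' ∖ s`, so every class on it dies relative to `L' ∖ s`. -/
lemma coeff_map_eq_zero (n : ℤ) {s : ι} {M L M' L' : LowerSet ι} (h : M ≤ L) (h' : M' ≤ L')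
    (hM : M ≤ M') (hL : L ≤ L') (hs : s ∉ L) (hs' : IsTop s M' L') (x : 𝓗.G n h) :
    𝓗.coeff n h' hs' (𝓗.map n h h' hM hL x) = 0 := by
  rw [coeff_eq_iff, map_zero, 𝓗.map_map]
  exact 𝓗.map_eq_zero_of_le _ _ _ _ (RelHomology.le_erase hL hs) _

lemma isTop_Iic (s : ι) : IsTop s (LowerSet.Iio s) (LowerSet.Iic s) where
  mem := le_refl s
  notMem := lt_irrefl s
  eq_of_le _ h h' := le_antisymm h h'

lemma coeff_Iic (n : ℤ) {s : ι} (x : 𝓗.cell n s) :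
    𝓗.coeff n (Iio_le_Iic s) (isTop_Iic s) x = x := by
  rw [coeff_eq_iff]

lemma coeff_push (n : ℤ) {s : ι} {M L : LowerSet ι} (h : M ≤ L) (hs : IsTop s M L)
    (hM : LowerSet.Iio s ≤ M) (m : 𝓗.cell n s) :
    𝓗.coeff n h hs (𝓗.map n (Iio_le_Iic s) h hM hs.Iic_le m) = m := by
  rw [coeff_map _ _ _ _ _ (isTop_Iic s), coeff_Iic]

lemma coeff_push_of_not_le (n : ℤ) {s t : ι} {M L : LowerSet ι} (h : M ≤ L) (ht : IsTop t M L)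
    (hM : LowerSet.Iio s ≤ M) (hL : LowerSet.Iic s ≤ L) (hst : ¬ t ≤ s) (m : 𝓗.cell n s) :
    𝓗.coeff n h ht (𝓗.map n (Iio_le_Iic s) h hM hL m) = 0 :=
  coeff_map_eq_zero _ _ _ _ _ hst _ _

lemma coeff_push_ne (n : ℤ) {s t : ι} {M L : LowerSet ι} (h : M ≤ L) (ht : IsTop t M L)
    (hM : LowerSet.Iio s ≤ M) (hL : LowerSet.Iic s ≤ L) (hst : s ≠ t) (m : 𝓗.cell n s) :
    𝓗.coeff n h ht (𝓗.map n (Iio_le_Iic s) h hM hL m) = 0 :=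
  coeff_push_of_not_le n h ht hM hL (fun k => hst (ht.eq_of_le s (hL (le_refl s)) k)) m

lemma mem_sdiff {L : LowerSet ι} {S : Set ι} {u : ι} :
    u ∈ L.sdiff S ↔ u ∈ L ∧ ∀ s ∈ S, ¬ s ≤ u := by
  rw [← SetLike.mem_coe, LowerSet.coe_sdiff, Set.mem_sdiff]
  simp [mem_upperClosure]

lemma sdiff_le_self (L : LowerSet ι) (S : Set ι) : L.sdiff S ≤ L := fun _ h => (mem_sdiff.1 h).1

lemma mem_sdiff_of_isTop {M L : LowerSet ι} {S : Set ι} (hS : ∀ s ∈ S, IsTop s M L) {u : ι} :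
    u ∈ L.sdiff S ↔ u ∈ L ∧ u ∉ S := by
  rw [mem_sdiff]
  refine and_congr_right fun hu => ⟨fun h hS' => h u hS' le_rfl, fun h s hs hsu => h ?_⟩
  rwa [(hS s hs).eq_of_le u hu hsu]

lemma le_sdiff {M L : LowerSet ι} (h : M ≤ L) {S : Set ι} (hS : ∀ s ∈ S, IsTop s M L) :
    M ≤ L.sdiff S := fun u hu => (mem_sdiff_of_isTop hS).2 ⟨h hu, fun k => (hS u k).notMem hu⟩

/-- A class vanishes off finitely many maximal cells if its coefficients at these cells do. -/
lemma map_sdiff_eq_zero (n : ℤ) {M L : LowerSet ι} (h : M ≤ L) (S : Set ι) (hfin : S.Finite)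
    (hS : ∀ s ∈ S, IsTop s M L) (x : 𝓗.G n h) (hx : ∀ s (hs : s ∈ S), 𝓗.coeff n h (hS s hs) x = 0) :
    𝓗.map n h (sdiff_le_self L S) (le_sdiff h hS) le_rfl x = 0 := by
  induction S, hfin using Set.Finite.induction_on with
  | empty =>
    refine 𝓗.eq_zero_of_le _ (fun u hu => ?_) _
    exact (mem_sdiff_of_isTop hS).2 ⟨hu, fun k => k⟩
  | @insert s S hsS _ ih =>
    have hS' : ∀ s ∈ S, IsTop s M L := fun t ht => hS t (Or.inr ht)
    have hs := hS s (Or.inl rfl)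
    have hle : L.sdiff (insert s S) ≤ L.sdiff S := fun u hu =>
      (mem_sdiff_of_isTop hS').2 ⟨((mem_sdiff_of_isTop hS).1 hu).1,
        fun k => ((mem_sdiff_of_isTop hS).1 hu).2 (Or.inr k)⟩
    have ih := ih hS' fun t ht => hx t (Or.inr ht)
    have hM := le_sdiff h hS
    rw [← 𝓗.map_map n h (hle.trans (sdiff_le_self L S)) (sdiff_le_self L S) hM le_rfl hle le_rfl,
      𝓗.exact_mid n hle (sdiff_le_self L S)] at ih
    obtain ⟨y, hy⟩ := ih
    have hse : L.sdiff (insert s S) ≤ L.erase s := fun u hu => by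
      obtain ⟨h1, h2⟩ := (mem_sdiff_of_isTop hS).1 hu
      exact ⟨h1, fun k => h2 (Or.inl (hs.eq_of_le u h1 k))⟩
    -- The class `y` lives on the single cell `s`. In `(L, L ∖ s)` it becomes the image of the
    -- coefficient of `x` at `s`, which is zero, and `hb` says by excision that nothing is lost
    -- there.
    have e : 𝓗.map n hle (erase_le_self L s) hse (sdiff_le_self L S) y = 0 := by
      rw [← 𝓗.map_map n hle (hle.trans (sdiff_le_self L S)) (erase_le_self L s) le_rfl
        (sdiff_le_self L S) hse le_rfl, hy, 𝓗.map_map, ← map_coeff n h hs, hx s (Or.inl rfl), map_zero]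
    have hb : Function.Injective (𝓗.map n hle (erase_le_self L s) hse (sdiff_le_self L S)) := by
      refine (𝓗.excision n _ _ _ _ (fun u hu => ?_) fun u hu => ?_).1
      · by_cases k : s ≤ u
        · obtain rfl := hs.eq_of_le u hu k
          exact Or.inl ((mem_sdiff_of_isTop hS').2 ⟨hu, hsS⟩)
        · exact Or.inr ⟨hu, k⟩
      · obtain ⟨h1, h2⟩ := (mem_sdiff_of_isTop hS').1 hu.1
        refine (mem_sdiff_of_isTop hS).2 ⟨h1, ?_⟩
        rintro (rfl | k)
        · exact hu.2.2 (le_refl u)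
        · exact h2 k
    rw [← hy, hb (e.trans (map_zero _).symm), map_zero]

/-! #### The incidence isomorphisms -/

lemma isTop_of_covBy {t s : ι} (h : t ⋖ s) : IsTop t ⊥ (LowerSet.Iio s) where
  mem := h.lt
  notMem k := k
  eq_of_le _ hu htu := (h.wcovBy.eq_or_eq htu (le_of_lt hu)).resolve_right (ne_of_lt hu)

variable (𝓗) in
/-- The component `G n (s, ∂s) → G (n + 1) (∂s) → G (n + 1) (t, ∂t)` of the connecting map at a
facet `t` of `s`. -/
def inc {n m : ℤ} (hnm : n + 1 = m) {t s : ι} (h : t ⋖ s) : 𝓗.cell n s →+ 𝓗.cell m t :=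
  (𝓗.coeff m bot_le (isTop_of_covBy h)).comp (𝓗.δ hnm bot_le (Iio_le_Iic s))

/-- The coefficients of a boundary. -/
theorem coeff_δ {n m : ℤ} (hnm : n + 1 = m) {N M L : LowerSet ι} (hN : N ≤ M) (hM : M ≤ L) {t : ι}
    (ht : IsTop t N M) (S : Finset ι) (hS : ∀ s ∈ S, IsTop s M L)
    (hSM : ∀ s ∈ S, LowerSet.Iio s ≤ M) (hcov : ∀ s ∈ S, t ⋖ s) (hall : ∀ s ∈ L, t < s → s ∈ S)
    (x : 𝓗.G n hM) :
    𝓗.coeff m hN ht (𝓗.δ hnm hN hM x) =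
      ∑ s : S, 𝓗.inc hnm (hcov s s.2) (𝓗.coeff n hM (hS s s.2) x) := by
  classical
  have hpush : ∀ (s : ι) (hs : s ∈ S) (m : 𝓗.cell n s), 𝓗.coeff _ hN ht (𝓗.δ hnm hN hM
      (𝓗.map n (Iio_le_Iic s) hM (hSM s hs) (hS s hs).Iic_le m)) = 𝓗.inc hnm (hcov s hs) m := by
    intro s hs m
    rw [← 𝓗.δ_map hnm bot_le (Iio_le_Iic s) hN hM bot_le (hSM s hs) (hS s hs).Iic_le,
      coeff_map _ _ _ _ _ (isTop_of_covBy (hcov s hs))]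
    rfl
  -- Subtracting the contributions of the cells in `S`, for which the formula is `hpush`, reduces
  -- the claim to a class without coefficients on `S`.
  let x' := x - ∑ s : S, 𝓗.map n (Iio_le_Iic s.1) hM (hSM s s.2) (hS s s.2).Iic_le
    (𝓗.coeff n hM (hS s s.2) x)
  have hx' : ∀ s (hs : s ∈ S), 𝓗.coeff n hM (hS s hs) x' = 0 := by
    intro s hs
    rw [map_sub, map_sum, Finset.sum_eq_single (⟨s, hs⟩ : S), coeff_push, sub_self]
    · intro t _ hts
      exact coeff_push_ne _ _ _ _ _ (fun e => hts (Subtype.ext e)) _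
    · exact fun k => absurd (Finset.mem_univ _) k
  have key : 𝓗.coeff m hN ht (𝓗.δ hnm hN hM x') = 0 := by
    have h0 := map_sdiff_eq_zero n hM (S : Set ι) S.finite_toSet hS x' hx'
    have hMQ := le_sdiff hM (S := (S : Set ι)) hS
    -- So `x'` comes from `Q = L ∖ S`. All cells of `L` above `t` have been removed, hence `t` is
    -- still maximal in `Q` and the coefficient at `t` can be read off in `(Q, Q ∖ t)`. There it
    -- vanishes, because the boundary of `y` is already zero in `(Q, N)`.
    obtain ⟨y, hy⟩ := (𝓗.exact_mid n hMQ (sdiff_le_self L S) x').1 h0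
    rw [← hy, ← 𝓗.δ_map hnm hN hMQ hN hM le_rfl le_rfl (sdiff_le_self L S), 𝓗.map_id,
      coeff_eq_iff, map_zero]
    have hMQ' : M.erase t ≤ (L.sdiff S).erase t := erase_mono hMQ t
    have hb : Function.Injective (𝓗.map m (erase_le_self M t) (erase_le_self (L.sdiff S) t)
        hMQ' hMQ) := by
      refine (𝓗.excision m (erase_le_self M t) (erase_le_self (L.sdiff S) t) hMQ' hMQ
        (fun u hu => ?_) fun u hu => And.intro hu.1 hu.2.2).1
      by_cases k : t ≤ u
      · obtain ⟨h1, h2⟩ := (mem_sdiff_of_isTop hS).1 hu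
        rcases k.eq_or_lt with rfl | k
        · exact Or.inl ht.mem
        · exact absurd (hall u h1 k) h2
      · exact Or.inr ⟨hu, k⟩
    refine hb ?_
    rw [map_zero, 𝓗.map_map, ← 𝓗.map_map m hN (hN.trans hMQ) (erase_le_self (L.sdiff S) t) le_rfl
      hMQ ((ht.le_erase hN).trans hMQ') le_rfl, 𝓗.map_δ_eq_zero, map_zero]
  rw [map_sub, map_sub, map_sum, map_sum, sub_eq_zero] at key
  rw [key]
  exact Finset.sum_congr rfl fun s _ => hpush s s.2 _

/-- The two ways to pass to a face of codimension two cancel. -/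
theorem inc_inc_add {n m k : ℤ} (hnm : n + 1 = m) (hmk : m + 1 = k) {r t t' s : ι} (hrt : r ⋖ t)
    (hrt' : r ⋖ t') (hts : t ⋖ s) (hts' : t' ⋖ s) (hne : t ≠ t')
    (hall : ∀ u, r < u → u < s → u = t ∨ u = t') (x : 𝓗.cell n s) :
    𝓗.inc hmk hrt (𝓗.inc hnm hts x) + 𝓗.inc hmk hrt' (𝓗.inc hnm hts' x) = 0 := by
  classical
  -- With `M = ∂t ∪ ∂t'`, both `t` and `t'` are cells of `(∂s, M)` and `r` is a maximal cell of `M`.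
  -- The image of `δ x` in `(∂s, M)` has zero boundary in `M`, and the coefficient of this boundary
  -- at `r` is the desired sum.
  let M : LowerSet ι := LowerSet.Iio t ⊔ LowerSet.Iio t'
  have hM : M ≤ LowerSet.Iio s := sup_le (fun u hu => lt_trans hu hts.lt) fun u hu =>
    lt_trans hu hts'.lt
  have hr : IsTop r ⊥ M := by
    refine ⟨Or.inl hrt.lt, fun k => k, ?_⟩
    rintro u (hu | hu) hru
    · exact (hrt.wcovBy.eq_or_eq hru (le_of_lt hu)).resolve_right (ne_of_lt hu)
    · exact (hrt'.wcovBy.eq_or_eq hru (le_of_lt hu)).resolve_right (ne_of_lt hu)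
  have htM : t ∉ M := by
    rintro (h | h)
    · exact lt_irrefl t h
    · exact hts.2 h hts'.lt
  have htM' : t' ∉ M := by
    rintro (h | h)
    · exact hts'.2 h hts.lt
    · exact lt_irrefl t' h
  have ht : IsTop t M (LowerSet.Iio s) := ⟨hts.lt, htM, (isTop_of_covBy hts).eq_of_le⟩
  have ht' : IsTop t' M (LowerSet.Iio s) := ⟨hts'.lt, htM', (isTop_of_covBy hts').eq_of_le⟩
  have e := coeff_δ (𝓗 := 𝓗) hmk (bot_le : ⊥ ≤ M) hM hr {t, t'}
    (by simp [ht, ht'])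
    (by
      intro u hu
      rcases Finset.mem_insert.1 hu with rfl | hu
      · exact le_sup_left
      · rw [Finset.mem_singleton.1 hu]; exact le_sup_right)
    (by simp [hrt, hrt']) (fun u hu hru => by simpa using hall u hru hu)
    (𝓗.map m bot_le hM bot_le le_rfl (𝓗.δ hnm bot_le (Iio_le_Iic s) x))
  rw [𝓗.δ_map_eq_zero, map_zero, Fintype.sum_eq_add ⟨t, by simp⟩ ⟨t', by simp⟩
    (fun k => hne (congrArg Subtype.val k)), coeff_map _ _ _ _ _ (isTop_of_covBy hts),
    coeff_map _ _ _ _ _ (isTop_of_covBy hts')] at e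
  · exact e.symm
  · rintro ⟨u, hu⟩ ⟨h1, h2⟩
    rcases Finset.mem_insert.1 hu with rfl | hu
    · exact absurd rfl h1
    · obtain rfl := Finset.mem_singleton.1 hu
      exact absurd rfl h2

end RelHomology

namespace RelHomology

variable {ι : Type v} [PartialOrder ι] {𝓗 : RelHomology.{v, w} ι}

/-! #### Acyclicity of cones -/

lemma Iic_le_Iic {s t : ι} (h : s ≤ t) : LowerSet.Iic s ≤ LowerSet.Iic t := fun _ hu => le_trans hu h

variable (𝓗) in
/-- The absolute groups. -/
abbrev abs (n : ℤ) (L : LowerSet ι) : Type w := 𝓗.G n (bot_le : ⊥ ≤ L)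

variable (𝓗) in
/-- The map of absolute groups induced by an inclusion. -/
abbrev absMap (n : ℤ) {L L' : LowerSet ι} (h : L ≤ L') : 𝓗.abs n L →+ 𝓗.abs n L' :=
  𝓗.map n bot_le bot_le le_rfl h

lemma absMap_absMap (n : ℤ) {L L' L'' : LowerSet ι} (h : L ≤ L') (h' : L' ≤ L'')
    (x : 𝓗.abs n L) : 𝓗.absMap n h' (𝓗.absMap n h x) = 𝓗.absMap n (h.trans h') x :=
  𝓗.map_map _ _ _ _ _ _ _ _ _

/-- In the long exact sequence, injectivity one degree higher kills `δ x`, and surjectivity in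
degree `n` then kills `x`. -/
lemma eq_zero_of_absMap_bijective {M L : LowerSet ι} (h : M ≤ L)
    (hb : ∀ n, Function.Bijective (𝓗.absMap n h)) (n : ℤ) (x : 𝓗.G n h) : x = 0 := by
  have h1 : 𝓗.δ rfl bot_le h x = 0 := (hb (n + 1)).1 <| by
    rw [map_zero]
    exact 𝓗.map_δ_eq_zero rfl bot_le h x
  obtain ⟨y, rfl⟩ := (𝓗.exact_top rfl bot_le h x).1 h1
  obtain ⟨z, rfl⟩ := (hb n).2 y
  exact (𝓗.exact_mid n bot_le h _).2 ⟨z, rfl⟩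

/-- Vanishing in degree `n - 1` gives injectivity, vanishing in degree `n` gives surjectivity. -/
lemma absMap_bijective_of_eq_zero {M L : LowerSet ι} (h : M ≤ L)
    (h0 : ∀ n (x : 𝓗.G n h), x = 0) (n : ℤ) : Function.Bijective (𝓗.absMap n h) := by
  refine ⟨(injective_iff_map_eq_zero _).2 fun x hx => ?_, fun y => ?_⟩
  · obtain ⟨y, rfl⟩ := (𝓗.exact_bot (show n - 1 + 1 = n by omega) bot_le h x).1 hx
    rw [h0 _ y, map_zero]
  · exact (𝓗.exact_mid n bot_le h y).1 (h0 _ _)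

/-- The lower set generated by a list. -/
def lowerList (l : List ι) : LowerSet ι := ⟨{u | ∃ s ∈ l, u ≤ s}, fun _ _ hba ⟨s, hs, h⟩ =>
  ⟨s, hs, le_trans hba h⟩⟩

lemma mem_lowerList {l : List ι} {u : ι} : u ∈ lowerList l ↔ ∃ s ∈ l, u ≤ s := Iff.rfl

/-- If the simplices containing `v` are acyclic relative to `v`, then so are their finite unions. -/
theorem absMap_lowerList_bijective (v : ι)
    (hac : ∀ s (h : v ≤ s) n, Function.Bijective (𝓗.absMap n (Iic_le_Iic h)))
    (hinf : ∀ s t, v ≤ s → v ≤ t → ∃ m, ∀ u, u ≤ m ↔ u ≤ s ∧ u ≤ t) (l : List ι) (hl : l ≠ [])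
    (hv : ∀ s ∈ l, v ≤ s) (hle : LowerSet.Iic v ≤ lowerList l) (n : ℤ) :
    Function.Bijective (𝓗.absMap n hle) := by
  classical
  -- A Mayer–Vietoris induction that splits off one generator `s`. The remaining union is generated
  -- by `l`, and its intersection with `s` by the meets of `s` with the members of `l`. Both lists
  -- have the same length, so the induction runs over the length, for all lists and all degrees.
  induction hk : l.length generalizing l n with
  | zero => exact absurd (List.eq_nil_of_length_eq_zero hk) hl
  | succ k ih =>
    obtain ⟨s, l, rfl⟩ := List.exists_cons_of_ne_nil hl
    have hvs : v ≤ s := hv s (by simp)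
    by_cases hl' : l = []
    · subst hl'
      have e : lowerList [s] = LowerSet.Iic s := by
        ext u; simp [lowerList]
      have gen : ∀ (L : LowerSet ι) (hL : L = LowerSet.Iic s) (hle : LowerSet.Iic v ≤ L),
          Function.Bijective (𝓗.absMap n hle) := by
        rintro _ rfl hle
        exact hac s hvs n
      exact gen _ e hle
    · have hvl : ∀ t ∈ l, v ≤ t := fun t ht => hv t (by simp [ht])
      have hlen : l.length = k := by simpa using hk
      have hex : ∃ f : ι → ι, ∀ t ∈ l, ∀ u, u ≤ f t ↔ u ≤ s ∧ u ≤ t := by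
        choose! f hf using fun t (ht : v ≤ t) => hinf s t hvs ht
        exact ⟨f, fun t ht => hf t (hvl t ht)⟩
      obtain ⟨f, hf⟩ := hex
      have hvl' : ∀ t ∈ l.map f, v ≤ t := by
        intro t ht
        obtain ⟨t, ht', rfl⟩ := List.mem_map.1 ht
        exact (hf t ht' v).2 ⟨hvs, hvl t ht'⟩
      have hle1 : LowerSet.Iic v ≤ lowerList l := by
        obtain ⟨t, ht⟩ := List.exists_mem_of_ne_nil l hl'
        exact fun u hu => ⟨t, ht, le_trans hu (hvl t ht)⟩
      have hle2 : LowerSet.Iic v ≤ lowerList (l.map f) := by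
        obtain ⟨t, ht⟩ := List.exists_mem_of_ne_nil l hl'
        exact fun u hu => ⟨f t, List.mem_map_of_mem ht,
          le_trans hu (hvl' _ (List.mem_map_of_mem ht))⟩
      have hls : lowerList (l.map f) ≤ LowerSet.Iic s := by
        rintro u ⟨t, ht, hut⟩
        obtain ⟨t, ht', rfl⟩ := List.mem_map.1 ht
        exact ((hf t ht' u).1 hut).1
      have hll : lowerList (l.map f) ≤ lowerList l := by
        rintro u ⟨t, ht, hut⟩
        obtain ⟨t, ht', rfl⟩ := List.mem_map.1 ht
        exact ⟨t, ht', ((hf t ht' u).1 hut).2⟩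
      have hlc : lowerList l ≤ lowerList (s :: l) := by
        rintro u ⟨t, ht, hut⟩
        exact ⟨t, by simp [ht], hut⟩
      have hsc : LowerSet.Iic s ≤ lowerList (s :: l) := fun u hu => ⟨s, by simp, hu⟩
      have b1 := fun n => ih l hl' hvl hle1 n hlen
      have b2 := fun n => ih (l.map f) (by simpa using hl') hvl' hle2 n (by simpa using hlen)
      -- Two out of three for `v ⊆ s ∩ ⋃ l ⊆ s`.
      have b3 : ∀ n, Function.Bijective (𝓗.absMap n hls) := fun n => by
        have := hac s hvs n
        rw [← Function.Bijective.of_comp_iff _ (b2 n)]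
        refine (congrArg Function.Bijective (funext fun x => ?_)).mpr this
        exact absMap_absMap n hle2 hls x
      have z1 := eq_zero_of_absMap_bijective hls b3
      -- By excision, adjoining `s` to the union of `l` has the same relative groups as the pair
      -- `(s, s ∩ ⋃ l)`, and these vanish.
      have z2 : ∀ n (x : 𝓗.G n hlc), x = 0 := fun n x => by
        obtain ⟨y, rfl⟩ := (𝓗.excision n hls hlc hll hsc (by
            rintro u ⟨t, ht, hut⟩
            rcases List.mem_cons.1 ht with rfl | ht
            · exact Or.inl hut
            · exact Or.inr ⟨t, ht, hut⟩) (by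
            rintro u ⟨hus, t, ht, hut⟩
            exact ⟨f t, List.mem_map_of_mem ht, (hf t ht u).2 ⟨hus, hut⟩⟩)).2 x
        rw [z1 n y, map_zero]
      have b4 := absMap_bijective_of_eq_zero hlc z2 n
      have := b4.comp (b1 n)
      refine (congrArg Function.Bijective (funext fun x => ?_)).mpr this
      exact (absMap_absMap n hle1 hlc x).symm

/-- The incidence map at a facet is an isomorphism if the other facets have a common vertex. -/
theorem inc_bijective {n m : ℤ} (hnm : n + 1 = m) {t s v : ι} (h : t ⋖ s) (hvs : v ≤ s)
    (hac : ∀ s (h : v ≤ s) n, Function.Bijective (𝓗.absMap n (Iic_le_Iic h)))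
    (hinf : ∀ s t, v ≤ s → v ≤ t → ∃ m, ∀ u, u ≤ m ↔ u ≤ s ∧ u ≤ t) (l : List ι) (hl : l ≠ [])
    (hv : ∀ s ∈ l, v ≤ s) (hll : ∀ u, u ∈ lowerList l ↔ u < s ∧ u ≠ t) :
    Function.Bijective (𝓗.inc hnm h) := by
  have ht := isTop_of_covBy h
  -- The boundary of `s` without the open facet `t` is the union of the other facets, a cone with
  -- apex `v`.
  have e : lowerList l = (LowerSet.Iio s).erase t := by
    ext u
    refine (hll u).trans (and_congr_right fun hu => not_congr ⟨fun k => k.ge, fun k => ?_⟩)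
    exact ht.eq_of_le u hu k
  have hle : LowerSet.Iic v ≤ (LowerSet.Iio s).erase t := by
    rw [← e]
    obtain ⟨t, ht⟩ := List.exists_mem_of_ne_nil l hl
    exact fun u hu => ⟨t, ht, le_trans hu (hv t ht)⟩
  have b1 : ∀ n, Function.Bijective (𝓗.absMap n hle) := fun n => by
    have gen : ∀ (L : LowerSet ι) (hL : lowerList l = L) (hle : LowerSet.Iic v ≤ L),
        Function.Bijective (𝓗.absMap n hle) := by
      rintro _ rfl hle
      exact absMap_lowerList_bijective v hac hinf l hl hv hle n
    exact gen _ e hle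
  have hes := erase_le_self (LowerSet.Iio s) t
  -- The cone and `s` itself are both acyclic relative to `v`, so the groups of the pair `(s, ∂s ∖
  -- t)` vanish.
  have b2 : ∀ n, Function.Bijective (𝓗.absMap n (hes.trans (Iio_le_Iic s))) := fun n => by
    rw [← Function.Bijective.of_comp_iff _ (b1 n)]
    refine (congrArg Function.Bijective (funext fun x => ?_)).mpr (hac s hvs n)
    exact absMap_absMap n hle (hes.trans (Iio_le_Iic s)) x
  have z := eq_zero_of_absMap_bijective _ b2
  have b3 : Function.Bijective (𝓗.δ hnm hes (Iio_le_Iic s)) := by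
    refine ⟨(injective_iff_map_eq_zero _).2 fun x hx => ?_, fun y => ?_⟩
    · obtain ⟨y, rfl⟩ := (𝓗.exact_top hnm hes _ x).1 hx
      rw [z n y, map_zero]
    · exact (𝓗.exact_bot hnm hes _ y).1 (z m _)
  -- The connecting map `(s, ∂s) → (∂s, ∂s ∖ t)` followed by excision to `(t, ∂t)` is bijective;
  -- naturality of `δ` identifies the composite with `inc`.
  have b4 := (AddEquiv.ofBijective _ (ht.excision_bijective (𝓗 := 𝓗) m)).symm.bijective.comp b3
  refine (congrArg Function.Bijective (funext fun x => ?_)).mpr b4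
  refine congrArg (AddEquiv.ofBijective _ (ht.excision_bijective (𝓗 := 𝓗) m)).symm ?_
  refine (𝓗.δ_map hnm bot_le (Iio_le_Iic s) hes (Iio_le_Iic s) bot_le le_rfl le_rfl x).trans ?_
  rw [𝓗.map_id]

/-! #### Vertices and edges -/

variable (𝓗) in
/-- The identification of the group of a minimal cell with its absolute group. -/
def vertexMap (n : ℤ) {v : ι} (hv : LowerSet.Iio v ≤ ⊥) : 𝓗.cell n v →+ 𝓗.abs n (LowerSet.Iic v) :=
  𝓗.map n (Iio_le_Iic v) bot_le hv le_rfl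

lemma vertexMap_bijective (n : ℤ) {v : ι} (hv : LowerSet.Iio v ≤ ⊥) :
    Function.Bijective (𝓗.vertexMap n hv) :=
  𝓗.excision n _ _ _ _ le_sup_left (inf_le_right.trans bot_le)

/-- The boundary of an edge consists of two points, so `δ x` is the sum of its two coefficients, and
its image in the edge vanishes by exactness. This replaces `inc_inc_add` in dimension one, where
there is no face of codimension two. -/
theorem edge_relation {n m : ℤ} (hnm : n + 1 = m) {v w s : ι} (hv : LowerSet.Iio v ≤ ⊥)
    (hw : LowerSet.Iio w ≤ ⊥) (hvs : v ⋖ s) (hws : w ⋖ s) (hne : v ≠ w)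
    (hall : ∀ u, u < s → u = v ∨ u = w) (x : 𝓗.cell n s) :
    𝓗.absMap m (Iic_le_Iic hvs.le) (𝓗.vertexMap m hv (𝓗.inc hnm hvs x)) +
      𝓗.absMap m (Iic_le_Iic hws.le) (𝓗.vertexMap m hw (𝓗.inc hnm hws x)) = 0 := by
  let y := 𝓗.δ hnm bot_le (Iio_le_Iic s) x
  let S : Set ι := {v, w}
  have htv := isTop_of_covBy hvs
  have htw := isTop_of_covBy hws
  have hS : ∀ t ∈ S, IsTop t ⊥ (LowerSet.Iio s) := by
    rintro t (rfl | rfl)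
    · exact htv
    · exact htw
  have hvw : ¬ v ≤ w := fun k => by
    rcases k.eq_or_lt with rfl | k
    · exact hne rfl
    · exact hw k
  have hwv : ¬ w ≤ v := fun k => by
    rcases k.eq_or_lt with rfl | k
    · exact hne rfl
    · exact hv k
  let y' := y - (𝓗.map m (Iio_le_Iic v) bot_le hv htv.Iic_le (𝓗.inc hnm hvs x) +
    𝓗.map m (Iio_le_Iic w) bot_le hw htw.Iic_le (𝓗.inc hnm hws x))
  have hy' : y' = 0 := by
    have h0 := map_sdiff_eq_zero m (bot_le : ⊥ ≤ LowerSet.Iio s) S (Set.toFinite _) hS y' (by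
      rintro t (rfl | rfl)
      · rw [map_sub, map_add, coeff_push, coeff_push_of_not_le _ _ _ _ _ hvw, add_zero]
        exact sub_self _
      · rw [map_sub, map_add, coeff_push, coeff_push_of_not_le _ _ _ _ _ hwv, zero_add]
        exact sub_self _)
    -- Nothing is left after both vertices have been removed, so a class on `∂s` without
    -- coefficients is zero.
    have hle : (LowerSet.Iio s).sdiff S ≤ ⊥ := fun u hu =>
      (((mem_sdiff_of_isTop hS).1 hu).2 (hall u ((mem_sdiff_of_isTop hS).1 hu).1)).elim
    have := congrArg (𝓗.map m (sdiff_le_self (LowerSet.Iio s) S) bot_le hle le_rfl) h0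
    rwa [𝓗.map_map, map_zero, 𝓗.map_id] at this
  have e := 𝓗.map_δ_eq_zero hnm bot_le (Iio_le_Iic s) x
  change 𝓗.map m _ _ _ _ y = 0 at e
  rw [sub_eq_zero.1 hy', map_add, 𝓗.map_map, 𝓗.map_map] at e
  rw [vertexMap, vertexMap, 𝓗.map_map, 𝓗.map_map]
  exact e

end RelHomology

/-! ### Faces of a simplicial complex and their orderings -/

namespace AbstractSimplicialComplex

variable {V : Type v} {K : AbstractSimplicialComplex V}

variable (K) in
/-- The faces of a simplicial complex, ordered by inclusion. -/
abbrev Face : Type v := {s : Finset V // s ∈ K.faces}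

lemma Face.nonempty (s : K.Face) : s.1.Nonempty := (K.isRelLowerSet_faces s.2).1

lemma mem_faces_of_subset {s t : Finset V} (hs : s ∈ K.faces) (h : t ⊆ s) (ht : t.Nonempty) :
    t ∈ K.faces :=
  (K.isRelLowerSet_faces hs).2 h ht

/-- `v` is an ordering of the vertices of `s`. -/
structure IsOrdering {p : ℕ} (v : Fin (p + 1) → V) (s : K.Face) : Prop where
  injective : Function.Injective v
  range_eq : Set.range v = (s.1 : Set V)

namespace IsOrdering

variable {p : ℕ} {s t : K.Face}

lemma mem {v : Fin (p + 1) → V} (h : IsOrdering v s) (i : Fin (p + 1)) : v i ∈ s.1 := by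
  rw [← Finset.mem_coe, ← h.range_eq]; exact ⟨i, rfl⟩

lemma exists_eq {v : Fin (p + 1) → V} (h : IsOrdering v s) {a : V} (ha : a ∈ s.1) :
    ∃ i, v i = a := by
  rwa [← Finset.mem_coe, ← h.range_eq] at ha

lemma eq {v : Fin (p + 1) → V} (h : IsOrdering v s) (h' : IsOrdering v t) : s = t :=
  Subtype.ext (Finset.coe_injective (h.range_eq.symm.trans h'.range_eq))

lemma comp_perm {v : Fin (p + 1) → V} (h : IsOrdering v s) (π : Equiv.Perm (Fin (p + 1))) :
    IsOrdering (v ∘ π) s where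
  injective := h.injective.comp π.injective
  range_eq := by rw [EquivLike.range_comp, h.range_eq]

lemma card_eq {v : Fin (p + 1) → V} (h : IsOrdering v s) : s.1.card = p + 1 := by
  have : s.1 = Finset.univ.map ⟨v, h.injective⟩ := by
    refine Finset.coe_injective ?_
    rw [Finset.coe_map, Finset.coe_univ, Set.image_univ]
    exact h.range_eq.symm
  rw [this, Finset.card_map, Finset.card_univ, Fintype.card_fin]

lemma comp_succAbove [DecidableEq V] {v : Fin (p + 2) → V} (h : IsOrdering v s) (l : Fin (p + 2))
    (ht : t.1 = s.1.erase (v l)) : IsOrdering (v ∘ l.succAbove) t where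
  injective := h.injective.comp Fin.succAbove_right_injective
  range_eq := by
    rw [Set.range_comp, Fin.range_succAbove, Set.image_compl_eq_range_sdiff_image h.injective,
      Set.image_singleton, h.range_eq, ht, Finset.coe_erase]

lemma tail [DecidableEq V] {v : Fin (p + 2) → V} (h : IsOrdering v s)
    (ht : t.1 = s.1.erase (v 0)) : IsOrdering (Fin.tail v) t := by
  have := h.comp_succAbove 0 ht
  rwa [Fin.succAbove_zero] at this

end IsOrdering

lemma IsOrdering.Iio_le_bot {s : K.Face} {v : Fin 1 → V} (h : IsOrdering v s) :
    LowerSet.Iio s ≤ ⊥ := fun u hu => by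
  have h1 := Finset.card_lt_card (show u.1 ⊂ s.1 from hu)
  have h2 := u.nonempty.card_pos
  rw [h.card_eq] at h1
  omega

variable [DecidableEq V]

/-- The facet of `s` opposite to the vertex `a`. -/
def Face.erase (s : K.Face) (a : V) (h : (s.1.erase a).Nonempty) : K.Face :=
  ⟨s.1.erase a, mem_faces_of_subset s.2 (Finset.erase_subset _ _) h⟩

lemma covBy_of_eq_erase {s t : K.Face} {a : V} (ha : a ∈ s.1) (h : t.1 = s.1.erase a) : t ⋖ s := by
  have := Finset.erase_covBy ha
  rw [← h] at this
  exact ⟨this.lt, fun u h1 h2 => this.2 (show t.1 < u.1 from h1) h2⟩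

lemma IsOrdering.erase_nonempty {p : ℕ} {s : K.Face} {v : Fin (p + 2) → V} (h : IsOrdering v s)
    (i : Fin (p + 2)) : (s.1.erase (v i)).Nonempty := by
  obtain ⟨j, hj⟩ := exists_ne i
  exact ⟨v j, Finset.mem_erase.2 ⟨fun e => hj (h.injective e), h.mem j⟩⟩

/-- A face strictly between `r` and `s` contains exactly one of the two vertices missing from `r`.
This is the condition on intermediate cells in `RelHomology.inc_inc_add`. -/
lemma eq_or_eq_of_lt_of_lt {r u s : K.Face} {a b : V} (hr : r.1 = (s.1.erase a).erase b)
    (h1 : r < u) (h2 : u < s) : u.1 = s.1.erase a ∨ u.1 = s.1.erase b := by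
  have h1' : r.1 ⊂ u.1 := h1
  have h2' : u.1 ⊂ s.1 := h2
  have hru : r.1 ⊆ u.1 := h1'.1
  have hus : u.1 ⊆ s.1 := h2'.1
  obtain ⟨x, hxu, hxr⟩ := Finset.exists_of_ssubset h1'
  obtain ⟨y, hys, hyu⟩ := Finset.exists_of_ssubset h2'
  have hr' : ∀ z, z ∈ r.1 ↔ z ≠ b ∧ z ≠ a ∧ z ∈ s.1 := fun z => by
    rw [hr, Finset.mem_erase, Finset.mem_erase]
  have hxab : x = a ∨ x = b := by
    by_contra! hc
    exact hxr ((hr' x).2 ⟨hc.2, hc.1, hus hxu⟩)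
  have hyab : y = a ∨ y = b := by
    by_contra! hc
    exact hyu (hru ((hr' y).2 ⟨hc.2, hc.1, hys⟩))
  have hru' : ∀ z ∈ s.1, z ≠ a → z ≠ b → z ∈ u.1 := fun z hz h h' => hru ((hr' z).2 ⟨h', h, hz⟩)
  rcases hyab with rfl | rfl
  · left
    ext z
    rw [Finset.mem_erase]
    refine ⟨fun hz => ⟨fun e => hyu (e ▸ hz), hus hz⟩, fun ⟨h, hz⟩ => ?_⟩
    by_cases hzb : z = b
    · rcases hxab with rfl | rfl
      · exact absurd hxu hyu
      · rwa [hzb]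
    · exact hru' z hz h hzb
  · right
    ext z
    rw [Finset.mem_erase]
    refine ⟨fun hz => ⟨fun e => hyu (e ▸ hz), hus hz⟩, fun ⟨h, hz⟩ => ?_⟩
    by_cases hza : z = a
    · rcases hxab with rfl | rfl
      · rwa [hza]
      · exact absurd hxu hyu
    · exact hru' z hz hza h

end AbstractSimplicialComplex

lemma Fin.tail_comp_swap_succ {V : Type*} {p : ℕ} (v : Fin (p + 2) → V) (j : Fin p) :
    Fin.tail (v ∘ Equiv.swap j.succ.castSucc j.succ.succ) =
      Fin.tail v ∘ Equiv.swap j.castSucc j.succ := by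
  funext k
  simp only [Fin.tail, Function.comp_apply]
  congr 1
  rw [← Fin.succ_castSucc]
  exact (Fin.succ_injective _).swap_apply _ _ _

/-! ### Orientation isomorphisms of simplices and their signs -/

namespace RelHomology

open AbstractSimplicialComplex

variable {V : Type v} [DecidableEq V] {K : AbstractSimplicialComplex V}
  {𝓗 : RelHomology.{v, w} K.Face}

variable (𝓗) in
/-- All simplices are acyclic. -/
def Acyclic : Prop := ∀ (s t : K.Face) (h : s ≤ t) (n : ℤ),
  Function.Bijective (𝓗.absMap n (Iic_le_Iic h))

/-- All facets of `s` other than the one opposite to `a` contain `a`, so they form a cone with apex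
`a`. -/
lemma Acyclic.inc_bijective (hac : 𝓗.Acyclic) {n m : ℤ} (hnm : n + 1 = m) {t s : K.Face} {a : V}
    (ha : a ∈ s.1) (hta : t.1 = s.1.erase a) (h : t ⋖ s) : Function.Bijective (𝓗.inc hnm h) := by
  have hs : ∀ b : {b // b ∈ s.1.erase a}, a ∈ s.1.erase b := fun b =>
    Finset.mem_erase.2 ⟨(Finset.ne_of_mem_erase b.2).symm, ha⟩
  let v : K.Face := ⟨{a}, mem_faces_of_subset s.2 (by simpa using ha) (by simp)⟩
  have hv : ∀ u : K.Face, v ≤ u ↔ a ∈ u.1 := fun u => Finset.singleton_subset_iff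
  refine RelHomology.inc_bijective hnm h (v := v) ((hv s).2 ha) (fun s h n => hac v s h n) ?_
    ((s.1.erase a).attach.toList.map fun b : {b // b ∈ s.1.erase a} => s.erase b ⟨a, hs b⟩) ?_ ?_ ?_
  · intro s t hs ht
    rw [hv] at hs ht
    refine ⟨⟨s.1 ∩ t.1, mem_faces_of_subset s.2 Finset.inter_subset_left
      ⟨a, Finset.mem_inter.2 ⟨hs, ht⟩⟩⟩, fun u => ?_⟩
    exact Finset.subset_inter_iff
  · obtain ⟨b, hb⟩ := t.nonempty
    rw [hta] at hb
    intro e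
    simp only [List.map_eq_nil_iff, Finset.toList_eq_nil, Finset.attach_eq_empty_iff] at e
    rw [e] at hb
    exact absurd hb (Finset.notMem_empty b)
  · intro u hu
    obtain ⟨b, -, rfl⟩ := List.mem_map.1 hu
    exact (hv _).2 (hs b)
  · intro u
    rw [mem_lowerList]
    constructor
    · rintro ⟨_, hu, hle⟩
      obtain ⟨b, -, rfl⟩ := List.mem_map.1 hu
      have hle' : u.1 ⊆ s.1.erase b := hle
      have hbs := Finset.mem_of_mem_erase b.2
      refine ⟨lt_of_le_of_ne (fun z hz => Finset.mem_of_mem_erase (hle' hz)) ?_, ?_⟩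
      · rintro rfl
        exact absurd (hle' hbs) (Finset.notMem_erase _ _)
      · rintro rfl
        exact absurd (hle' (hta.symm.subset b.2)) (Finset.notMem_erase _ _)
    · rintro ⟨hus, hut⟩
      have hsub : u.1 ⊆ s.1 := hus.le
      -- A face of `s` that lies in none of the listed facets contains every vertex except possibly
      -- `a`; being proper, it is `t`.
      by_contra! hc
      have h1 : ∀ b ∈ s.1, b ≠ a → b ∈ u.1 := by
        intro b hb hba
        by_contra hbu
        refine hc _ (List.mem_map_of_mem (a := ⟨b, Finset.mem_erase.2 ⟨hba, hb⟩⟩) (by simp)) ?_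
        refine fun z hz => Finset.mem_erase.2 ⟨?_, hsub hz⟩
        rintro rfl
        exact hbu hz
      obtain ⟨y, hys, hyu⟩ := Finset.exists_of_ssubset (show u.1 ⊂ s.1 from hus)
      have hya : y = a := by
        by_contra hya
        exact hyu (h1 y hys hya)
      subst hya
      refine hut (Subtype.ext ?_)
      rw [hta]
      ext z
      rw [Finset.mem_erase]
      exact ⟨fun hz => ⟨fun e => hyu (e ▸ hz), hsub hz⟩, fun hz => h1 z hz.2 hz.1⟩

variable (𝓗) in
/-- The map `G n (s, ∂s) → G (n + p) s` for a `p`-simplex `s`, determined by an ordering of its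
vertices. -/
def ordMap : ∀ (p : ℕ) {n m : ℤ}, n + p = m → ∀ (v : Fin (p + 1) → V) (s : K.Face),
    IsOrdering v s → 𝓗.cell n s →+ 𝓗.abs m (LowerSet.Iic s)
  | 0, n, m, hnm, _, s, hs =>
    -- For a vertex the two degrees agree only propositionally, whence the cast.
    (show n = m by rwa [Nat.cast_zero, add_zero] at hnm) ▸ 𝓗.vertexMap n hs.Iio_le_bot
  | p + 1, n, m, hnm, v, s, hs =>
    have hc := covBy_of_eq_erase (t := s.erase (v 0) (hs.erase_nonempty 0)) (hs.mem 0) rfl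
    ((𝓗.absMap m (Iic_le_Iic hc.le)).comp
      (ordMap p (n := n + 1) (by push_cast at hnm; omega) (Fin.tail v)
        (s.erase (v 0) (hs.erase_nonempty 0)) (hs.tail rfl))).comp
      (𝓗.inc rfl hc)

/-- The recursion with the facet and the intermediate degree as free variables, so that it applies
to any description of them. -/
lemma ordMap_succ {p : ℕ} {n m k : ℤ} (hnm : n + (p + 1 : ℕ) = m) (hk : n + 1 = k)
    (hkm : k + p = m) {v : Fin (p + 2) → V} {s t : K.Face} (hs : IsOrdering v s)
    (ht : IsOrdering (Fin.tail v) t) (hts : t ⋖ s) (x : 𝓗.cell n s) :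
    𝓗.ordMap (p + 1) hnm v s hs x =
      𝓗.absMap m (Iic_le_Iic hts.le) (𝓗.ordMap p hkm (Fin.tail v) t ht (𝓗.inc hk hts x)) := by
  subst hk
  obtain rfl : s.erase (v 0) (hs.erase_nonempty 0) = t := (hs.tail rfl).eq ht
  rfl

lemma Acyclic.ordMap_bijective (hac : 𝓗.Acyclic) {p : ℕ} {n m : ℤ} (hnm : n + p = m)
    {v : Fin (p + 1) → V} {s : K.Face} (hs : IsOrdering v s) :
    Function.Bijective (𝓗.ordMap p hnm v s hs) := by
  induction p generalizing n s with
  | zero =>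
    obtain rfl : n = m := by simpa using hnm
    exact vertexMap_bijective n hs.Iio_le_bot
  | succ p ih =>
    rw [ordMap]
    have hc := covBy_of_eq_erase (t := s.erase (v 0) (hs.erase_nonempty 0)) (hs.mem 0) rfl
    exact ((hac _ _ hc.le m).comp (ih (by push_cast at hnm; omega) (hs.tail rfl))).comp
      (hac.inc_bijective rfl (hs.mem 0) rfl hc)

/-- A transposition that fixes the first vertex descends to the opposite facet. Exchanging the first
two vertices compares the two routes to the same face of codimension two, which cancel by
`inc_inc_add`; for an edge the two end points cancel by `edge_relation`. -/
lemma ordMap_swap {p : ℕ} {n m : ℤ} (hnm : n + p = m) (i : Fin p) {v : Fin (p + 1) → V} {s : K.Face}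
    (hs : IsOrdering v s) (x : 𝓗.cell n s) :
    𝓗.ordMap p hnm (v ∘ Equiv.swap i.castSucc i.succ) s (hs.comp_perm _) x =
      -𝓗.ordMap p hnm v s hs x := by
  induction p generalizing n s with
  | zero => exact i.elim0
  | succ p ih =>
    have hkm : n + 1 + p = m := by push_cast at hnm; omega
    induction i using Fin.cases with
    | succ j =>
      let t := s.erase (v 0) (hs.erase_nonempty 0)
      have ht : IsOrdering (Fin.tail v) t := hs.tail rfl
      have hc : t ⋖ s := covBy_of_eq_erase (hs.mem 0) rfl
      have ht' := ht.comp_perm (Equiv.swap j.castSucc j.succ)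
      rw [ordMap_succ hnm rfl hkm hs ht hc, ← map_neg, ← ih hkm j ht]
      -- The proof that a list is an ordering depends on the list, so equal orderings are exchanged
      -- through a generalised statement.
      have gen : ∀ (w : Fin (p + 1) → V) (hw : Fin.tail v ∘ Equiv.swap j.castSucc j.succ = w)
          (hw' : IsOrdering w t), 𝓗.ordMap p hkm w t hw' (𝓗.inc rfl hc x) =
            𝓗.ordMap p hkm (Fin.tail v ∘ Equiv.swap j.castSucc j.succ) t ht' (𝓗.inc rfl hc x) := by
        rintro _ rfl _; rfl
      have e := (Fin.tail_comp_swap_succ v j).symm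
      rw [← gen _ e (e ▸ ht')]
      exact ordMap_succ hnm rfl hkm _ _ _ x
    | zero =>
      obtain ⟨w, hw⟩ : ∃ w, w = v ∘ Equiv.swap (Fin.castSucc (0 : Fin (p + 1))) (Fin.succ 0) :=
        ⟨_, rfl⟩
      have hw0 : w 0 = v 1 := by rw [hw]; simp
      have hw1 : w 1 = v 0 := by rw [hw]; simp
      have hws : IsOrdering w s := hw ▸ hs.comp_perm _
      have gen : ∀ (w' : Fin (p + 2) → V) (hw' : IsOrdering w' s), w = w' →
          𝓗.ordMap (p + 1) hnm w' s hw' x = 𝓗.ordMap (p + 1) hnm w s hws x := by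
        rintro _ _ rfl; rfl
      rw [gen _ (hs.comp_perm _) hw, eq_neg_iff_add_eq_zero]
      let t := s.erase (v 0) (hs.erase_nonempty 0)
      have ht : IsOrdering (Fin.tail v) t := hs.tail rfl
      have hc : t ⋖ s := covBy_of_eq_erase (hs.mem 0) rfl
      let t' := s.erase (w 0) (hws.erase_nonempty 0)
      have ht' : IsOrdering (Fin.tail w) t' := hws.tail rfl
      have hc' : t' ⋖ s := covBy_of_eq_erase (hws.mem 0) rfl
      have hne : v 0 ≠ v 1 := fun e => Fin.zero_ne_one (hs.injective e)
      have htt : t' ≠ t := by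
        intro e
        have : v 0 ∈ t'.1 := Finset.mem_erase.2 ⟨by rwa [hw0], hs.mem 0⟩
        rw [e] at this
        exact Finset.notMem_erase _ _ this
      rw [ordMap_succ hnm rfl hkm hs ht hc, ordMap_succ hnm rfl hkm hws ht' hc']
      cases p with
      | zero =>
        obtain rfl : n + 1 = m := by simpa using hkm
        refine edge_relation rfl ht'.Iio_le_bot ht.Iio_le_bot hc' hc htt (fun u hu => ?_) x
        have hcard := hs.card_eq
        have hu1 : u.1 ⊂ s.1 := hu
        obtain ⟨b, hbs, hbu⟩ := Finset.exists_of_ssubset hu1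
        have hsub : u.1 ⊆ s.1.erase b := fun z hz =>
          Finset.mem_erase.2 ⟨fun e => hbu (e ▸ hz), hu1.1 hz⟩
        have hub : u.1 = s.1.erase b := by
          refine Finset.eq_of_subset_of_card_le hsub ?_
          rw [Finset.card_erase_of_mem hbs, hcard]
          exact u.nonempty.card_pos
        obtain ⟨i, rfl⟩ := hs.exists_eq hbs
        fin_cases i
        · exact Or.inr (Subtype.ext hub)
        · refine Or.inl (Subtype.ext (hub.trans ?_))
          exact congrArg s.1.erase hw0.symm
      | succ p =>
        have hkm' : n + 1 + 1 + p = m := by push_cast at hkm; omega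
        let r := t.erase (Fin.tail v 0) (ht.erase_nonempty 0)
        have hr : IsOrdering (Fin.tail (Fin.tail v)) r := ht.tail rfl
        have hrt : r ⋖ t := covBy_of_eq_erase (ht.mem 0) rfl
        have hr1 : r.1 = (s.1.erase (v 0)).erase (v 1) := rfl
        have hr2 : r.1 = t'.1.erase (w 1) := by
          rw [hr1, Finset.erase_right_comm, hw1, ← hw0]; rfl
        have hrt' : r ⋖ t' := covBy_of_eq_erase (ht'.mem 0) hr2
        -- The transposition moves only the first two entries, so both orderings induce the same one
        -- on `r`.
        have htl : Fin.tail (Fin.tail w) = Fin.tail (Fin.tail v) := by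
          funext k
          rw [hw]
          simp only [Fin.tail, Function.comp_apply]
          rw [Equiv.swap_apply_of_ne_of_ne]
          · exact Fin.succ_ne_zero _
          · exact fun e => Fin.succ_ne_zero _ (Fin.succ_injective _ e)
        have hr' : IsOrdering (Fin.tail (Fin.tail w)) r := htl ▸ hr
        have gen' : ∀ (w' : Fin (p + 1) → V) (hw' : IsOrdering w' r) (y : 𝓗.cell (n + 1 + 1) r),
            Fin.tail (Fin.tail v) = w' →
            𝓗.ordMap p hkm' w' r hw' y = 𝓗.ordMap p hkm' (Fin.tail (Fin.tail v)) r hr y := by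
          rintro _ _ _ rfl; rfl
        rw [ordMap_succ hkm rfl hkm' ht hr hrt, ordMap_succ hkm rfl hkm' ht' hr' hrt',
          gen' _ hr' _ htl.symm, absMap_absMap, absMap_absMap, ← map_add, ← map_add,
          inc_inc_add rfl rfl hrt' hrt hc' hc htt, map_zero, map_zero]
        intro u h1 h2
        rcases eq_or_eq_of_lt_of_lt hr1 h1 h2 with h | h
        · exact Or.inr (Subtype.ext h)
        · refine Or.inl (Subtype.ext (h.trans ?_))
          exact congrArg s.1.erase hw0.symm

/-- The maps `ordMap` are alternating in the ordering. -/
theorem ordMap_perm {p : ℕ} {n m : ℤ} (hnm : n + p = m) (π : Equiv.Perm (Fin (p + 1)))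
    {v : Fin (p + 1) → V} {s : K.Face} (hs : IsOrdering v s) (x : 𝓗.cell n s) :
    𝓗.ordMap p hnm (v ∘ π) s (hs.comp_perm π) x =
      (Equiv.Perm.sign π : ℤ) • 𝓗.ordMap p hnm v s hs x := by
  -- Adjacent transpositions generate the symmetric group, so `ordMap_swap` suffices.
  have hπ : π ∈ Submonoid.closure (Set.range fun i : Fin p => Equiv.swap i.castSucc i.succ) := by
    rw [Equiv.Perm.mclosure_swap_castSucc_succ]; trivial
  induction hπ using Submonoid.closure_induction generalizing v with
  | mem π h =>
    obtain ⟨i, rfl⟩ := h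
    refine (ordMap_swap hnm i hs x).trans ?_
    rw [Equiv.Perm.sign_swap (Fin.castSucc_lt_succ (i := i)).ne]
    simp
  | one => simp [Equiv.Perm.coe_one]
  | mul π π' _ _ h h' =>
    refine (h' (hs.comp_perm π)).trans ?_
    rw [h hs, Equiv.Perm.sign_mul, smul_smul, Units.val_mul, mul_comm]

/-- Listing the `l`-th vertex first costs the sign `(-1)^l` of a cycle. Dropping that vertex is then
the recursive step of `ordMap`, and comparing orderings of the facet costs `sign φ`. -/
theorem ordMap_face {p : ℕ} {n k m : ℤ} (hnm : n + (p + 1 : ℕ) = m) (hk : n + 1 = k)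
    (hkm : k + p = m) {v : Fin (p + 2) → V} {w : Fin (p + 1) → V} {s t : K.Face}
    (hs : IsOrdering v s) (ht : IsOrdering w t) (hts : t ⋖ s) (l : Fin (p + 2))
    (φ : Equiv.Perm (Fin (p + 1))) (hw : ∀ i, w i = v (l.succAbove (φ i))) (x : 𝓗.cell n s) :
    𝓗.absMap m (Iic_le_Iic hts.le) (𝓗.ordMap p hkm w t ht (𝓗.inc hk hts x)) =
      ((-1) ^ (l : ℕ) * (Equiv.Perm.sign φ : ℤ)) • 𝓗.ordMap (p + 1) hnm v s hs x := by
  -- Composition with `l.cycleRange.symm` brings entry `l` to the front and keeps the order of the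
  -- others.
  have hu := hs.comp_perm l.cycleRange.symm
  have htl : Fin.tail (v ∘ l.cycleRange.symm) = v ∘ l.succAbove := by
    funext i
    simp [Fin.tail]
  have hw' : w = Fin.tail (v ∘ l.cycleRange.symm) ∘ φ := by
    rw [htl]; exact funext hw
  have ht' : IsOrdering (Fin.tail (v ∘ l.cycleRange.symm)) t := by
    have := ht.comp_perm φ.symm
    rwa [hw', Function.comp_assoc, Equiv.self_comp_symm, Function.comp_id] at this
  subst hw'
  rw [ordMap_perm hkm φ ht', map_zsmul, ← ordMap_succ hnm hk hkm hu ht' hts, ordMap_perm hnm _ hs,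
    smul_smul, Equiv.Perm.sign_symm, Fin.sign_cycleRange, mul_comm]
  simp

end RelHomology

/-! ### Incidence numbers -/

namespace AbstractSimplicialComplex

variable {V : Type v} {K : AbstractSimplicialComplex V}

lemma IsOrdering.exists_perm {p : ℕ} {s : K.Face} {v w : Fin (p + 1) → V} (hv : IsOrdering v s)
    (hw : IsOrdering w s) : ∃ φ : Equiv.Perm (Fin (p + 1)), ∀ i, w i = v (φ i) := by
  choose f hf using fun i => hv.exists_eq (hw.mem i)
  have hinj : Function.Injective f := fun i j h => hw.injective (by rw [← hf, ← hf, h])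
  exact ⟨Equiv.ofBijective f (Finite.injective_iff_bijective.1 hinj), fun i => (hf i).symm⟩

/-- A simplex, as a face. -/
def Simplex.face {p : ℕ} (σ : K.Simplex p) : K.Face := ⟨σ.1, σ.2.1⟩

/-- A map from `p + 1` indices onto the `p + 1` vertices of a simplex is automatically injective. -/
lemma Orientation.isOrdering (o : K.Orientation) {p : ℕ} (σ : K.Simplex p) :
    IsOrdering (o.vert σ) σ.face where
  injective := by
    classical
    have h : Finset.univ.image (o.vert σ) = σ.1 := by
      refine Finset.coe_injective ?_
      rw [Finset.coe_image, Finset.coe_univ, Set.image_univ, o.range_vert]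
    have h2 : (Finset.univ.image (o.vert σ)).card = (Finset.univ : Finset (Fin (p + 1))).card := by
      rw [h, σ.2.2, Finset.card_univ, Fintype.card_fin]
    exact Set.injOn_univ.1 (by simpa using Finset.card_image_iff.1 h2)
  range_eq := o.range_vert σ

lemma Simplex.exists_eq_erase [DecidableEq V] (o : K.Orientation) {p : ℕ} {σ : K.Simplex (p + 1)}
    {τ : K.Simplex p} (h : τ.1 ⊆ σ.1) : ∃ l, τ.1 = σ.1.erase (o.vert σ l) := by
  obtain ⟨a, ha, haτ⟩ := Finset.exists_of_ssubset (h.ssubset_of_ne fun e => by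
    have := congrArg Finset.card e
    rw [τ.2.2, σ.2.2] at this
    omega)
  obtain ⟨l, rfl⟩ := (o.isOrdering σ).exists_eq ha
  refine ⟨l, Finset.eq_of_subset_of_card_le ?_ ?_⟩
  · exact fun z hz => Finset.mem_erase.2 ⟨fun e => haτ (e ▸ hz), h hz⟩
  · rw [Finset.card_erase_of_mem ha, τ.2.2, σ.2.2]
    omega

lemma Simplex.face_covBy {p : ℕ} (o : K.Orientation) {σ : K.Simplex (p + 1)} {τ : K.Simplex p}
    (h : τ.1 ⊆ σ.1) : τ.face ⋖ σ.face := by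
  classical
  obtain ⟨l, hl⟩ := Simplex.exists_eq_erase o h
  exact covBy_of_eq_erase ((o.isOrdering σ).mem l) hl

/-- The omitted vertex and the comparing permutation are both determined by `τ`, so the double sum
has a single nonzero term. -/
lemma Orientation.exists_incidence_eq (o : K.Orientation) {p : ℕ} {σ : K.Simplex (p + 1)}
    {τ : K.Simplex p} (h : τ.1 ⊆ σ.1) : ∃ (l : Fin (p + 2)) (φ : Equiv.Perm (Fin (p + 1))),
      (∀ i, o.vert τ i = o.vert σ (l.succAbove (φ i))) ∧
        o.incidence σ τ = (-1) ^ (l : ℕ) * (Equiv.Perm.sign φ : ℤ) := by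
  classical
  have hσ := o.isOrdering σ
  have hτ := o.isOrdering τ
  obtain ⟨l, hl⟩ := Simplex.exists_eq_erase o h
  obtain ⟨φ, hφ⟩ := (hσ.comp_succAbove l (t := τ.face) hl).exists_perm hτ
  have hφ' : ∀ i, o.vert τ i = o.vert σ (l.succAbove (φ i)) := hφ
  refine ⟨l, φ, hφ', ?_⟩
  rw [Orientation.incidence, Finset.sum_eq_single l, Finset.sum_eq_single φ, if_pos hφ']
  · intro ψ _ hψ
    refine if_neg fun hc => hψ (Equiv.ext fun i => ?_)
    exact Fin.succAbove_right_injective (hσ.injective ((hc i).symm.trans (hφ' i)))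
  · exact fun k => absurd (Finset.mem_univ _) k
  · intro l' _ hll
    refine Finset.sum_eq_zero fun ψ _ => if_neg fun hc => ?_
    obtain ⟨j, hj⟩ := Fin.exists_succAbove_eq hll.symm
    have h1 : o.vert σ l ∈ τ.1 := by
      have := hτ.mem (ψ.symm j)
      rwa [hc, Equiv.apply_symm_apply, hj] at this
    rw [hl] at h1
    exact Finset.notMem_erase _ _ h1
  · exact fun k => absurd (Finset.mem_univ _) k

end AbstractSimplicialComplex

/-! ### Functions vanishing at infinity -/

namespace ZeroAtInftyContinuousMap

variable {X : Type v} [TopologicalSpace X]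

lemma norm_le_of_forall_le (f : ZeroAtInftyContinuousMap X ℂ) {c : ℝ} (hc : 0 ≤ c)
    (h : ∀ x, ‖f x‖ ≤ c) : ‖f‖ ≤ c := by
  rw [← norm_toBCF_eq_norm]
  exact (BoundedContinuousFunction.norm_le hc).2 h

lemma sum_apply {κ : Type*} (s : Finset κ) (f : κ → ZeroAtInftyContinuousMap X ℂ) (x : X) :
    (∑ i ∈ s, f i) x = ∑ i ∈ s, f i x := by
  classical
  induction s using Finset.induction_on with
  | empty => rfl
  | insert i s hi ih => rw [Finset.sum_insert hi, Finset.sum_insert hi, add_apply, ih]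

lemma exists_eq_mul (f : ZeroAtInftyContinuousMap X ℂ) {g : X → ℝ} (hg : Continuous g)
    (hg1 : ∀ x, |g x| ≤ 1) : ∃ h : ZeroAtInftyContinuousMap X ℂ, ∀ x, h x = f x * (g x : ℂ) := by
  refine ⟨⟨⟨fun x => f x * (g x : ℂ), by fun_prop⟩, ?_⟩, fun x => rfl⟩
  refine squeeze_zero_norm' (a := fun x => ‖f x‖) (Filter.Eventually.of_forall fun x => ?_) ?_
  · change ‖f x * (g x : ℂ)‖ ≤ _
    rw [norm_mul, Complex.norm_real, Real.norm_eq_abs]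
    exact mul_le_of_le_one_right (norm_nonneg _) (hg1 x)
  · have := f.zero_at_infty'.norm
    rwa [norm_zero] at this

/-- Multiplication by `ε / max ε |f|` truncates the absolute value at `ε`. -/
lemma exists_clip (f : ZeroAtInftyContinuousMap X ℂ) {ε : ℝ} (hε : 0 < ε) :
    ∃ g : ZeroAtInftyContinuousMap X ℂ, ‖g‖ ≤ ε ∧ ∀ x, ‖f x‖ ≤ ε → g x = f x := by
  have hpos : ∀ x, 0 < max ε ‖f x‖ := fun x => lt_max_of_lt_left hε
  obtain ⟨g, hg⟩ := f.exists_eq_mul (g := fun x => ε / max ε ‖f x‖)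
    (continuous_const.div (continuous_const.max (map_continuous f).norm) fun x => (hpos x).ne')
    fun x => by
      rw [abs_of_nonneg (div_nonneg hε.le (hpos x).le)]
      exact div_le_one_of_le₀ (le_max_left _ _) (hpos x).le
  refine ⟨g, norm_le_of_forall_le g hε.le fun x => ?_, fun x hx => ?_⟩
  · rw [hg, norm_mul, Complex.norm_real, Real.norm_eq_abs,
      abs_of_nonneg (div_nonneg hε.le (hpos x).le), mul_div_assoc', div_le_iff₀ (hpos x), mul_comm]
    gcongr
    exact le_max_right _ _
  · rw [hg, max_eq_left hx, div_self hε.ne', Complex.ofReal_one, mul_one]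

lemma isCompact_le_norm (f : ZeroAtInftyContinuousMap X ℂ) {ε : ℝ} (hε : 0 < ε) :
    IsCompact {x | ε ≤ ‖f x‖} := by
  have h := Metric.tendsto_nhds.1 f.zero_at_infty' ε hε
  obtain ⟨S, hS, hS'⟩ := Filter.mem_cocompact.1 h
  refine hS.of_isClosed_subset (isClosed_le continuous_const (map_continuous f).norm) fun x hx => ?_
  by_contra hc
  have : dist (f x) 0 < ε := hS' hc
  rw [dist_zero_right] at this
  exact absurd this (not_lt.2 hx)

end ZeroAtInftyContinuousMap

namespace NonUnitalStarAlgHom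

variable {A B : Type u} [NonUnitalCStarAlgebra A] [NonUnitalCStarAlgebra B]

/-- Injective `*`-homomorphisms of C*-algebras are isometric, hence have closed range, so
approximate surjectivity is enough. -/
lemma bijective_of_injective_of_dense (φ : A →⋆ₙₐ[ℂ] B) (hi : Function.Injective φ)
    (hd : ∀ b, ∀ ε > 0, ∃ a, ‖φ a - b‖ ≤ ε) : Function.Bijective φ := by
  refine ⟨hi, fun b => ?_⟩
  have hiso : Isometry φ := AddMonoidHomClass.isometry_of_norm φ (norm_map φ hi)
  have hc := hiso.isClosedEmbedding.isClosed_range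
  have : b ∈ closure (Set.range φ) := Metric.mem_closure_iff.2 fun ε hε => by
    obtain ⟨a, ha⟩ := hd b (ε / 2) (half_pos hε)
    refine ⟨φ a, ⟨a, rfl⟩, ?_⟩
    rw [dist_comm, dist_eq_norm]
    linarith
  rwa [hc.closure_eq] at this

end NonUnitalStarAlgHom

/-! ### Ideals of `C₀(X)`-algebras -/

namespace C0Algebra

variable {X : Type v} [TopologicalSpace X] {A : Type u} [NonUnitalCStarAlgebra A]
  (𝒜 : C0Algebra X A)

/-- The action of functions. -/
def act (f : ZeroAtInftyContinuousMap X ℂ) : A →L[ℂ] A := (𝒜.Φ f).fst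

variable {𝒜}

lemma norm_act_le (f : ZeroAtInftyContinuousMap X ℂ) (a : A) : ‖𝒜.act f a‖ ≤ ‖f‖ * ‖a‖ := by
  refine ((𝒜.act f).le_opNorm a).trans ?_
  gcongr
  rw [act, DoubleCentralizer.norm_fst]
  exact NonUnitalStarAlgHom.norm_apply_le 𝒜.Φ f

lemma act_fun_mul (f g : ZeroAtInftyContinuousMap X ℂ) (a : A) :
    𝒜.act (f * g) a = 𝒜.act f (𝒜.act g a) := by
  rw [act, map_mul, DoubleCentralizer.mul_fst]; rfl

lemma act_fun_add (f g : ZeroAtInftyContinuousMap X ℂ) (a : A) :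
    𝒜.act (f + g) a = 𝒜.act f a + 𝒜.act g a := by
  rw [act, map_add, DoubleCentralizer.add_fst]; rfl

lemma act_fun_smul (c : ℂ) (f : ZeroAtInftyContinuousMap X ℂ) (a : A) :
    𝒜.act (c • f) a = c • 𝒜.act f a := by
  rw [act, map_smul, DoubleCentralizer.smul_fst]; rfl

lemma act_fun_zero (a : A) : 𝒜.act 0 a = 0 := by
  rw [act, map_zero, DoubleCentralizer.zero_fst]; rfl

lemma act_fun_sub (f g : ZeroAtInftyContinuousMap X ℂ) (a : A) :
    𝒜.act (f - g) a = 𝒜.act f a - 𝒜.act g a := by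
  rw [eq_sub_iff_add_eq, ← act_fun_add, sub_add_cancel]

lemma act_fun_sum {κ : Type*} (s : Finset κ) (f : κ → ZeroAtInftyContinuousMap X ℂ) (a : A) :
    𝒜.act (∑ i ∈ s, f i) a = ∑ i ∈ s, 𝒜.act (f i) a := by
  classical
  induction s using Finset.induction_on with
  | empty => rw [Finset.sum_empty, Finset.sum_empty, act_fun_zero]
  | insert i s hi ih => rw [Finset.sum_insert hi, Finset.sum_insert hi, act_fun_add, ih]

lemma act_mem_vanishing {Y : Set X} {f : ZeroAtInftyContinuousMap X ℂ} (hf : ∀ y ∈ Y, f y = 0)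
    (a : A) : 𝒜.act f a ∈ 𝒜.vanishing Y :=
  subset_closure (Submodule.subset_span ⟨f, a, hf, rfl⟩)

/-- The ideal is the closed span of the products `f · a`. Scalars can be absorbed into `f`, so `p`
need only be closed and additive. -/
lemma vanishing_induction {Y : Set X} {p : A → Prop} (hc : IsClosed {a | p a})
    (hact : ∀ f a, (∀ y ∈ Y, f y = 0) → p (𝒜.act f a)) (h0 : p 0)
    (hadd : ∀ a b, p a → p b → p (a + b)) {a : A} (ha : a ∈ 𝒜.vanishing Y) : p a := by
  refine hc.closure_subset_iff.2 (fun b hb => ?_) ha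
  refine Submodule.closure_induction (p := fun x _ => p x) h0 (fun a b _ _ => hadd a b) ?_ hb
  rintro c _ ⟨f, b, hf, rfl⟩
  have := hact (c • f) b fun y hy => by
    rw [ZeroAtInftyContinuousMap.smul_apply, hf y hy, smul_zero]
  rwa [act_fun_smul] at this

lemma mem_vanishing_empty (a : A) : a ∈ 𝒜.vanishing ∅ := by
  have h := 𝒜.nondegenerate.closure_eq
  have : a ∈ closure (Submodule.span ℂ {b : A | ∃ f a, b = (𝒜.Φ f).fst a} : Set A) := by
    rw [h]; trivial
  refine closure_mono (Submodule.span_mono ?_) this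
  rintro _ ⟨f, b, rfl⟩
  exact ⟨f, b, fun y hy => hy.elim, rfl⟩

lemma eq_zero_of_mem_vanishing_univ {a : A} (ha : a ∈ 𝒜.vanishing Set.univ) : a = 0 := by
  refine vanishing_induction (p := fun a => a = 0) isClosed_singleton (fun f a hf => ?_) rfl ?_ ha
  · obtain rfl : f = 0 := by ext x; exact hf x trivial
    exact act_fun_zero a
  · rintro _ _ rfl rfl; exact add_zero 0

/-- Up to `ε`, only the values of a function on `Y` matter modulo `I_Y`. -/
lemma exists_act_sub_mem {Y : Set X} {f : ZeroAtInftyContinuousMap X ℂ} {ε : ℝ} (hε : 0 < ε)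
    (hf : ∀ y ∈ Y, ‖f y‖ ≤ ε) (a : A) : ∃ b ∈ 𝒜.vanishing Y, ‖𝒜.act f a - b‖ ≤ ε * ‖a‖ := by
  obtain ⟨g, hg, hgf⟩ := f.exists_clip hε
  refine ⟨𝒜.act (f - g) a, act_mem_vanishing (fun y hy => ?_) a, ?_⟩
  · rw [ZeroAtInftyContinuousMap.sub_apply, hgf y (hf y hy), sub_self]
  · rw [act_fun_sub, sub_sub_cancel]
    exact (norm_act_le g a).trans (by gcongr)

lemma mul_mem_vanishing_union {Y Z : Set X} {a b : A} (ha : a ∈ 𝒜.vanishing Y)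
    (hb : b ∈ 𝒜.vanishing Z) : a * b ∈ 𝒜.vanishing (Y ∪ Z) := by
  refine vanishing_induction (p := fun a => a * b ∈ 𝒜.vanishing (Y ∪ Z))
    ((𝒜.vanishing _).closed.preimage (continuous_mul_const b)) (fun f a hf => ?_)
    (by rw [zero_mul]; exact zero_mem _) (fun _ _ h h' => by rw [add_mul]; exact add_mem h h') ha
  refine vanishing_induction (p := fun b => 𝒜.act f a * b ∈ 𝒜.vanishing (Y ∪ Z))
    ((𝒜.vanishing _).closed.preimage (continuous_const_mul _)) (fun g c hg => ?_)
    (by rw [mul_zero]; exact zero_mem _) (fun _ _ h h' => by rw [mul_add]; exact add_mem h h') hb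
  have e : 𝒜.act f a * 𝒜.act g c = 𝒜.act (f * g) (a * c) := by
    rw [act_fun_mul]
    exact (𝒜.act_mul f a _).trans (congrArg (𝒜.act f) (𝒜.mul_act g a c))
  rw [e]
  refine act_mem_vanishing ?_ _
  rintro y (hy | hy)
  · rw [ZeroAtInftyContinuousMap.mul_apply, hf y hy, zero_mul]
  · rw [ZeroAtInftyContinuousMap.mul_apply, hg y hy, mul_zero]

/-- An element of two closed ideals is a limit of products `a * u` with `u` from an approximate unit
of the second ideal, and such products vanish on the union. No topological condition on `Y` and `Z`
is needed. -/
lemma mem_vanishing_union {Y Z : Set X} {a : A} (ha : a ∈ 𝒜.vanishing Y)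
    (hb : a ∈ 𝒜.vanishing Z) : a ∈ 𝒜.vanishing (Y ∪ Z) := by
  refine (𝒜.vanishing (Y ∪ Z)).closed.closure_subset (Metric.mem_closure_iff.2 fun ε hε => ?_)
  obtain ⟨u, hu, -, -, h⟩ := (𝒜.vanishing Z).exists_cutoff hb hε
  exact ⟨a * u, mul_mem_vanishing_union ha hu, by rwa [dist_eq_norm]⟩

/-- Partition of unity for the ideal of an open set covered by the sets `U i`. -/
theorem mem_closure_iSup_vanishing [T2Space X] [LocallyCompactSpace X] {Y Z : Set X}
    (hY : IsClosed Y) {κ : Type*} (U : κ → Set X) (hU : ∀ i, IsOpen (U i))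
    (hc : Y \ Z ⊆ ⋃ i, U i) (S : AddSubgroup A) (hSY : ∀ a ∈ 𝒜.vanishing Y, a ∈ S)
    (hS : ∀ i, ∀ a ∈ 𝒜.vanishing (Y \ U i), a ∈ S) {a : A} (ha : a ∈ 𝒜.vanishing Z) :
    a ∈ closure (S : Set A) := by
  refine vanishing_induction (p := fun a => a ∈ closure (S : Set A)) isClosed_closure
    (fun f a hf => ?_) (subset_closure S.zero_mem) (fun a b h h' => S.topologicalClosure.add_mem h h')
    ha
  refine Metric.mem_closure_iff.2 fun ε hε => ?_
  have ha1 : 0 < ‖a‖ + 1 := by positivity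
  -- The final error is at most `η ‖a‖ < ε`; the summand `1` covers the case `a = 0`.
  let η := ε / (‖a‖ + 1)
  have hη : 0 < η := div_pos hε ha1
  -- Since `f` vanishes on `Z`, this compact set avoids `Z` and is covered by the `U i`.
  have hKc : IsCompact ({x | η ≤ ‖f x‖} ∩ Y) := (f.isCompact_le_norm hη).inter_right hY
  have hKU : {x | η ≤ ‖f x‖} ∩ Y ⊆ ⋃ i, U i := by
    rintro x ⟨hx, hxY⟩
    refine hc ⟨hxY, fun hxZ => ?_⟩
    have hx' : η ≤ ‖f x‖ := hx
    rw [hf x hxZ, norm_zero] at hx'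
    exact absurd hx' (not_le.2 hη)
  -- The functions `φ j` are guaranteed to sum to `1` only on `L`, so a cut-off `χ` equal to `1` on
  -- the compact set and zero outside the interior of `L` is needed as well.
  obtain ⟨L, hLc, hKL, hLU⟩ := exists_compact_between hKc (isOpen_iUnion hU) hKU
  obtain ⟨χ, hχ1, hχ0, -, hχ⟩ := exists_continuous_one_zero_of_isCompact hKc
    (isOpen_interior (s := L)).isClosed_compl (Set.disjoint_compl_right_iff_subset.2 hKL)
  obtain ⟨t, ht⟩ := hLc.elim_finite_subcover U hU hLU
  have ht' : L ⊆ ⋃ j : Fin t.card, U (t.equivFin.symm j) := by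
    intro x hx
    obtain ⟨i, hi, hxi⟩ := Set.mem_iUnion₂.1 (ht hx)
    exact Set.mem_iUnion.2 ⟨t.equivFin ⟨i, hi⟩, by simpa using hxi⟩
  obtain ⟨φ, hφU, hφ1, hφ, -⟩ := exists_continuous_sum_one_of_isOpen_isCompact
    (fun j : Fin t.card => hU (t.equivFin.symm j)) hLc ht'
  have hχφ : ∀ j x, |χ x * φ j x| ≤ 1 := fun j x => by
    rw [abs_of_nonneg (mul_nonneg (hχ x).1 (hφ j x).1)]
    exact mul_le_one₀ (hχ x).2 (hφ j x).1 (hφ j x).2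
  -- The pieces `f χ φ j` act with values in the ideals of `Y ∖ U i`. The remainder `f (1 - χ)` is
  -- bounded by `η` on `Y`, so it acts with values close to the ideal of `Y`.
  choose g hg using fun j => f.exists_eq_mul (g := fun x => χ x * φ j x) (by fun_prop) (hχφ j)
  obtain ⟨k, hk⟩ := f.exists_eq_mul (g := fun x => 1 - χ x) (by fun_prop) fun x => by
    rw [abs_of_nonneg (sub_nonneg.2 (hχ x).2)]
    linarith [(hχ x).1]
  have hsum : f = ∑ j, g j + k := by
    ext x
    rw [ZeroAtInftyContinuousMap.add_apply, hk, ZeroAtInftyContinuousMap.sum_apply,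
      Finset.sum_congr rfl fun j _ => hg j x, ← Finset.mul_sum, ← mul_add]
    have : ∑ j, χ x * φ j x + (1 - χ x) = 1 := by
      rw [← Finset.mul_sum]
      by_cases hx : x ∈ L
      · have := hφ1 hx
        simp only [Finset.sum_apply, Pi.one_apply] at this
        rw [this]; ring
      · have : χ x = 0 := hχ0 fun h => hx (interior_subset h)
        rw [this]; ring
    have h2 := congrArg (fun r : ℝ => (r : ℂ)) this
    push_cast at h2 ⊢
    rw [h2, mul_one]
  have hkY : ∀ y ∈ Y, ‖k y‖ ≤ η := fun y hy => by
    rw [hk, norm_mul, Complex.norm_real, Real.norm_eq_abs, abs_of_nonneg (sub_nonneg.2 (hχ y).2)]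
    by_cases h : η ≤ ‖f y‖
    · have : χ y = 1 := hχ1 ⟨h, hy⟩
      rw [this, sub_self, mul_zero]; exact hη.le
    · exact (mul_le_of_le_one_right (norm_nonneg _) (by linarith [(hχ y).1])).trans (not_le.1 h).le
  obtain ⟨b, hbY, hb⟩ := exists_act_sub_mem (𝒜 := 𝒜) hη hkY a
  refine ⟨∑ j, 𝒜.act (g j) a + b, ?_, ?_⟩
  · refine S.add_mem (S.sum_mem fun j _ => hS (t.equivFin.symm j) _ (act_mem_vanishing ?_ a))
      (hSY b hbY)
    intro y hy
    have : φ j y = 0 := by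
      by_contra h
      exact hy.2 (hφU j (subset_tsupport _ h))
    rw [hg, this, mul_zero, Complex.ofReal_zero, mul_zero]
  · rw [dist_eq_norm, hsum, act_fun_add, act_fun_sum, add_sub_add_left_eq_sub]
    refine hb.trans_lt ?_
    rw [div_mul_eq_mul_div, div_lt_iff₀ ha1]
    nlinarith

/-- The complements of `Y` and `Z` cover `(Y ∪ Z) ∖ (Y ∩ Z)`. Removing one of them from `Y ∪ Z`
leaves `Y`, respectively `Z`, so the partition of unity splits an element into parts vanishing on
`Y` and on `Z`, up to a small error. -/
lemma mem_closure_vanishing_add [T2Space X] [LocallyCompactSpace X] {Y Z : Set X}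
    (hY : IsClosed Y) (hZ : IsClosed Z) {a : A} (ha : a ∈ 𝒜.vanishing (Y ∩ Z)) {ε : ℝ}
    (hε : 0 < ε) : ∃ b ∈ 𝒜.vanishing Y, ∃ c ∈ 𝒜.vanishing Z, ‖a - (b + c)‖ < ε := by
  let S : AddSubgroup A := (𝒜.vanishing Y).toSubmodule.toAddSubgroup ⊔
    (𝒜.vanishing Z).toSubmodule.toAddSubgroup
  have hl : ∀ a ∈ 𝒜.vanishing Y, a ∈ S := fun a ha =>
    AddSubgroup.mem_sup_left (show a ∈ (𝒜.vanishing Y).toSubmodule.toAddSubgroup from ha)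
  have hr : ∀ a ∈ 𝒜.vanishing Z, a ∈ S := fun a ha =>
    AddSubgroup.mem_sup_right (show a ∈ (𝒜.vanishing Z).toSubmodule.toAddSubgroup from ha)
  have := mem_closure_iSup_vanishing (𝒜 := 𝒜) (hY.union hZ)
    (fun i : Bool => if i then Yᶜ else Zᶜ) (by
      rintro (_ | _)
      · exact hZ.isOpen_compl
      · exact hY.isOpen_compl) (by
      rintro x ⟨-, hx⟩
      by_cases h : x ∈ Y
      · exact Set.mem_iUnion.2 ⟨false, fun h' => hx ⟨h, h'⟩⟩
      · exact Set.mem_iUnion.2 ⟨true, h⟩) S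
    (fun a ha => hl a (𝒜.vanishing_anti Set.subset_union_left ha)) (by
      rintro (_ | _) a ha
      · exact hr a (𝒜.vanishing_anti (show Z ⊆ (Y ∪ Z) \ Zᶜ from fun x hx => ⟨Or.inr hx, fun h => h hx⟩) ha)
      · exact hl a (𝒜.vanishing_anti (show Y ⊆ (Y ∪ Z) \ Yᶜ from fun x hx => ⟨Or.inl hx, fun h => h hx⟩) ha)) ha
  obtain ⟨d, hd, hd'⟩ := Metric.mem_closure_iff.1 this ε hε
  obtain ⟨b, hb, c, hc, rfl⟩ := AddSubgroup.mem_sup.1 hd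
  exact ⟨b, hb, c, hc, by rwa [dist_eq_norm] at hd'⟩

/-- A function acts on the fibre at `x` as its value there: on a generator `g · b` the difference is
`(f g - f(x) g) · b`, whose function vanishes at `x`. -/
lemma act_sub_smul_mem_vanishing (f : ZeroAtInftyContinuousMap X ℂ) (x : X) (a : A) :
    𝒜.act f a - f x • a ∈ 𝒜.vanishing {x} := by
  refine vanishing_induction (p := fun a => 𝒜.act f a - f x • a ∈ 𝒜.vanishing {x}) ?_
    (fun g b _ => ?_) ?_ (fun b c hb hc => ?_) (𝒜.mem_vanishing_empty a)
  · exact (𝒜.vanishing {x}).closed.preimage ((𝒜.act f).continuous.sub (continuous_const_smul _))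
  · rw [← act_fun_mul, ← act_fun_smul, ← act_fun_sub]
    refine act_mem_vanishing ?_ b
    rintro _ rfl
    rw [ZeroAtInftyContinuousMap.sub_apply, ZeroAtInftyContinuousMap.mul_apply,
      ZeroAtInftyContinuousMap.smul_apply, smul_eq_mul, sub_self]
  · rw [map_zero, smul_zero, sub_zero]; exact zero_mem _
  · rw [map_add, smul_add, add_sub_add_comm]
    exact add_mem hb hc

lemma norm_proj_mono {Y Z : Set X} (h : Y ⊆ Z) (a : A) :
    ‖(𝒜.vanishing Y).proj a‖ ≤ ‖(𝒜.vanishing Z).proj a‖ :=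
  NonUnitalStarAlgHom.norm_apply_le (𝒜.res h) ((𝒜.vanishing Z).proj a)

/-- By `mem_vanishing_union` the algebra over the union embeds in the product of the two
restrictions, and injective `*`-homomorphisms are isometric. -/
lemma norm_proj_union_le {Y Z : Set X} (a : A) : ‖(𝒜.vanishing (Y ∪ Z)).proj a‖ ≤
    max ‖(𝒜.vanishing Y).proj a‖ ‖(𝒜.vanishing Z).proj a‖ := by
  let φ : 𝒜.Restrict (Y ∪ Z) →⋆ₙₐ[ℂ] 𝒜.Restrict Y × 𝒜.Restrict Z :=
    NonUnitalStarAlgHom.prod (𝒜.res Set.subset_union_left) (𝒜.res Set.subset_union_right)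
  have hφ : Function.Injective φ := by
    refine (injective_iff_map_eq_zero φ).2 fun x hx => ?_
    obtain ⟨a, rfl⟩ := ClosedIdeal.proj_surjective _ x
    have h1 : (𝒜.vanishing Y).proj a = 0 := congrArg Prod.fst hx
    have h2 : (𝒜.vanishing Z).proj a = 0 := congrArg Prod.snd hx
    rw [ClosedIdeal.proj_eq_zero] at h1 h2 ⊢
    exact mem_vanishing_union h1 h2
  exact (NonUnitalStarAlgHom.norm_map φ hφ ((𝒜.vanishing (Y ∪ Z)).proj a)).ge

/-- An element that vanishes at each point of a compact set vanishes on it. -/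
theorem mem_vanishing_of_forall {Y : Set X} (hY : IsCompact Y) {a : A}
    (ha : ∀ y ∈ Y, a ∈ 𝒜.vanishing {y}) : a ∈ 𝒜.vanishing Y := by
  have key : ∀ ε : ℝ, 0 < ε → ‖(𝒜.vanishing Y).proj a‖ ≤ ε := fun ε hε => by
    -- Having norm at most `ε` over a set passes to subsets and to finite unions, so by compactness
    -- it is enough to find one such neighbourhood of each point.
    refine hY.induction_on (p := fun T => ‖(𝒜.vanishing T).proj a‖ ≤ ε) ?_
      (fun s t h ht => (norm_proj_mono h a).trans ht)
      (fun s t hs ht => (norm_proj_union_le a).trans (max_le hs ht)) fun y hy => ?_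
    · rw [(ClosedIdeal.proj_eq_zero _).2 (𝒜.mem_vanishing_empty a), norm_zero]
      exact hε.le
    · suffices h : ∀ ε : ℝ, 0 < ε → ∃ T ∈ nhds y, ‖(𝒜.vanishing T).proj a‖ ≤ ε by
        obtain ⟨T, hT, h⟩ := h ε hε
        exact ⟨T, mem_nhdsWithin_of_mem_nhds hT, h⟩
      -- Upper semicontinuity of the fibre norm at a zero. For `f · b` with `f y = 0` it follows
      -- from continuity of `f`.
      refine vanishing_induction (p := fun a => ∀ ε : ℝ, 0 < ε → ∃ T ∈ nhds y,
        ‖(𝒜.vanishing T).proj a‖ ≤ ε) ?_ (fun f b hf ε hε => ?_) (fun ε hε => ?_) ?_ (ha y hy)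
      · refine isClosed_of_closure_subset fun b hb ε hε => ?_
        obtain ⟨c, hc, hbc⟩ := Metric.mem_closure_iff.1 hb (ε / 2) (half_pos hε)
        obtain ⟨T, hT, h⟩ := hc (ε / 2) (half_pos hε)
        refine ⟨T, hT, ?_⟩
        rw [dist_eq_norm] at hbc
        have h1 : (𝒜.vanishing T).proj b = (𝒜.vanishing T).proj (b - c) + (𝒜.vanishing T).proj c := by
          rw [← map_add, sub_add_cancel]
        rw [h1]
        refine (norm_add_le _ _).trans ?_
        have := (𝒜.vanishing T).norm_toQuot_le (b - c)
        change ‖(𝒜.vanishing T).proj (b - c)‖ ≤ _ at this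
        linarith
      · have hb1 : 0 < ‖b‖ + 1 := by positivity
        have hη := div_pos hε hb1
        have hcont : ∀ᶠ x in nhds y, ‖f x‖ < ε / (‖b‖ + 1) := by
          have := (map_continuous f).norm.tendsto y
          rw [hf y rfl, norm_zero] at this
          exact this.eventually (gt_mem_nhds hη)
        refine ⟨{x | ‖f x‖ ≤ ε / (‖b‖ + 1)}, hcont.mono fun x hx => le_of_lt hx, ?_⟩
        obtain ⟨c, hc, hbc⟩ := exists_act_sub_mem (𝒜 := 𝒜) hη
          (Y := {x | ‖f x‖ ≤ ε / (‖b‖ + 1)}) (fun x hx => hx) b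
        have h1 : (𝒜.vanishing {x | ‖f x‖ ≤ ε / (‖b‖ + 1)}).proj (𝒜.act f b) =
            (𝒜.vanishing {x | ‖f x‖ ≤ ε / (‖b‖ + 1)}).proj (𝒜.act f b - c) := by
          rw [map_sub, (ClosedIdeal.proj_eq_zero _).2 hc, sub_zero]
        rw [h1]
        refine ((ClosedIdeal.norm_toQuot_le _ _).trans hbc).trans ?_
        rw [div_mul_eq_mul_div, div_le_iff₀ hb1]
        nlinarith
      · exact ⟨Set.univ, Filter.univ_mem, by rw [map_zero, norm_zero]; exact hε.le⟩
      · intro b c hb hc ε hε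
        obtain ⟨T, hT, h⟩ := hb (ε / 2) (half_pos hε)
        obtain ⟨T', hT', h'⟩ := hc (ε / 2) (half_pos hε)
        refine ⟨T ∩ T', Filter.inter_mem hT hT', ?_⟩
        rw [map_add]
        refine (norm_add_le _ _).trans ?_
        have h1 := norm_proj_mono (𝒜 := 𝒜) (Set.inter_subset_left : T ∩ T' ⊆ T) b
        have h2 := norm_proj_mono (𝒜 := 𝒜) (Set.inter_subset_right : T ∩ T' ⊆ T') c
        linarith
  rw [← ClosedIdeal.proj_eq_zero, ← norm_le_zero_iff]
  exact le_of_forall_pos_le_add fun ε hε => by simpa using key ε hε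

end C0Algebra

namespace C0Algebra

variable {X : Type v} [TopologicalSpace X] {A : Type u} [NonUnitalCStarAlgebra A]
  {𝒜 : C0Algebra X A}

/-! ### Restrictions to differences of closed sets -/

variable (𝒜) in
/-- The element of `A|_{Y ∖ Z}` defined by an element of `A` that vanishes on `Z`. -/
def relMk {Z Y : Set X} (h : Z ⊆ Y) (a : A) (ha : a ∈ 𝒜.vanishing Z) : 𝒜.relIdeal h :=
  ⟨(𝒜.vanishing Y).proj a, (𝒜.vanishing Z).proj_eq_zero.2 ha⟩

lemma exists_relMk_eq {Z Y : Set X} {h : Z ⊆ Y} (x : 𝒜.relIdeal h) :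
    ∃ a ha, 𝒜.relMk h a ha = x := by
  obtain ⟨x, hx⟩ := x
  obtain ⟨a, rfl⟩ := (𝒜.vanishing Y).proj_surjective x
  exact ⟨a, (𝒜.vanishing Z).proj_eq_zero.1 hx, rfl⟩

lemma relMk_eq_zero {Z Y : Set X} {h : Z ⊆ Y} {a : A} {ha : a ∈ 𝒜.vanishing Z} :
    𝒜.relMk h a ha = 0 ↔ a ∈ 𝒜.vanishing Y :=
  Subtype.ext_iff.trans (𝒜.vanishing Y).proj_eq_zero

lemma norm_relMk_sub_le {Z Y : Set X} {h : Z ⊆ Y} {a b : A} (ha : a ∈ 𝒜.vanishing Z)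
    (hb : b ∈ 𝒜.vanishing Z) : ‖𝒜.relMk h a ha - 𝒜.relMk h b hb‖ ≤ ‖a - b‖ :=
  (𝒜.vanishing Y).norm_toQuot_le (a - b)

variable (𝒜) in
/-- The map `A|_{Y' ∖ Z'} → A|_{Y ∖ Z}` for an inclusion of pairs `(Y, Z) ⊆ (Y', Z')`. -/
def relRes {Z Y Z' Y' : Set X} (h : Z ⊆ Y) (h' : Z' ⊆ Y') (hZ : Z ⊆ Z') (hY : Y ⊆ Y') :
    𝒜.relIdeal h' →⋆ₙₐ[ℂ] 𝒜.relIdeal h where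
  toFun x := ⟨𝒜.res hY x.1, by
    obtain ⟨a, ha, rfl⟩ := exists_relMk_eq x
    exact (𝒜.vanishing Z).proj_eq_zero.2 (𝒜.vanishing_anti hZ ha)⟩
  map_smul' c x := Subtype.ext (map_smul (𝒜.res hY) c x.1)
  map_zero' := Subtype.ext (map_zero (𝒜.res hY))
  map_add' x y := Subtype.ext (map_add (𝒜.res hY) x.1 y.1)
  map_mul' x y := Subtype.ext (map_mul (𝒜.res hY) x.1 y.1)
  map_star' x := Subtype.ext (map_star (𝒜.res hY) x.1)

section

variable {Z Y Z' Y' Z'' Y'' : Set X} (h : Z ⊆ Y) (h' : Z' ⊆ Y') (h'' : Z'' ⊆ Y'') (hZ : Z ⊆ Z')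
  (hY : Y ⊆ Y')

lemma relRes_relMk (a : A) (ha : a ∈ 𝒜.vanishing Z') :
    𝒜.relRes h h' hZ hY (𝒜.relMk h' a ha) = 𝒜.relMk h a (𝒜.vanishing_anti hZ ha) := rfl

lemma relRes_self (hZ : Z ⊆ Z) (hY : Y ⊆ Y) :
    𝒜.relRes h h hZ hY = NonUnitalStarAlgHom.id ℂ (𝒜.relIdeal h) := by
  refine NonUnitalStarAlgHom.ext fun x => ?_
  obtain ⟨a, ha, rfl⟩ := exists_relMk_eq x
  rfl

lemma relRes_comp (hZ' : Z' ⊆ Z'') (hY' : Y' ⊆ Y'') :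
    (𝒜.relRes h h' hZ hY).comp (𝒜.relRes h' h'' hZ' hY') =
      𝒜.relRes h h'' (hZ.trans hZ') (hY.trans hY') := by
  refine NonUnitalStarAlgHom.ext fun x => ?_
  obtain ⟨a, ha, rfl⟩ := exists_relMk_eq x
  rfl

lemma relRes_relRes (hZ' : Z' ⊆ Z'') (hY' : Y' ⊆ Y'') (x : 𝒜.relIdeal h'') :
    𝒜.relRes h h' hZ hY (𝒜.relRes h' h'' hZ' hY' x) =
      𝒜.relRes h h'' (hZ.trans hZ') (hY.trans hY') x := by
  obtain ⟨a, ha, rfl⟩ := exists_relMk_eq x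
  rfl

lemma relRes_eq_zero_of_subset (hk : Y ⊆ Z') (x : 𝒜.relIdeal h') : 𝒜.relRes h h' hZ hY x = 0 := by
  obtain ⟨a, ha, rfl⟩ := exists_relMk_eq x
  rw [relRes_relMk, relMk_eq_zero]
  exact 𝒜.vanishing_anti hk ha

/-- The short exact sequence of a triple. -/
lemma shortExact_triple {N M L : Set X} (hN : N ⊆ M) (hM : M ⊆ L) :
    IsShortExact (𝒜.relRes (hN.trans hM) hM hN subset_rfl)
      (𝒜.relRes hN (hN.trans hM) subset_rfl hM) where
  injective := by
    refine (injective_iff_map_eq_zero _).2 fun x hx => ?_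
    obtain ⟨a, ha, rfl⟩ := exists_relMk_eq x
    rw [relRes_relMk, relMk_eq_zero] at hx
    exact relMk_eq_zero.2 hx
  surjective x := by
    obtain ⟨a, ha, rfl⟩ := exists_relMk_eq x
    exact ⟨𝒜.relMk _ a ha, rfl⟩
  exact x := by
    obtain ⟨a, ha, rfl⟩ := exists_relMk_eq x
    rw [relRes_relMk, relMk_eq_zero]
    refine ⟨fun h => ⟨𝒜.relMk hM a h, rfl⟩, ?_⟩
    rintro ⟨y, hy⟩
    obtain ⟨b, hb, rfl⟩ := exists_relMk_eq y
    have : a - b ∈ 𝒜.vanishing L := by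
      rw [← ClosedIdeal.proj_eq_zero, map_sub, sub_eq_zero]
      exact (congrArg Subtype.val hy).symm
    have h2 := add_mem (𝒜.vanishing_anti hM this) hb
    rwa [sub_add_cancel] at h2

/-- Excision. -/
theorem relRes_bijective [T2Space X] [LocallyCompactSpace X] (hYc : IsClosed Y)
    (hZc : IsClosed Z') (h1 : Y' ⊆ Y ∪ Z') (h2 : Y ∩ Z' ⊆ Z) :
    Function.Bijective (𝒜.relRes h h' hZ hY) := by
  refine NonUnitalStarAlgHom.bijective_of_injective_of_dense _ ?_ fun x ε hε => ?_
  · refine (injective_iff_map_eq_zero _).2 fun x hx => ?_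
    obtain ⟨a, ha, rfl⟩ := exists_relMk_eq x
    rw [relRes_relMk, relMk_eq_zero] at hx
    exact relMk_eq_zero.2 (𝒜.vanishing_anti h1 (mem_vanishing_union hx ha))
  · obtain ⟨a, ha, rfl⟩ := exists_relMk_eq x
    -- The part `b` is zero over `Y`, while `c` vanishes on `Z'` and therefore lifts to the larger
    -- pair.
    obtain ⟨b, hb, c, hc, hbc⟩ := mem_closure_vanishing_add hYc hZc (𝒜.vanishing_anti h2 ha) hε
    have hc' := 𝒜.vanishing_anti hZ hc
    have hb' := 𝒜.vanishing_anti h hb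
    refine ⟨𝒜.relMk h' c hc, ?_⟩
    have e : 𝒜.relMk h (b + c) (add_mem hb' hc') = 𝒜.relMk h c hc' := by
      refine Subtype.ext ?_
      change (𝒜.vanishing Y).proj (b + c) = (𝒜.vanishing Y).proj c
      rw [map_add, ClosedIdeal.proj_eq_zero _ |>.2 hb, zero_add]
    rw [relRes_relMk, ← e, norm_sub_rev]
    exact (norm_relMk_sub_le ha _).trans hbc.le

end

/-- The decomposition of `A|_{Y ∖ Z}` as a direct sum, for `Y ∖ Z` a disjoint union of relatively
open subsets `Y ∖ W i`. -/
theorem isDirectSumCStar_relIdeal [T2Space X] [LocallyCompactSpace X] {κ : Type} {Z Y : Set X}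
    (h : Z ⊆ Y) (hY : IsClosed Y) (Zc Yc : κ → Set X) (hc : ∀ i, Zc i ⊆ Yc i)
    (hZ : ∀ i, Zc i ⊆ Z) (hcY : ∀ i, Yc i ⊆ Y) (W : κ → Set X) (hW : ∀ i, W i ⊆ Y)
    (hWc : ∀ i, IsClosed (W i)) (hZW : ∀ i, Z ⊆ W i) (hcW : ∀ i, Zc i ⊆ W i)
    (hb : ∀ i, Function.Bijective (𝒜.relRes (hc i) (hW i) (hcW i) (hcY i)))
    (hne : ∀ i j, i ≠ j → Yc j ⊆ W i) (hdisj : ∀ i j, i ≠ j → Y ⊆ W i ∪ W j)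
    (hcov : ∀ y ∈ Y, y ∉ Z → ∃ i, y ∉ W i)
    (inc : ∀ i, 𝒜.relIdeal (hc i) →⋆ₙₐ[ℂ] 𝒜.relIdeal h)
    (hinc : ∀ i x, inc i (𝒜.relRes (hc i) (hW i) (hcW i) (hcY i) x) =
      𝒜.relRes h (hW i) (hZW i) subset_rfl x) :
    IsDirectSumCStar inc fun i => 𝒜.relRes (hc i) h (hZ i) (hcY i) where
  pr_inc_same i b := by
    obtain ⟨x, rfl⟩ := (hb i).2 b
    rw [hinc, relRes_relRes]
  pr_inc_ne i j hij b := by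
    obtain ⟨x, rfl⟩ := (hb i).2 b
    rw [hinc, relRes_relRes]
    exact relRes_eq_zero_of_subset _ _ _ _ (hne i j hij) x
  orthogonal i j hij b c := by
    obtain ⟨x, rfl⟩ := (hb i).2 b
    obtain ⟨y, rfl⟩ := (hb j).2 c
    rw [hinc, hinc]
    obtain ⟨a, ha, rfl⟩ := exists_relMk_eq x
    obtain ⟨d, hd, rfl⟩ := exists_relMk_eq y
    exact Subtype.ext ((𝒜.vanishing Y).proj_eq_zero.2
      (𝒜.vanishing_anti (hdisj i j hij) (mul_mem_vanishing_union ha hd)))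
  dense := by
    intro x
    obtain ⟨a, ha, rfl⟩ := exists_relMk_eq x
    let T : Submodule ℂ (𝒜.relIdeal h) := Submodule.span ℂ {a | ∃ i b, inc i b = a}
    -- Elements of `A` whose class lies in the span of the summands. This subgroup contains the
    -- ideals of `Y` and of every `W i`, so `mem_closure_iSup_vanishing` shows it to be dense in the
    -- ideal of `Z`.
    let S : AddSubgroup A :=
      { carrier := {a | ∃ ha : a ∈ 𝒜.vanishing Z, 𝒜.relMk h a ha ∈ T}
        zero_mem' := ⟨zero_mem _, T.zero_mem⟩
        add_mem' := by
          rintro a b ⟨ha, ha'⟩ ⟨hb, hb'⟩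
          exact ⟨add_mem ha hb, T.add_mem ha' hb'⟩
        neg_mem' := by
          rintro a ⟨ha, ha'⟩
          exact ⟨neg_mem ha, T.neg_mem ha'⟩ }
    have := mem_closure_iSup_vanishing (𝒜 := 𝒜) hY (fun i => (W i)ᶜ) (fun i => (hWc i).isOpen_compl)
      (fun y hy => by
        obtain ⟨i, hi⟩ := hcov y hy.1 hy.2
        exact Set.mem_iUnion.2 ⟨i, hi⟩) S
      (fun a ha => ⟨𝒜.vanishing_anti h ha, by rw [relMk_eq_zero.2 ha]; exact T.zero_mem⟩)
      (fun i a ha => by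
        have ha' : a ∈ 𝒜.vanishing (W i) := 𝒜.vanishing_anti
          (show W i ⊆ Y \ (W i)ᶜ from fun y hy => ⟨hW i hy, fun k => k hy⟩) ha
        refine ⟨𝒜.vanishing_anti (hZW i) ha', Submodule.subset_span
          ⟨i, 𝒜.relRes (hc i) (hW i) (hcW i) (hcY i) (𝒜.relMk (hW i) a ha'), ?_⟩⟩
        rw [hinc]; rfl) ha
    refine Metric.mem_closure_iff.2 fun ε hε => ?_
    obtain ⟨b, ⟨hb1, hb2⟩, hb'⟩ := Metric.mem_closure_iff.1 this ε hε
    refine ⟨_, hb2, ?_⟩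
    rw [dist_eq_norm] at hb' ⊢
    exact (norm_relMk_sub_le ha hb1).trans_lt hb'

/-! ### Pull-backs along embeddings -/

section Pullback

variable {Y : Type} [TopologicalSpace Y] [CompactSpace Y]

/-- Constant functions. -/
def constHom (A : Type u) [NonUnitalCStarAlgebra A] (Y : Type) [TopologicalSpace Y]
    [CompactSpace Y] : A →⋆ₙₐ[ℂ] C(Y, A) where
  toFun a := ContinuousMap.const Y a
  map_smul' _ _ := rfl
  map_zero' := rfl
  map_add' _ _ := rfl
  map_mul' _ _ := rfl
  map_star' _ := rfl

variable (𝒜) in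
/-- The canonical map `A|_S → f^*A` for a map `f` with values in `S`. -/
def toPullback (f : C(Y, X)) {S : Set X} (hf : ∀ y, f y ∈ S) : 𝒜.Restrict S →⋆ₙₐ[ℂ] 𝒜.Pullback f :=
  (𝒜.vanishing S).lift ((𝒜.pullbackIdeal f).proj.comp (constHom A Y)) fun _ ha =>
    (𝒜.pullbackIdeal f).proj_eq_zero.2 fun y =>
      𝒜.vanishing_anti (Set.singleton_subset_iff.2 (hf y)) ha

lemma evalAt_toPullback (f : C(Y, X)) {S : Set X} (hf : ∀ y, f y ∈ S) (y : Y) {x : X}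
    (hx : f y = x) (a : 𝒜.Restrict S) :
    𝒜.evalAt f y hx (𝒜.toPullback f hf a) =
      𝒜.res (Set.singleton_subset_iff.2 (hx ▸ hf y)) a := by
  obtain ⟨a, rfl⟩ := (𝒜.vanishing S).proj_surjective a
  rfl

/-- For an embedding `f` of a compact space, `f^*A` is the restriction of `A` to the image. -/
theorem toPullback_bijective [T2Space X] [LocallyCompactSpace X] (f : C(Y, X))
    (hinj : Function.Injective f) {S : Set X} (hf : ∀ y, f y ∈ S) (hS : ∀ x ∈ S, ∃ y, f y = x) :
    Function.Bijective (𝒜.toPullback f hf) := by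
  have hSr : S = Set.range f := Set.Subset.antisymm hS (by rintro _ ⟨y, rfl⟩; exact hf y)
  have hemb : Topology.IsClosedEmbedding f := f.continuous.isClosedEmbedding hinj
  refine NonUnitalStarAlgHom.bijective_of_injective_of_dense _ ?_ fun x ε hε => ?_
  · refine (injective_iff_map_eq_zero _).2 fun x hx => ?_
    obtain ⟨a, rfl⟩ := (𝒜.vanishing S).proj_surjective x
    rw [ClosedIdeal.proj_eq_zero]
    refine mem_vanishing_of_forall (hSr ▸ isCompact_range f.continuous) fun x hx' => ?_
    obtain ⟨y, rfl⟩ := hS x hx'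
    exact (𝒜.pullbackIdeal f).proj_eq_zero.1 hx y
  · obtain ⟨F, rfl⟩ := (𝒜.pullbackIdeal f).proj_surjective x
    -- As `f` is an embedding, the sets on which `F` is `ε`-close to one of its values extend to
    -- open sets of `X`.
    have hO : ∀ y : Y, ∃ O : Set X, IsOpen O ∧ f ⁻¹' O = {z | ‖F z - F y‖ < ε} := fun y =>
      hemb.isInducing.isOpen_iff.1 (isOpen_lt (by fun_prop) continuous_const)
    choose O hOo hO using hO
    obtain ⟨t, ht⟩ := (isCompact_range f.continuous).elim_finite_subcover O hOo (by
      rintro _ ⟨y, rfl⟩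
      refine Set.mem_iUnion.2 ⟨y, ?_⟩
      rw [← Set.mem_preimage, hO]
      simpa using hε)
    have ht' : Set.range f ⊆ ⋃ j : Fin t.card, O (t.equivFin.symm j) := by
      intro x hx
      obtain ⟨i, hi, hxi⟩ := Set.mem_iUnion₂.1 (ht hx)
      exact Set.mem_iUnion.2 ⟨t.equivFin ⟨i, hi⟩, by simpa using hxi⟩
    obtain ⟨φ, hφU, hφ1, hφ, hφc⟩ := exists_continuous_sum_one_of_isOpen_isCompact
      (fun j : Fin t.card => hOo (t.equivFin.symm j)) (isCompact_range f.continuous) ht'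
    let c : Fin t.card → A := fun j => F (t.equivFin.symm j)
    have hψ : ∀ j, ∃ g : ZeroAtInftyContinuousMap X ℂ, ∀ x, g x = (φ j x : ℂ) := fun j => by
      refine ⟨⟨⟨fun x => (φ j x : ℂ), by fun_prop⟩, ?_⟩, fun _ => rfl⟩
      refine HasCompactSupport.is_zero_at_infty ?_
      exact (hφc j).comp_left Complex.ofReal_zero
    choose g hg using hψ
    -- In the fibre over `f y` this element agrees with the convex combination `∑ φ j (f y) • c j`,
    -- and each value `c j` that contributes there is within `ε` of `F y`.
    let a : A := ∑ j, 𝒜.act (g j) (c j)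
    let G : C(Y, A) := ⟨fun y => ∑ j, g j (f y) • c j, by fun_prop⟩
    refine ⟨(𝒜.vanishing S).proj a, ?_⟩
    have e : 𝒜.toPullback f hf ((𝒜.vanishing S).proj a) = (𝒜.pullbackIdeal f).proj G := by
      change (𝒜.pullbackIdeal f).proj (constHom A Y a) = _
      rw [← sub_eq_zero, ← map_sub, ClosedIdeal.proj_eq_zero]
      intro y
      change ∑ j, 𝒜.act (g j) (c j) - ∑ j, g j (f y) • c j ∈ _
      rw [← Finset.sum_sub_distrib]
      exact sum_mem fun j _ => act_sub_smul_mem_vanishing (g j) (f y) (c j)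
    rw [e, ← map_sub]
    refine (ClosedIdeal.norm_toQuot_le _ _).trans ((ContinuousMap.norm_le _ hε.le).2 fun y => ?_)
    have h1 : ∑ j, φ j (f y) = 1 := by
      have := hφ1 ⟨y, rfl⟩
      simpa using this
    have h2 : (G - F) y = ∑ j, (φ j (f y) : ℂ) • (c j - F y) := by
      change ∑ j, g j (f y) • c j - F y = _
      simp only [hg, smul_sub, Finset.sum_sub_distrib]
      rw [← Finset.sum_smul, ← Complex.ofReal_sum, h1, Complex.ofReal_one, one_smul]
    rw [h2]
    calc ‖∑ j, (φ j (f y) : ℂ) • (c j - F y)‖ ≤ ∑ j, φ j (f y) * ε := by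
          refine norm_sum_le_of_le _ fun j _ => ?_
          rw [norm_smul, Complex.norm_real, Real.norm_eq_abs, abs_of_nonneg (hφ j (f y)).1]
          by_cases h0 : φ j (f y) = 0
          · rw [h0, zero_mul, zero_mul]
          · refine mul_le_mul_of_nonneg_left ?_ (hφ j (f y)).1
            have : y ∈ f ⁻¹' O (t.equivFin.symm j) := hφU j (subset_tsupport _ h0)
            rw [hO] at this
            rw [norm_sub_rev]
            exact (show ‖F y - F (t.equivFin.symm j)‖ < ε from this).le
      _ = ε := by rw [← Finset.sum_mul, h1, one_mul]

end Pullback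

end C0Algebra

/-! ### The geometric realisation -/

namespace AbstractSimplicialComplex

variable {V : Type v} {K : AbstractSimplicialComplex V}

lemma exists_isOrdering (s : K.Face) : ∃ (p : ℕ) (v : Fin (p + 1) → V), IsOrdering v s := by
  obtain ⟨p, hp⟩ := Nat.exists_eq_succ_of_ne_zero s.nonempty.card_pos.ne'
  let e := s.1.equivFinOfCardEq hp
  refine ⟨p, fun i => (e.symm i).1, fun i j h => e.symm.injective (Subtype.ext h), ?_⟩
  ext a
  refine ⟨?_, fun ha => ⟨e ⟨a, ha⟩, by simp⟩⟩
  rintro ⟨i, rfl⟩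
  exact (e.symm i).2

namespace Realization

instance : T2Space K.Realization := inferInstanceAs (T2Space {t : V → ℝ // (∀ v, 0 ≤ t v) ∧
    ∃ s ∈ K.faces, (∀ v, v ∉ s → t v = 0) ∧ ∑ v ∈ s, t v = 1})

lemma continuous_coord (a : V) : Continuous fun x : K.Realization => x.1 a :=
  (continuous_apply a).comp continuous_subtype_val

lemma exists_support (x : K.Realization) : ∃ s : K.Face, ∀ a, a ∈ s.1 ↔ x.1 a ≠ 0 := by
  classical
  obtain ⟨s, hs, h0, h1⟩ := x.2.2
  refine ⟨⟨s.filter fun a => x.1 a ≠ 0, mem_faces_of_subset hs (Finset.filter_subset _ _) ?_⟩,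
    fun a => ?_⟩
  · by_contra hc
    rw [Finset.not_nonempty_iff_eq_empty, Finset.filter_eq_empty_iff] at hc
    rw [Finset.sum_eq_zero fun a ha => not_not.1 (hc ha)] at h1
    exact zero_ne_one h1
  · rw [Finset.mem_filter]
    exact ⟨fun h => h.2, fun h => ⟨not_imp_comm.1 (h0 a) h, h⟩⟩

/-- The smallest face containing a point. -/
def supp (x : K.Realization) : K.Face := (exists_support x).choose

lemma mem_supp {x : K.Realization} {a : V} : a ∈ x.supp.1 ↔ x.1 a ≠ 0 :=
  (exists_support x).choose_spec a

lemma mem_closedSimplex_iff {x : K.Realization} {s : Finset V} :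
    x ∈ K.closedSimplex s ↔ x.supp.1 ⊆ s :=
  ⟨fun h _ ha => not_imp_comm.1 (h _) (mem_supp.1 ha),
    fun h _ ha => not_imp_comm.1 (fun k => h (mem_supp.2 k)) ha⟩

end Realization

/-- The subspace of the realisation given by a subcomplex. -/
def carrier (L : LowerSet K.Face) : Set K.Realization := {x | x.supp ∈ L}

lemma carrier_mono {L M : LowerSet K.Face} (h : L ≤ M) : carrier L ⊆ carrier M := fun _ hx => h hx

lemma carrier_bot : carrier (⊥ : LowerSet K.Face) = ∅ := rfl

lemma mem_carrier_Iic {x : K.Realization} {s : K.Face} :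
    x ∈ carrier (LowerSet.Iic s) ↔ x ∈ K.closedSimplex s.1 :=
  Realization.mem_closedSimplex_iff.symm

/-- Nonzero coordinates remain nonzero nearby, so supports can only grow near a point. A point
outside `L` thus has a neighbourhood outside `L`. -/
lemma isClosed_carrier (L : LowerSet K.Face) : IsClosed (carrier L) := by
  rw [← isOpen_compl_iff, isOpen_iff_mem_nhds]
  intro x hx
  have h : ∀ᶠ y in nhds x, ∀ a ∈ x.supp.1, y.1 a ≠ 0 := by
    rw [Filter.eventually_all_finset]
    exact fun a ha => (Realization.continuous_coord a).continuousAt.eventually_ne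
      (Realization.mem_supp.1 ha)
  refine h.mono fun y hy hyL => hx (L.lower ?_ hyL)
  exact fun a ha => Realization.mem_supp.2 (hy a ha)

variable (K) in
/-- The subcomplex underlying the `p`-skeleton. -/
def skel (p : ℤ) : LowerSet K.Face where
  carrier := {s | (s.1.card : ℤ) ≤ p + 1}
  lower' s t h (hs : (s.1.card : ℤ) ≤ p + 1) := by
    have := Finset.card_le_card (show t.1 ⊆ s.1 from h)
    change (t.1.card : ℤ) ≤ p + 1
    omega

lemma mem_skel {p : ℤ} {s : K.Face} : s ∈ skel K p ↔ (s.1.card : ℤ) ≤ p + 1 := Iff.rfl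

lemma skel_mono : Monotone (skel K) := fun p q h s (hs : (s.1.card : ℤ) ≤ p + 1) => by
  show (s.1.card : ℤ) ≤ q + 1
  omega

/-- An equality of functions of `p`, so that it can be substituted for the whole filtration at once.
-/
lemma skeleton_eq : K.skeleton = fun p => carrier (skel K p) := by
  funext p
  ext x
  constructor
  · rintro ⟨s, hs, hc, hx⟩
    have := Finset.card_le_card (Realization.mem_closedSimplex_iff.1 hx)
    change (x.supp.1.card : ℤ) ≤ p + 1
    omega
  · intro hx
    exact ⟨x.supp.1, x.supp.2, hx, Realization.mem_closedSimplex_iff.2 subset_rfl⟩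

/-! #### Characteristic maps -/

section CharMap

variable {p : ℕ} {v : Fin (p + 1) → V} {s : K.Face} (hs : IsOrdering v s)

open Classical in
/-- The affine parametrisation of a closed simplex given by an ordering of its vertices. -/
def charMap : C(stdSimplex ℝ (Fin (p + 1)), K.Realization) where
  toFun t := ⟨fun a => ∑ i, if v i = a then t.1 i else 0, fun a =>
      Finset.sum_nonneg fun i _ => by
        split_ifs
        · exact t.2.1 i
        · exact le_rfl,
    s.1, s.2, fun a ha => Finset.sum_eq_zero fun i _ => if_neg fun (e : v i = a) => ha (e ▸ hs.mem i), by
      refine (Finset.sum_comm.trans (Finset.sum_congr rfl fun i _ => ?_)).trans t.2.2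
      rw [Finset.sum_ite_eq, if_pos (hs.mem i)]⟩
  continuous_toFun := by
    refine Continuous.subtype_mk (continuous_pi fun a => continuous_finsetSum _ fun i _ => ?_) _
    split_ifs
    · exact (continuous_apply i).comp continuous_subtype_val
    · exact continuous_const

lemma charMap_apply (t : stdSimplex ℝ (Fin (p + 1))) (i : Fin (p + 1)) :
    (charMap hs t).1 (v i) = t.1 i := by
  classical
  refine (Finset.sum_eq_single i (fun j _ hj => if_neg fun e => hj (hs.injective e))
    fun h => absurd (Finset.mem_univ i) h).trans (if_pos rfl)

lemma charMap_injective : Function.Injective (charMap hs) := fun t t' h =>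
  Subtype.ext (funext fun i => by rw [← charMap_apply hs, ← charMap_apply hs, h])

lemma charMap_mem (t : stdSimplex ℝ (Fin (p + 1))) : charMap hs t ∈ K.closedSimplex s.1 :=
  fun a ha => by
    classical
    refine (Finset.sum_eq_zero ?_ : ∑ i, (if v i = a then t.1 i else 0) = 0)
    exact fun i _ => if_neg fun (e : v i = a) => ha (e ▸ hs.mem i)

/-- The barycentric coordinates of a point of a closed simplex. -/
def coords (x : K.closedSimplex s.1) : stdSimplex ℝ (Fin (p + 1)) :=
  ⟨fun i => x.1.1 (v i), fun i => x.1.2.1 _, by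
    classical
    obtain ⟨r, hr, h0, h1⟩ := x.1.2.2
    have hx := x.2
    have e : s.1 = Finset.univ.map ⟨v, hs.injective⟩ := Finset.coe_injective (by
      rw [Finset.coe_map, Finset.coe_univ, Set.image_univ]
      exact hs.range_eq.symm)
    have h2 : ∑ a ∈ s.1, x.1.1 a = 1 := by
      refine Eq.trans ?_ h1
      refine (Finset.sum_subset (Finset.inter_subset_left : s.1 ∩ r ⊆ s.1) ?_).symm.trans
        (Finset.sum_subset (Finset.inter_subset_right : s.1 ∩ r ⊆ r) ?_)
      · exact fun a ha har => h0 a fun hr => har (Finset.mem_inter.2 ⟨ha, hr⟩)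
      · exact fun a ha has => hx a fun hs => has (Finset.mem_inter.2 ⟨hs, ha⟩)
    exact ((Finset.sum_map _ _ _).symm.trans (by rw [← e])).trans h2⟩

lemma continuous_coords : Continuous (coords hs) :=
  Continuous.subtype_mk (continuous_pi fun i =>
    (Realization.continuous_coord (v i)).comp continuous_subtype_val) _

lemma charMap_coords (x : K.closedSimplex s.1) : charMap hs (coords hs x) = x := by
  refine Subtype.ext (funext fun a => ?_)
  by_cases ha : a ∈ s.1
  · obtain ⟨i, rfl⟩ := hs.exists_eq ha
    exact charMap_apply hs _ i
  · rw [charMap_mem hs _ a ha, x.2 a ha]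

end CharMap

lemma isCompact_closedSimplex (s : K.Face) : IsCompact (K.closedSimplex s.1) := by
  obtain ⟨p, v, hs⟩ := exists_isOrdering s
  have : K.closedSimplex s.1 = Set.range (charMap hs) := by
    ext x
    refine ⟨fun hx => ⟨coords hs ⟨x, hx⟩, charMap_coords hs ⟨x, hx⟩⟩, ?_⟩
    rintro ⟨t, rfl⟩
    exact charMap_mem hs t
  rw [this]
  exact isCompact_range (charMap hs).continuous

/-- If the coordinate at `a` is nonzero at `x`, it is nonzero on a neighbourhood. This neighbourhood
lies in the union of the closed simplices containing `a`, of which there are finitely many, all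
compact. -/
lemma LocallyFinite.locallyCompactSpace (hK : K.LocallyFinite) :
    LocallyCompactSpace K.Realization := by
  have : WeaklyLocallyCompactSpace K.Realization := ⟨fun x => by
    obtain ⟨a, ha⟩ := x.supp.nonempty
    refine ⟨⋃ s ∈ {s ∈ K.faces | a ∈ s}, K.closedSimplex s,
      (hK a).isCompact_biUnion fun s hs => isCompact_closedSimplex ⟨s, hs.1⟩, ?_⟩
    have h := (Realization.continuous_coord a).continuousAt.eventually_ne (Realization.mem_supp.1 ha)
    refine h.mono fun y hy => Set.mem_iUnion₂.2 ⟨y.supp.1, ⟨y.supp.2, Realization.mem_supp.2 hy⟩, ?_⟩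
    exact Realization.mem_closedSimplex_iff.2 subset_rfl⟩
  infer_instance

end AbstractSimplicialComplex

/-! ### The relative homology theory of a `C₀(X)`-algebra -/

namespace CohomologyTheory

open AbstractSimplicialComplex

variable {C : GoodSubcategory.{u}} (h : CohomologyTheory.{u, w} C)

lemma map_bijective (n : ℤ) {A B : C.Obj} (φ : A →⋆ₙₐ[ℂ] B) (hφ : Function.Bijective φ) :
    Function.Bijective (h.map n φ) := by
  let e : A ≃⋆ₐ[ℂ] B := StarAlgEquiv.ofBijective φ hφ
  let ψ : B →⋆ₙₐ[ℂ] A := (e.symm : B →⋆ₙₐ[ℂ] A)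
  have h1 : ψ.comp φ = NonUnitalStarAlgHom.id ℂ A := NonUnitalStarAlgHom.ext fun a =>
    e.symm_apply_apply a
  have h2 : φ.comp ψ = NonUnitalStarAlgHom.id ℂ B := NonUnitalStarAlgHom.ext fun b =>
    e.apply_symm_apply b
  refine Function.bijective_iff_has_inverse.2 ⟨h.map n ψ, fun x => ?_, fun x => ?_⟩
  · rw [← h.map_comp, h2, h.map_id]
  · rw [← h.map_comp, h1, h.map_id]

variable {V : Type v} {K : AbstractSimplicialComplex V} {A : C.Obj} (𝒜 : C0Algebra K.Realization A)

/-- The relative homology theory `(L, M) ↦ h^n(A|_{|L| ∖ |M|})`. -/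
def pairHomology (hK : K.LocallyFinite) : RelHomology.{v, w} K.Face where
  G n {_ _} hML := h.group n (relObj 𝒜 (carrier_mono hML))
  -- Algebras restrict from the larger pair to the smaller one; contravariance of `h` turns this
  -- into a map from the smaller pair to the larger.
  map n {_ _ _ _} k k' hM hL := h.map n (A := relObj 𝒜 (carrier_mono k'))
    (B := relObj 𝒜 (carrier_mono k)) (𝒜.relRes _ _ (carrier_mono hM) (carrier_mono hL))
  map_id n {M L} k x := by
    refine Eq.trans ?_ (h.map_id n (relObj 𝒜 (carrier_mono k)) x)
    exact congrArg (fun φ => h.map n (A := relObj 𝒜 (carrier_mono k))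
      (B := relObj 𝒜 (carrier_mono k)) φ x) (C0Algebra.relRes_self _ _ _)
  map_map n {M L M' L' M'' L''} k k' k'' hM hL hM' hL' x := by
    refine (h.map_comp n (A := relObj 𝒜 (carrier_mono k'')) (B := relObj 𝒜 (carrier_mono k'))
      (D := relObj 𝒜 (carrier_mono k)) _ _ x).symm.trans ?_
    exact congrArg (fun φ => h.map n (A := relObj 𝒜 (carrier_mono k''))
      (B := relObj 𝒜 (carrier_mono k)) φ x) (C0Algebra.relRes_comp _ _ _ _ _ _ _)
  δ {_ _} hnm {_ _ _} hN hM := h.δ hnm (J := relObj 𝒜 (carrier_mono hM))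
    (A := relObj 𝒜 (carrier_mono (hN.trans hM))) (B := relObj 𝒜 (carrier_mono hN))
    (C0Algebra.shortExact_triple (carrier_mono hN) (carrier_mono hM))
  δ_map {_ _} hnm {_ _ _ _ _ _} hN hM hN' hM' kN kM kL x :=
    h.δ_natural hnm (J := relObj 𝒜 (carrier_mono hM'))
      (A := relObj 𝒜 (carrier_mono (hN'.trans hM'))) (B := relObj 𝒜 (carrier_mono hN'))
      (J' := relObj 𝒜 (carrier_mono hM))
      (A' := relObj 𝒜 (carrier_mono (hN.trans hM))) (B' := relObj 𝒜 (carrier_mono hN))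
      (C0Algebra.shortExact_triple (carrier_mono hN') (carrier_mono hM'))
      (C0Algebra.shortExact_triple (carrier_mono hN) (carrier_mono hM))
      (𝒜.relRes _ _ (carrier_mono kM) (carrier_mono kL))
      (𝒜.relRes _ _ (carrier_mono kN) (carrier_mono kL))
      (𝒜.relRes _ _ (carrier_mono kN) (carrier_mono kM))
      (fun a => by rw [C0Algebra.relRes_relRes, C0Algebra.relRes_relRes])
      (fun a => by rw [C0Algebra.relRes_relRes, C0Algebra.relRes_relRes]) x
  exact_mid n {_ _ _} hN hM x := h.exact_middle n (J := relObj 𝒜 (carrier_mono hM))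
    (A := relObj 𝒜 (carrier_mono (hN.trans hM))) (B := relObj 𝒜 (carrier_mono hN))
    (C0Algebra.shortExact_triple (carrier_mono hN) (carrier_mono hM)) x
  exact_top {_ _} hnm {_ _ _} hN hM x := h.exact_left hnm (J := relObj 𝒜 (carrier_mono hM))
    (A := relObj 𝒜 (carrier_mono (hN.trans hM))) (B := relObj 𝒜 (carrier_mono hN))
    (C0Algebra.shortExact_triple (carrier_mono hN) (carrier_mono hM)) x
  exact_bot {_ _} hnm {_ _ _} hN hM x := h.exact_right hnm (J := relObj 𝒜 (carrier_mono hM))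
    (A := relObj 𝒜 (carrier_mono (hN.trans hM))) (B := relObj 𝒜 (carrier_mono hN))
    (C0Algebra.shortExact_triple (carrier_mono hN) (carrier_mono hM)) x
  excision n {M L M' L'} k k' hM hL h1 h2 := by
    have := hK.locallyCompactSpace
    exact h.map_bijective n (A := relObj 𝒜 (carrier_mono k')) (B := relObj 𝒜 (carrier_mono k)) _
      (C0Algebra.relRes_bijective _ _ _ _ (isClosed_carrier _) (isClosed_carrier _)
        (fun x hx => h1 hx) fun x hx => h2 hx)

end CohomologyTheory

/-! ### Evaluation at points and constant sections over closed simplices -/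

namespace C0Algebra

variable {X : Type v} [TopologicalSpace X] {A : Type u} [NonUnitalCStarAlgebra A]
  (𝒜 : C0Algebra X A)

/-- The evaluation `A|_{Y ∖ Z} → A_x` at a point `x` of `Y`. -/
def evalRel {Z Y : Set X} (h : Z ⊆ Y) {x : X} (hx : x ∈ Y) : 𝒜.relIdeal h →⋆ₙₐ[ℂ] 𝒜.Fibre x :=
  (𝒜.res (Set.singleton_subset_iff.2 hx)).comp (𝒜.relIdeal h).incl

lemma incl_relIdeal_bijective {Z Y : Set X} (h : Z ⊆ Y) (hZ : Z = ∅) :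
    Function.Bijective (𝒜.relIdeal h).incl := by
  refine ⟨Subtype.val_injective, fun b => ?_⟩
  obtain ⟨a, rfl⟩ := (𝒜.vanishing Y).proj_surjective b
  exact ⟨𝒜.relMk h a (hZ ▸ 𝒜.mem_vanishing_empty a), rfl⟩

end C0Algebra

namespace CohomologyTheory

open AbstractSimplicialComplex

variable {C : GoodSubcategory.{u}} {h : CohomologyTheory.{u, w} C} {V : Type v}
  {K : AbstractSimplicialComplex V} {A : C.Obj} {𝒜 : C0Algebra K.Realization A}
  (hK : K.LocallyFinite)

variable (h 𝒜) in
/-- The map `h^n(A_x) → h^n(A|_{|L|})` for a point `x` of `|L|`. -/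
def pointMap (n : ℤ) {L : LowerSet K.Face} {x : K.Realization} (hx : x ∈ carrier L) :
    h.group n (restrictObj 𝒜 {x}) →+ (h.pairHomology 𝒜 hK).abs n L :=
  h.map n (A := relObj 𝒜 (carrier_mono (bot_le : ⊥ ≤ L))) (B := restrictObj 𝒜 {x})
    (𝒜.evalRel (carrier_mono bot_le) hx)

lemma absMap_pointMap (n : ℤ) {L L' : LowerSet K.Face} (hL : L ≤ L') {x : K.Realization}
    (hx : x ∈ carrier L) (a : h.group n (restrictObj 𝒜 {x})) :
    (h.pairHomology 𝒜 hK).absMap n hL (h.pointMap 𝒜 hK n hx a) =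
      h.pointMap 𝒜 hK n (carrier_mono hL hx) a := by
  refine (h.map_comp n (A := relObj 𝒜 (carrier_mono (bot_le : ⊥ ≤ L')))
    (B := relObj 𝒜 (carrier_mono (bot_le : ⊥ ≤ L))) (D := restrictObj 𝒜 {x}) _ _ a).symm.trans ?_
  refine congrArg (fun φ => h.map n (A := relObj 𝒜 (carrier_mono (bot_le : ⊥ ≤ L')))
    (B := restrictObj 𝒜 {x}) φ a) ?_
  refine NonUnitalStarAlgHom.ext fun b => ?_
  obtain ⟨a, ha, rfl⟩ := C0Algebra.exists_relMk_eq b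
  rfl

/-- Evaluation at `x = f y` factors as `A|_{|L|} → f^*A → A_x`. This transfers statements about
pull-backs, such as the fibration property, to restrictions of `A`. -/
lemma pointMap_eq_map_evalMap (n : ℤ) {L : LowerSet K.Face} {Y : Type} [TopologicalSpace Y]
    [CompactSpace Y] (hY : C.Admissible Y) (f : C(Y, K.Realization))
    (hf : ∀ y, f y ∈ carrier L) (y : Y) {x : K.Realization} (hx : f y = x) (hxL : x ∈ carrier L)
    (a : h.group n (restrictObj 𝒜 {x})) :
    h.pointMap 𝒜 hK n hxL a = h.map n (A := relObj 𝒜 (carrier_mono (bot_le : ⊥ ≤ L)))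
      (B := restrictObj 𝒜 (carrier L)) (𝒜.relIdeal (carrier_mono bot_le)).incl
      (h.map n (A := restrictObj 𝒜 (carrier L)) (B := pullbackObj 𝒜 hY f) (𝒜.toPullback f hf)
        (h.evalMap 𝒜 hY n f y hx a)) := by
  refine Eq.trans ?_ (congrArg (h.map n (A := relObj 𝒜 (carrier_mono (bot_le : ⊥ ≤ L)))
      (B := restrictObj 𝒜 (carrier L)) (𝒜.relIdeal (carrier_mono bot_le)).incl)
    (h.map_comp n (A := restrictObj 𝒜 (carrier L)) (B := pullbackObj 𝒜 hY f)
      (D := restrictObj 𝒜 {x}) _ _ a))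
  refine Eq.trans ?_ (h.map_comp n (A := relObj 𝒜 (carrier_mono (bot_le : ⊥ ≤ L)))
    (B := restrictObj 𝒜 (carrier L)) (D := restrictObj 𝒜 {x}) _ _ a)
  refine congrArg (fun φ => h.map n (A := relObj 𝒜 (carrier_mono (bot_le : ⊥ ≤ L)))
    (B := restrictObj 𝒜 {x}) φ a) ?_
  refine NonUnitalStarAlgHom.ext fun b => ?_
  exact (𝒜.evalAt_toPullback f hf y hx _).symm

section Simplex

variable {s : K.Face}

/-- The affine parametrisation embeds the standard simplex onto `s`, so `A|_s` is the pull-back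
along it and the fibration hypothesis applies. -/
lemma pointMap_bijective (hA : h.IsFibration 𝒜) (n : ℤ) {x : K.Realization} (hx : x ∈ carrier (LowerSet.Iic s)) :
    Function.Bijective (h.pointMap 𝒜 hK n hx) := by
  have := hK.locallyCompactSpace
  obtain ⟨p, v, hs⟩ := exists_isOrdering s
  have hf : ∀ t, charMap hs t ∈ carrier (LowerSet.Iic s) := fun t =>
    mem_carrier_Iic.2 (charMap_mem hs t)
  have hS : ∀ x ∈ carrier (LowerSet.Iic s), ∃ t, charMap hs t = x := fun x hx =>
    ⟨_, charMap_coords hs ⟨x, mem_carrier_Iic.1 hx⟩⟩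
  obtain ⟨t, rfl⟩ := hS x hx
  have e : ⇑(h.pointMap 𝒜 hK n hx) = _ := funext fun a =>
    pointMap_eq_map_evalMap hK n (C.admissible_stdSimplex p) (charMap hs) hf t rfl hx a
  rw [e]
  refine Function.Bijective.comp (h.map_bijective n (A := relObj 𝒜 _) (B := restrictObj 𝒜 _) _
    (𝒜.incl_relIdeal_bijective _ carrier_bot)) (Function.Bijective.comp
      (h.map_bijective n (A := restrictObj 𝒜 _) (B := pullbackObj 𝒜 _ _) _
        (C0Algebra.toPullback_bijective _ (charMap_injective hs) hf hS)) (hA p _ _ n))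

/-- In barycentric coordinates the path lifts to the standard simplex, where transport is compatible
with the evaluations of the pull-back. -/
lemma pointMap_transport (hA : h.IsFibration 𝒜) (n : ℤ) {x y : K.Realization} (γ : Path x y)
    (hγ : ∀ t, γ t ∈ K.closedSimplex s.1) (hx : x ∈ carrier (LowerSet.Iic s))
    (hy : y ∈ carrier (LowerSet.Iic s)) (a : h.group n (restrictObj 𝒜 {x})) :
    h.pointMap 𝒜 hK n hy (transport n hA γ a) = h.pointMap 𝒜 hK n hx a := by
  obtain ⟨p, v, hs⟩ := exists_isOrdering s
  have hf : ∀ t, charMap hs t ∈ carrier (LowerSet.Iic s) := fun t =>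
    mem_carrier_Iic.2 (charMap_mem hs t)
  let g : C(unitInterval, stdSimplex ℝ (Fin (p + 1))) :=
    ⟨fun t => coords hs ⟨γ t, hγ t⟩, (continuous_coords hs).comp (γ.continuous.subtype_mk hγ)⟩
  have hg : ∀ t, charMap hs (g t) = γ t := fun t => charMap_coords hs ⟨γ t, hγ t⟩
  have h0 := (hg 0).trans γ.source
  have h1 := (hg 1).trans γ.target
  rw [pointMap_eq_map_evalMap hK n (C.admissible_stdSimplex p) (charMap hs) hf (g 0) h0,
    pointMap_eq_map_evalMap hK n (C.admissible_stdSimplex p) (charMap hs) hf (g 1) h1,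
    evalMap_transport _ n hA γ (charMap hs) g hg (g 0) (g 1) rfl rfl h0 h1]

/-- The groups of both simplices are identified with `h^n(A_x)` for a vertex `x` of the smaller one.
-/
lemma pairHomology_acyclic [DecidableEq V] (hA : h.IsFibration 𝒜) : (h.pairHomology 𝒜 hK).Acyclic := by
  intro s t hst n
  obtain ⟨p, v, hs⟩ := exists_isOrdering s
  let x := charMap hs (stdSimplex.vertex 0)
  have hx : x ∈ carrier (LowerSet.Iic s) := mem_carrier_Iic.2 (charMap_mem hs _)
  rw [← Function.Bijective.of_comp_iff _ (pointMap_bijective hK hA n hx)]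
  refine (congrArg Function.Bijective (funext fun a => ?_)).mpr (pointMap_bijective hK hA n
    (carrier_mono (RelHomology.Iic_le_Iic hst) hx))
  exact absMap_pointMap hK n _ hx a

lemma exists_path (x y : K.closedSimplex s.1) :
    ∃ γ : Path (x : K.Realization) y, ∀ t, γ t ∈ K.closedSimplex s.1 := by
  obtain ⟨p, v, hs⟩ := exists_isOrdering s
  have hpc : IsPathConnected (stdSimplex ℝ (Fin (p + 1))) :=
    (convex_stdSimplex ℝ _).isPathConnected ⟨_, (stdSimplex.vertex 0).2⟩
  have := isPathConnected_iff_pathConnectedSpace.1 hpc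
  let γ := PathConnectedSpace.somePath (coords hs x) (coords hs y)
  exact ⟨(γ.map (charMap hs).continuous).cast (charMap_coords hs x).symm (charMap_coords hs y).symm,
    fun t => charMap_mem hs (γ t)⟩

variable (s) (hA : h.IsFibration 𝒜) (n : ℤ)

/-- The isomorphism `h^n(A_y) ≅ h^n(A|_s)` for a point `y` of a closed simplex `s`. -/
def pointEquiv (y : K.closedSimplex s.1) :
    h.group n (restrictObj 𝒜 {y.1}) ≃+ (h.pairHomology 𝒜 hK).abs n (LowerSet.Iic s) :=
  AddEquiv.ofBijective _ (pointMap_bijective hK hA n (mem_carrier_Iic.2 y.2))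

/-- The isomorphism `h^n(A|_s) ≅ Γ_const(s, ℋ^n)`. -/
def constSectionsHom : (h.pairHomology 𝒜 hK).abs n (LowerSet.Iic s) →+
    (groupBundle hA n).constSections (K.closedSimplex s.1) where
  toFun z := ⟨fun y => (pointEquiv hK s hA n y).symm z, fun x y γ hγ =>
    (pointEquiv hK s hA n y).injective (by
      refine (pointMap_transport hK hA n γ hγ (mem_carrier_Iic.2 x.2) (mem_carrier_Iic.2 y.2)
        _).trans ?_
      exact ((pointEquiv hK s hA n x).apply_symm_apply z).trans
        ((pointEquiv hK s hA n y).apply_symm_apply z).symm)⟩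
  map_zero' := Subtype.ext (funext fun y => map_zero (pointEquiv hK s hA n y).symm)
  map_add' a b := Subtype.ext (funext fun y => map_add (pointEquiv hK s hA n y).symm a b)

/-- Any two points of a closed simplex are joined by a path inside it, so a constant section is
determined by one value; `pointMap_transport` shows that each value extends. -/
lemma constSectionsHom_bijective : Function.Bijective (constSectionsHom hK s hA n) := by
  obtain ⟨p, v, hs⟩ := exists_isOrdering s
  let x : K.closedSimplex s.1 := ⟨_, charMap_mem hs (stdSimplex.vertex 0)⟩
  refine ⟨fun z z' e => ?_, fun g => ?_⟩
  · exact (pointEquiv hK s hA n x).symm.injective (congrFun (congrArg Subtype.val e) x)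
  · refine ⟨pointEquiv hK s hA n x (g.1 x), Subtype.ext (funext fun y => ?_)⟩
    obtain ⟨γ, hγ⟩ := exists_path x y
    refine (pointEquiv hK s hA n y).symm_apply_eq.2 ?_
    rw [← g.2 x y γ hγ]
    exact (pointMap_transport hK hA n γ hγ (mem_carrier_Iic.2 x.2) (mem_carrier_Iic.2 y.2)
      _).symm

/-- Both sides are computed by evaluation at the points of `t`. This compatibility turns inclusions
of simplices into restriction of the coefficients in the simplicial boundary. -/
lemma resConst_constSectionsHom {t : K.Face} (hts : t ≤ s)
    (z : (h.pairHomology 𝒜 hK).abs n (LowerSet.Iic t)) :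
    (groupBundle hA n).resConst (K.closedSimplex_mono hts)
      (constSectionsHom hK s hA n ((h.pairHomology 𝒜 hK).absMap n (RelHomology.Iic_le_Iic hts) z)) =
      constSectionsHom hK t hA n z := by
  refine Subtype.ext (funext fun y => ?_)
  refine (pointEquiv hK s hA n ⟨y, K.closedSimplex_mono hts y.2⟩).symm_apply_eq.2 ?_
  refine Eq.trans ?_ (absMap_pointMap hK n (RelHomology.Iic_le_Iic hts) (mem_carrier_Iic.2 y.2) _)
  exact congrArg _ ((pointEquiv hK t hA n y).apply_symm_apply z).symm

end Simplex

end CohomologyTheory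

/-! ### Classes on a layer as chains -/

namespace AbstractSimplicialComplex

variable {V : Type v} {K : AbstractSimplicialComplex V}

/-- The `p`-simplices are exactly the cells of `L` outside `M`, and their boundaries lie in `M`. -/
structure IsLayer (p : ℕ) (M L : LowerSet K.Face) : Prop where
  le : M ≤ L
  isTop : ∀ σ : K.Simplex p, RelHomology.IsTop σ.face M L
  Iio_le : ∀ σ : K.Simplex p, LowerSet.Iio σ.face ≤ M
  exists_face_eq : ∀ s ∈ L, s ∉ M → ∃ σ : K.Simplex p, σ.face = s

lemma isLayer_skel {p : ℕ} {P : ℤ} (hP : P = p) : IsLayer p (skel K (P - 1)) (skel K P) where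
  le := skel_mono (by omega)
  isTop σ := by
    have hσ : σ.face.1.card = p + 1 := σ.2.2
    refine ⟨?_, ?_, fun u hu hσu => ?_⟩
    · rw [mem_skel]; omega
    · rw [mem_skel]; omega
    · rw [mem_skel] at hu
      exact Subtype.ext (Finset.eq_of_subset_of_card_le (show σ.face.1 ⊆ u.1 from hσu)
        (by omega)).symm
  Iio_le σ u hu := by
    have hσ : σ.face.1.card = p + 1 := σ.2.2
    have := Finset.card_lt_card (show u.1 ⊂ σ.face.1 from hu)
    change (u.1.card : ℤ) ≤ P - 1 + 1
    omega
  exists_face_eq s hs hs' := by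
    rw [mem_skel] at hs hs'
    exact ⟨⟨s.1, s.2, by omega⟩, rfl⟩

lemma Simplex.face_injective {p : ℕ} :
    Function.Injective (Simplex.face : K.Simplex p → K.Face) := fun _ _ h =>
  Subtype.ext (Subtype.mk.inj h)

lemma Simplex.finite (hK : K.faces.Finite) (p : ℕ) : Finite (K.Simplex p) := by
  have := hK.to_subtype
  exact Finite.of_injective _ Simplex.face_injective

lemma Simplex.countable (hK : K.faces.Countable) (p : ℕ) : Countable (K.Simplex p) := by
  have := hK.to_subtype
  exact Simplex.face_injective.countable

end AbstractSimplicialComplex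

/-! ### The chain map given by coefficients, and the boundary formula -/

namespace RelHomology

open AbstractSimplicialComplex

variable {V : Type v} {K : AbstractSimplicialComplex V}
  {𝓗 : RelHomology.{v, w} K.Face}

section Layer

variable {p : ℕ} {M L : LowerSet K.Face} (hl : IsLayer p M L) (n : ℤ)

variable (𝓗) in
/-- The map `G n s → G n (L, M)` for a simplex `s` of a layer. -/
abbrev push (σ : K.Simplex p) : 𝓗.cell n σ.face →+ 𝓗.G n hl.le :=
  𝓗.map n (Iio_le_Iic σ.face) hl.le (hl.Iio_le σ) (hl.isTop σ).Iic_le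

lemma coeff_sum_push (b : ∀ σ : K.Simplex p, 𝓗.cell n σ.face) (S : Finset (K.Simplex p))
    (hS : ∀ σ, σ ∉ S → b σ = 0) (τ : K.Simplex p) :
    𝓗.coeff n hl.le (hl.isTop τ) (∑ σ ∈ S, 𝓗.push hl n σ (b σ)) = b τ := by
  rw [map_sum]
  refine (Finset.sum_eq_single τ (fun σ _ hσ => ?_) fun hτ => ?_).trans
    (coeff_push n hl.le (hl.isTop τ) (hl.Iio_le τ) (b τ))
  · exact coeff_push_ne _ _ _ _ _ (fun e => hσ (Simplex.face_injective e)) _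
  · rw [hS τ hτ, map_zero, map_zero]

/-- With finitely many simplices all of them can be removed at once. What remains of `L` lies in
`M`, so the class comes from a zero group. -/
lemma eq_zero_of_coeff_eq_zero [Finite (K.Simplex p)] (x : 𝓗.G n hl.le)
    (hx : ∀ σ, 𝓗.coeff n hl.le (hl.isTop σ) x = 0) : x = 0 := by
  have hS : ∀ s ∈ Set.range (Simplex.face : K.Simplex p → K.Face), IsTop s M L := by
    rintro _ ⟨σ, rfl⟩; exact hl.isTop σ
  have h0 := map_sdiff_eq_zero n hl.le _ (Set.finite_range _) hS x (by rintro _ ⟨σ, rfl⟩; exact hx σ)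
  obtain ⟨y, rfl⟩ := (𝓗.exact_mid n (le_sdiff hl.le hS) (sdiff_le_self L _) x).1 h0
  rw [𝓗.eq_zero_of_le _ (fun u hu => ?_) y, map_zero]
  obtain ⟨h1, h2⟩ := (mem_sdiff_of_isTop hS).1 hu
  by_contra hM
  obtain ⟨σ, rfl⟩ := hl.exists_face_eq u h1 hM
  exact h2 ⟨σ, rfl⟩

end Layer

variable [DecidableEq V] {n : ℤ} {G : GroupBundle.{v, w} K.Realization}
  (Φ : ∀ s : K.Face, 𝓗.abs n (LowerSet.Iic s) →+ G.constSections (K.closedSimplex s.1))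
  (o : K.Orientation)

section ChainMap

variable {p : ℕ} {M L : LowerSet K.Face} (hl : IsLayer p M L) {q : ℤ} (hq : q + p = n)

/-- The identification `G q (σ, ∂σ) → Γ_const(σ, G)`. -/
def coordinate (σ : K.Simplex p) :
    𝓗.cell q σ.face →+ G.constSections (K.closedSimplex σ.1) :=
  (Φ σ.face).comp (𝓗.ordMap p hq (o.vert σ) σ.face (o.isOrdering σ))

/-- The chain of coefficients of a class. -/
def chainMap : 𝓗.G q hl.le →+ G.Chain p :=
  AddMonoidHom.mk' (fun x σ => coordinate Φ o hq σ (𝓗.coeff q hl.le (hl.isTop σ) x))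
    fun a b => funext fun σ =>
      (congrArg (coordinate Φ o hq σ) (map_add _ a b)).trans (map_add _ _ _)

variable {Φ}

lemma chainMap_apply (x : 𝓗.G q hl.le) (σ : K.Simplex p) :
    chainMap Φ o hl hq x σ = coordinate Φ o hq σ (𝓗.coeff q hl.le (hl.isTop σ) x) := rfl

lemma coordinate_bijective (hac : 𝓗.Acyclic) (hΦ : ∀ s, Function.Bijective (Φ s))
    (σ : K.Simplex p) : Function.Bijective (coordinate Φ o hq σ) :=
  (hΦ σ.face).comp (hac.ordMap_bijective hq (o.isOrdering σ))

lemma coordinate_eq_zero_iff (hac : 𝓗.Acyclic) (hΦ : ∀ s, Function.Bijective (Φ s))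
    {σ : K.Simplex p} {m : 𝓗.cell q σ.face} : coordinate Φ o hq σ m = 0 ↔ m = 0 :=
  map_eq_zero_iff _ (coordinate_bijective o hq hac hΦ σ).1

lemma chainMap_injective (hac : 𝓗.Acyclic) (hΦ : ∀ s, Function.Bijective (Φ s))
    (hc : ∀ x : 𝓗.G q hl.le, (∀ σ, 𝓗.coeff q hl.le (hl.isTop σ) x = 0) → x = 0) :
    Function.Injective (chainMap Φ o hl hq) :=
  (injective_iff_map_eq_zero _).2 fun x hx => hc x fun σ =>
    (coordinate_eq_zero_iff o hq hac hΦ).1 (congrFun hx σ)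

/-- A finite chain is realised by a finite sum of classes pushed forward from single simplices; this
needs no additivity of the theory. -/
lemma finChain_le_range_chainMap (hac : 𝓗.Acyclic) (hΦ : ∀ s, Function.Bijective (Φ s)) :
    G.finChain p ≤ (chainMap Φ o hl hq).range := by
  intro a ha
  choose b hb using fun σ => (coordinate_bijective o hq hac hΦ σ).2 (a σ)
  refine ⟨∑ σ ∈ Set.Finite.toFinset ha, 𝓗.push hl q σ (b σ), funext fun τ => ?_⟩
  rw [chainMap_apply, coeff_sum_push, hb]
  intro σ hσ
  rw [← coordinate_eq_zero_iff o hq hac hΦ, hb]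
  exact not_not.1 fun k => hσ ((Set.Finite.mem_toFinset ha).2 k)

lemma range_chainMap_eq_finChain (hac : 𝓗.Acyclic) (hΦ : ∀ s, Function.Bijective (Φ s))
    (hc : ∀ x : 𝓗.G q hl.le, {σ | 𝓗.coeff q hl.le (hl.isTop σ) x ≠ 0}.Finite) :
    (chainMap Φ o hl hq).range = G.finChain p := by
  refine le_antisymm ?_ (finChain_le_range_chainMap o hl hq hac hΦ)
  rintro _ ⟨x, rfl⟩
  exact (hc x).subset fun σ hσ k => hσ ((coordinate_eq_zero_iff o hq hac hΦ).2 k)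

lemma range_chainMap_eq_top (hac : 𝓗.Acyclic) (hΦ : ∀ s, Function.Bijective (Φ s))
    (hc : ∀ b : ∀ σ : K.Simplex p, 𝓗.cell q σ.face,
      ∃ x, ∀ σ, 𝓗.coeff q hl.le (hl.isTop σ) x = b σ) : (chainMap Φ o hl hq).range = ⊤ := by
  refine eq_top_iff.2 fun a _ => ?_
  choose b hb using fun σ => (coordinate_bijective o hq hac hΦ σ).2 (a σ)
  obtain ⟨x, hx⟩ := hc b
  exact ⟨x, funext fun σ => by rw [chainMap_apply, hx, hb]⟩

end ChainMap

variable {Φ}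

/-- The connecting map is the simplicial boundary. -/
theorem boundary_chainMap (hK : K.LocallyFinite)
    (hres : ∀ (s t : K.Face) (h : t ≤ s) (z : 𝓗.abs n (LowerSet.Iic t)),
      G.resConst (K.closedSimplex_mono h) (Φ s (𝓗.absMap n (Iic_le_Iic h) z)) = Φ t z)
    {p : ℕ} {N M L : LowerSet K.Face} (hl : IsLayer p N M) (hl' : IsLayer (p + 1) M L) {q q' : ℤ}
    (hq : q + (p + 1 : ℕ) = n) (hq' : q' + p = n) (hqq : q + 1 = q') (x : 𝓗.G q hl'.le) :
    G.boundary o hK p (chainMap Φ o hl' hq x) = chainMap Φ o hl hq' (𝓗.δ hqq hl.le hl'.le x) := by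
  funext τ
  have := hK.finite_cofaces τ
  have := Fintype.ofFinite {σ : K.Simplex (p + 1) // τ.1 ⊆ σ.1}
  let e : {σ : K.Simplex (p + 1) // τ.1 ⊆ σ.1} ↪ K.Face :=
    ⟨fun σ => σ.1.face, fun σ σ' h => Subtype.ext (Simplex.face_injective h)⟩
  -- Local finiteness makes the set of cofaces of `τ` finite, as `coeff_δ` requires.
  let S : Finset K.Face := Finset.univ.map e
  have hS : ∀ s ∈ S, ∃ σ : {σ : K.Simplex (p + 1) // τ.1 ⊆ σ.1}, σ.1.face = s := fun s hs => by
    obtain ⟨σ, -, h⟩ := Finset.mem_map.1 hs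
    exact ⟨σ, h⟩
  have hS' : ∀ σ, e σ ∈ S := fun σ => Finset.mem_map_of_mem e (Finset.mem_univ σ)
  have h1 : ∀ s ∈ S, IsTop s M L := fun s hs => by
    obtain ⟨σ, rfl⟩ := hS s hs; exact hl'.isTop σ.1
  have h2 : ∀ s ∈ S, LowerSet.Iio s ≤ M := fun s hs => by
    obtain ⟨σ, rfl⟩ := hS s hs; exact hl'.Iio_le σ.1
  have h3 : ∀ s ∈ S, τ.face ⋖ s := fun s hs => by
    obtain ⟨σ, rfl⟩ := hS s hs; exact Simplex.face_covBy o σ.2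
  have h4 : ∀ s ∈ L, τ.face < s → s ∈ S := fun s hs hτ => by
    have hM : s ∉ M := fun hM => hτ.ne' ((hl.isTop τ).eq_of_le s hM hτ.le)
    obtain ⟨σ, rfl⟩ := hl'.exists_face_eq s hs hM
    exact hS' ⟨σ, hτ.le⟩
  rw [chainMap_apply, coeff_δ hqq hl.le hl'.le (hl.isTop τ) S h1 h2 h3 h4, map_sum]
  refine (finsum_eq_sum_of_fintype _).trans ?_
  let f : {σ : K.Simplex (p + 1) // τ.1 ⊆ σ.1} → S := fun σ => ⟨e σ, hS' σ⟩
  have hf : Function.Bijective f := ⟨fun σ σ' h => e.injective (congrArg Subtype.val h), fun s => by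
    obtain ⟨σ, hσ⟩ := hS s.1 s.2
    exact ⟨σ, Subtype.ext hσ⟩⟩
  refine (Finset.sum_congr rfl fun σ _ => ?_).trans (hf.sum_comp fun s : S =>
    coordinate Φ o hq' τ (𝓗.inc hqq (h3 s s.2) (𝓗.coeff q hl'.le (h1 s s.2) x)))
  -- For each coface the two contributions are compared in the absolute group of `σ`: `ordMap_face`
  -- supplies the incidence number, and `hres` the restriction of constant sections to `τ`.
  obtain ⟨l, φ, hφ, hi⟩ := o.exists_incidence_eq σ.2
  have hc := Simplex.face_covBy o σ.2
  have k := ordMap_face (𝓗 := 𝓗) hq hqq hq' (o.isOrdering σ.1) (o.isOrdering τ) hc l φ hφ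
    (𝓗.coeff q hl'.le (hl'.isTop σ.1) x)
  refine Eq.trans ?_ (hres σ.1.face τ.face hc.le _)
  refine Eq.trans ?_ (congrArg (fun y => G.resConst (K.closedSimplex_mono σ.2) (Φ σ.1.face y)) k.symm)
  rw [hi, chainMap_apply, ← map_zsmul]
  exact congrArg (G.resConst (K.closedSimplex_mono σ.2)) (map_zsmul (Φ σ.1.face) _ _).symm

end RelHomology

/-- If `⨁ βᵢ → G` is surjective and split over each summand, then each element of `G` has finitely
many nonzero components and is determined by them. -/
lemma DirectSum.finite_and_eq_zero_of_surjective {κ : Type*} [DecidableEq κ] {β : κ → Type*}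
    [∀ i, AddCommGroup (β i)] {G : Type*} [AddCommGroup G] (f : ∀ i, β i →+ G) (c : ∀ i, G →+ β i)
    (hsame : ∀ i b, c i (f i b) = b) (hne : ∀ j i, j ≠ i → ∀ b, c i (f j b) = 0)
    (hf : Function.Surjective (DirectSum.toAddMonoid f)) (x : G) :
    {i | c i x ≠ 0}.Finite ∧ ((∀ i, c i x = 0) → x = 0) := by
  obtain ⟨y, rfl⟩ := hf x
  have key : ∀ i, c i (DirectSum.toAddMonoid f y) = y i := by
    intro i
    induction y using DirectSum.induction_on with
    | zero => rw [map_zero, map_zero, DirectSum.zero_apply]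
    | of j b =>
      rw [DirectSum.toAddMonoid_of]
      by_cases hij : j = i
      · subst hij
        rw [DirectSum.of_eq_same, hsame]
      · rw [DirectSum.of_eq_of_ne _ _ _ (Ne.symm hij), hne j i hij]
    | add y y' h1 h2 => rw [map_add, map_add, h1, h2, DirectSum.add_apply]
  refine ⟨(DFinsupp.finite_support y).subset fun i hi k => hi ((key i).trans k), fun h0 => ?_⟩
  have : y = 0 := DFinsupp.ext fun i => (key i).symm.trans (h0 i)
  rw [this, map_zero]

/-! ### Layers as direct sums over open simplices -/

namespace CohomologyTheory

open AbstractSimplicialComplex RelHomology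

variable {C : GoodSubcategory.{u}} {h : CohomologyTheory.{u, w} C} {V : Type v}
  {K : AbstractSimplicialComplex V} {A : C.Obj} {𝒜 : C0Algebra K.Realization A}

section Layer

variable {p : ℕ} {M L : LowerSet K.Face}

lemma relRes_layer_bijective (hK : K.LocallyFinite) (hl : IsLayer p M L) (σ : K.Simplex p) :
    Function.Bijective (𝒜.relRes (carrier_mono (Iio_le_Iic σ.face))
      (carrier_mono (erase_le_self L σ.face)) (carrier_mono (hl.isTop σ).Iio_le_erase)
      (carrier_mono (hl.isTop σ).Iic_le)) := by
  have := hK.locallyCompactSpace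
  refine C0Algebra.relRes_bijective _ _ _ _ (isClosed_carrier _) (isClosed_carrier _)
    (fun x hx => ?_) fun x hx => ?_
  · by_cases k : σ.face ≤ x.supp
    · exact Or.inl ((hl.isTop σ).eq_of_le _ hx k).le
    · exact Or.inr ⟨hx, k⟩
  · exact lt_of_le_of_ne hx.1 fun e => hx.2.2 (show σ.face ≤ x.supp from e.ge)

variable (𝒜) in
/-- The inclusion of the summand of a simplex into the algebra of a layer. -/
def layerIncl (hK : K.LocallyFinite) (hl : IsLayer p M L) (σ : K.Simplex p) :
    𝒜.relIdeal (carrier_mono (Iio_le_Iic σ.face)) →⋆ₙₐ[ℂ] 𝒜.relIdeal (carrier_mono hl.le) :=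
  (𝒜.relRes (carrier_mono hl.le) (carrier_mono (erase_le_self L σ.face))
    (carrier_mono ((hl.isTop σ).le_erase hl.le)) subset_rfl).comp
  ((StarAlgEquiv.ofBijective (𝒜.relRes (carrier_mono (Iio_le_Iic σ.face))
    (carrier_mono (erase_le_self L σ.face)) (carrier_mono (hl.isTop σ).Iio_le_erase)
    (carrier_mono (hl.isTop σ).Iic_le)) (relRes_layer_bijective hK hl σ)).symm :
    𝒜.relIdeal (carrier_mono (Iio_le_Iic σ.face)) →⋆ₙₐ[ℂ] _)

lemma layerIncl_relRes (hK : K.LocallyFinite) (hl : IsLayer p M L) (σ : K.Simplex p)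
    (x : 𝒜.relIdeal (carrier_mono (erase_le_self L σ.face))) :
    layerIncl 𝒜 hK hl σ (𝒜.relRes (carrier_mono (Iio_le_Iic σ.face)) _
      (carrier_mono (hl.isTop σ).Iio_le_erase) (carrier_mono (hl.isTop σ).Iic_le) x) =
      𝒜.relRes (carrier_mono hl.le) _ (carrier_mono ((hl.isTop σ).le_erase hl.le)) subset_rfl x :=
  congrArg (𝒜.relRes (carrier_mono hl.le) (carrier_mono (erase_le_self L σ.face))
    (carrier_mono ((hl.isTop σ).le_erase hl.le)) subset_rfl)
    ((StarAlgEquiv.ofBijective _ (relRes_layer_bijective hK hl σ)).symm_apply_apply x)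

/-- The algebra of a layer is the direct sum of the algebras of its open simplices. -/
lemma isDirectSumCStar_layer (hK : K.LocallyFinite) (hl : IsLayer p M L) {κ : Type} (e : κ ≃ K.Simplex p) :
    IsDirectSumCStar (fun i => layerIncl 𝒜 hK hl (e i)) fun i =>
      𝒜.relRes (carrier_mono (Iio_le_Iic (e i).face)) (carrier_mono hl.le)
        (carrier_mono (hl.Iio_le (e i))) (carrier_mono (hl.isTop (e i)).Iic_le) := by
  have := hK.locallyCompactSpace
  refine C0Algebra.isDirectSumCStar_relIdeal (carrier_mono hl.le) (isClosed_carrier L)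
    (fun i => carrier (LowerSet.Iio (e i).face)) (fun i => carrier (LowerSet.Iic (e i).face)) _ _ _
    (fun i => carrier (L.erase (e i).face)) (fun i => carrier_mono (erase_le_self L _))
    (fun i => isClosed_carrier _) (fun i => carrier_mono ((hl.isTop (e i)).le_erase hl.le))
    (fun i => carrier_mono (hl.isTop (e i)).Iio_le_erase)
    (fun i => relRes_layer_bijective hK hl (e i)) (fun i j hij x hx => ?_) (fun i j hij x hx => ?_)
    (fun x hx hxM => ?_) _ fun i x => layerIncl_relRes hK hl (e i) x
  · refine ⟨(hl.isTop (e j)).Iic_le hx, fun k => hij (e.injective (Simplex.face_injective ?_))⟩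
    exact ((hl.isTop (e i)).eq_of_le _ (hl.isTop (e j)).mem (le_trans k hx)).symm
  · by_cases k : (e i).face ≤ x.supp
    · refine Or.inr ⟨hx, fun k' => hij (e.injective (Simplex.face_injective ?_))⟩
      exact ((hl.isTop (e i)).eq_of_le _ hx k).symm.trans ((hl.isTop (e j)).eq_of_le _ hx k')
    · exact Or.inl ⟨hx, k⟩
  · obtain ⟨σ, hσ⟩ := hl.exists_face_eq _ hx hxM
    refine ⟨e.symm σ, fun k => k.2 ?_⟩
    rw [Equiv.apply_symm_apply]
    exact hσ.le

/-- The inclusion of a summand is restriction from `(L, L ∖ σ)` to `(L, M)` after the inverse of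
excision, which is the construction of `coeff` at the level of algebras. -/
lemma map_layerIncl (hK : K.LocallyFinite) (hl : IsLayer p M L) (n : ℤ) (σ : K.Simplex p) (x : (h.pairHomology 𝒜 hK).G n hl.le) :
    h.map n (A := relObj 𝒜 (carrier_mono (Iio_le_Iic σ.face)))
      (B := relObj 𝒜 (carrier_mono hl.le)) (layerIncl 𝒜 hK hl σ) x =
      (h.pairHomology 𝒜 hK).coeff n hl.le (hl.isTop σ) x := by
  refine ((coeff_eq_iff (𝓗 := h.pairHomology 𝒜 hK) n hl.le (hl.isTop σ) x _).2 ?_).symm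
  refine Eq.trans ?_ (h.map_comp n (A := relObj 𝒜 (carrier_mono (erase_le_self L σ.face)))
    (B := relObj 𝒜 (carrier_mono (Iio_le_Iic σ.face))) (D := relObj 𝒜 (carrier_mono hl.le))
    (𝒜.relRes _ _ (carrier_mono (hl.isTop σ).Iio_le_erase) (carrier_mono (hl.isTop σ).Iic_le))
    (layerIncl 𝒜 hK hl σ) x)
  refine congrArg (fun φ => h.map n (A := relObj 𝒜 (carrier_mono (erase_le_self L σ.face)))
    (B := relObj 𝒜 (carrier_mono hl.le)) φ x) ?_
  exact NonUnitalStarAlgHom.ext fun x => (layerIncl_relRes hK hl σ x).symm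

/-- The inclusions of the summands of a layer induce the coefficient maps. -/
lemma SigmaMultiplicative.bijective_coeff (hm : h.SigmaMultiplicative)
    (hK : K.LocallyFinite) (hl : IsLayer p M L)
    (hc : K.faces.Countable) (n : ℤ) :
    Function.Bijective fun (x : (h.pairHomology 𝒜 hK).G n hl.le) (σ : K.Simplex p) =>
      (h.pairHomology 𝒜 hK).coeff n hl.le (hl.isTop σ) x := by
  have := Simplex.countable hc p
  -- Multiplicativity concerns index types in the lowest universe; a countable type has a copy
  -- there.
  let e := (equivShrink.{0} (K.Simplex p)).symm
  have : Countable (Shrink.{0} (K.Simplex p)) := e.injective.countable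
  have hb := hm (Shrink.{0} (K.Simplex p)) (fun i => relObj 𝒜 (carrier_mono (Iio_le_Iic (e i).face)))
    (relObj 𝒜 (carrier_mono hl.le)) _ _ (isDirectSumCStar_layer hK hl e) n
  have hb' := (Equiv.piCongrLeft (fun σ : K.Simplex p =>
    (h.pairHomology 𝒜 hK).cell n σ.face) e).bijective.comp hb
  refine (congrArg Function.Bijective (funext fun x => funext fun σ => ?_)).mp hb'
  obtain ⟨i, rfl⟩ := e.surjective σ
  refine (Equiv.piCongrLeft_apply_apply (fun σ : K.Simplex p =>
    (h.pairHomology 𝒜 hK).cell n σ.face) e _ i).trans ?_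
  exact map_layerIncl hK hl n (e i) x

/-- The projections onto the summands of a layer induce the push-forward maps, so every class is a
finite sum of push-forwards. -/
lemma SigmaAdditive.exists_finite_coeff (hs : h.SigmaAdditive) (hK : K.LocallyFinite)
    (hl : IsLayer p M L) (hc : K.faces.Countable) (n : ℤ) (x : (h.pairHomology 𝒜 hK).G n hl.le) :
    {σ | (h.pairHomology 𝒜 hK).coeff n hl.le (hl.isTop σ) x ≠ 0}.Finite ∧
      ((∀ σ, (h.pairHomology 𝒜 hK).coeff n hl.le (hl.isTop σ) x = 0) → x = 0) := by
  classical
  have := Simplex.countable hc p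
  let e := (equivShrink.{0} (K.Simplex p)).symm
  have : Countable (Shrink.{0} (K.Simplex p)) := e.injective.countable
  let B : Shrink.{0} (K.Simplex p) → C.Obj := fun i =>
    relObj 𝒜 (carrier_mono (Iio_le_Iic (e i).face))
  have key := DirectSum.finite_and_eq_zero_of_surjective (fun i =>
      ((h.pairHomology 𝒜 hK).push hl n (e i) : h.group n (B i) →+ _))
    (fun i => (h.pairHomology 𝒜 hK).coeff n hl.le (hl.isTop (e i)))
    (fun i b => coeff_push n hl.le (hl.isTop (e i)) (hl.Iio_le (e i)) b)
    (fun j i hij b => coeff_push_ne n hl.le (hl.isTop (e i)) (hl.Iio_le (e j)) (hl.isTop (e j)).Iic_le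
      (fun k => hij (e.injective (Simplex.face_injective k))) b)
    (hs (Shrink.{0} (K.Simplex p)) B (relObj 𝒜 (carrier_mono hl.le)) _ _
      (isDirectSumCStar_layer hK hl e) n).2 x
  refine ⟨(key.1.image e).subset fun σ hσ => ⟨e.symm σ, ?_, e.apply_symm_apply σ⟩,
    fun h0 => key.2 fun i => h0 (e i)⟩
  obtain ⟨i, rfl⟩ := e.surjective σ
  rw [Equiv.symm_apply_apply]
  exact hσ

end Layer

end CohomologyTheory

/-! ### The second page as the homology of a chain complex -/

namespace ExactCouple

variable (T : ExactCouple.{w})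

lemma subsingleton_page (h0 : ∀ p < 0, ∀ q, Subsingleton (T.D p q)) (r : ℕ+) {p : ℤ} (hp : p < 0)
    (q : ℤ) : Subsingleton (T.Page r p q) := by
  have hE : ∀ x : T.E p q, x = 0 := fun x => by
    have := h0 p hp q
    have := h0 (p - 1) (by omega) (q + 1)
    obtain ⟨y, rfl⟩ := (T.exact_k p rfl x).1 (Subsingleton.elim _ _)
    rw [Subsingleton.elim y 0, map_zero]
  refine subsingleton_of_forall_eq 0 fun x => ?_
  obtain ⟨x, rfl⟩ := T.toPage_surjective r p q x
  rw [show x = 0 from Subtype.ext (hE x), map_zero]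

variable {V : Type v} {K : AbstractSimplicialComplex V} {G : GroupBundle.{v, w} K.Realization}
  {o : K.Orientation} {hK : K.LocallyFinite} {n : ℤ}
  (Ψ : ∀ (p : ℕ) {P q : ℤ}, P = p → q + p = n → T.E P q →+ G.Chain p)
  (hΨ : ∀ (p : ℕ) {P q q' : ℤ} (hP : P = (p + 1 : ℕ)) (hP' : P - 1 = p) (hq : q + (p + 1 : ℕ) = n)
    (hq' : q' + p = n) (hqq : q + 1 = q') (x : T.E P q),
    G.boundary o hK p (Ψ (p + 1) hP hq x) = Ψ p hP' hq' (T.j (P - 1) q' (T.k P hqq x)))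
  (hinj : ∀ (p : ℕ) {P q : ℤ} (hP : P = p) (hq : q + p = n), Function.Injective (Ψ p hP hq))
  (S : ∀ p, AddSubgroup (G.Chain p))
  (hS : ∀ (p : ℕ) {P q : ℤ} (hP : P = p) (hq : q + p = n), (Ψ p hP hq).range = S p)

include hΨ hinj hS in
-- An element is a cycle for `d¹` exactly when its chain has zero boundary, since `Ψ` is injective
-- one dimension lower. In dimension zero there is no condition on either side, because `D_{-1}`
-- vanishes.
lemma map_Z_two (h0 : ∀ p < 0, ∀ q, Subsingleton (T.D p q)) (p : ℕ) {P q : ℤ} (hP : P = p)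
    (hq : q + p = n) : (T.Z 2 P q).map (Ψ p hP hq) = G.cycles o hK p ⊓ S p := by
  rw [← hS p hP hq]
  have key : ∀ x, x ∈ T.Z 2 P q ↔ Ψ p hP hq x ∈ G.cycles o hK p := by
    intro x
    rw [T.mem_Z_two_iff rfl]
    cases p with
    | zero =>
      have := h0 (P - 1) (by omega) (q + 1)
      exact ⟨fun _ => AddSubgroup.mem_top _, fun _ => by
        rw [Subsingleton.elim (T.k P rfl x) 0, map_zero]⟩
    | succ p =>
      refine Iff.trans ?_ (AddMonoidHom.mem_ker (f := G.boundary o hK p)).symm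
      rw [hΨ p hP (by push_cast at hP; omega) hq (by push_cast at hq; omega) rfl]
      exact (map_eq_zero_iff _ (hinj p _ _)).symm
  ext y
  constructor
  · rintro ⟨x, hx, rfl⟩
    exact ⟨(key x).1 hx, x, rfl⟩
  · rintro ⟨hy, x, rfl⟩
    exact ⟨x, (key x).2 hy, rfl⟩

include hΨ hS in
lemma map_B_two (p : ℕ) {P q : ℤ} (hP : P = p) (hq : q + p = n) :
    (T.B 2 P q).map (Ψ p hP hq) = (S (p + 1)).map (G.boundary o hK p) := by
  -- Boundaries come from the column one higher; this substitution makes the target of `k` literally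
  -- the column in question.
  obtain ⟨P, rfl⟩ : ∃ P', P = P' - 1 := ⟨P + 1, by omega⟩
  have hP' : P = (p + 1 : ℕ) := by push_cast; omega
  have hq' : q - 1 + (p + 1 : ℕ) = n := by push_cast; omega
  have hqq : q - 1 + 1 = q := by omega
  rw [← hS (p + 1) hP' hq']
  ext y
  constructor
  · rintro ⟨x, hx, rfl⟩
    obtain ⟨z, rfl⟩ := (T.mem_B_two_iff hqq x).1 hx
    exact ⟨_, ⟨z, rfl⟩, hΨ p hP' hP hq' hq hqq z⟩
  · rintro ⟨_, ⟨z, rfl⟩, rfl⟩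
    exact ⟨_, (T.mem_B_two_iff hqq _).2 ⟨z, rfl⟩, (hΨ p hP' hP hq' hq hqq z).symm⟩

end ExactCouple

/-! ### Assembly: the first differential, the ends of the filtration, the second page -/

namespace C0Algebra

variable {X : Type v} [TopologicalSpace X] {A : Type u} [NonUnitalCStarAlgebra A]
  {𝒜 : C0Algebra X A} {N M L : Set X} (hN : N ⊆ M) (hM : M ⊆ L)

lemma incl_relRes_left (a : 𝒜.relIdeal hM) :
    (𝒜.relIdeal (hN.trans hM)).incl (𝒜.relRes (hN.trans hM) hM hN subset_rfl a) =
      (𝒜.relIdeal hM).incl a := by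
  obtain ⟨a, ha, rfl⟩ := exists_relMk_eq a
  rfl

lemma incl_relRes_right (a : 𝒜.relIdeal (hN.trans hM)) :
    (𝒜.relIdeal hN).incl (𝒜.relRes hN (hN.trans hM) subset_rfl hM a) =
      𝒜.res hM ((𝒜.relIdeal (hN.trans hM)).incl a) := rfl

end C0Algebra

namespace CohomologyTheory

open AbstractSimplicialComplex RelHomology

variable {C : GoodSubcategory.{u}} (h : CohomologyTheory.{u, w} C)

/-- For the zero algebra the identity maps form a short exact sequence, so every class is an image
and hence zero. -/
lemma subsingleton_group (n : ℤ) (A : C.Obj) [Subsingleton A] : Subsingleton (h.group n A) := by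
  have hs : IsShortExact (NonUnitalStarAlgHom.id ℂ A) (NonUnitalStarAlgHom.id ℂ A) :=
    ⟨fun _ _ e => e, fun a => ⟨a, rfl⟩, fun a => ⟨fun _ => ⟨a, rfl⟩, fun _ => Subsingleton.elim _ _⟩⟩
  refine subsingleton_of_forall_eq 0 fun x => ?_
  rw [← h.map_id n A x]
  exact (h.exact_middle n hs x).2 ⟨x, h.map_id n A x⟩

section Filtration

variable {X : Type v} [TopologicalSpace X] {A : C.Obj} (𝒜 : C0Algebra X A)

lemma subsingleton_group_restrict (n : ℤ) {Y : Set X} (hY : Y = ∅) :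
    Subsingleton (h.group n (restrictObj 𝒜 Y)) := by
  subst hY
  have : Subsingleton (restrictObj 𝒜 (∅ : Set X)) := subsingleton_of_forall_eq 0 fun x => by
    obtain ⟨a, rfl⟩ := (𝒜.vanishing ∅).proj_surjective x
    exact (𝒜.vanishing ∅).proj_eq_zero.2 (𝒜.mem_vanishing_empty a)
  exact h.subsingleton_group n _

/-- The map `h^n(A|_Y) → h^n(A)`. -/
def globalMap (n : ℤ) (Y : Set X) : h.group n (restrictObj 𝒜 Y) →+ h.group n A :=
  h.map n (A := A) (B := restrictObj 𝒜 Y) (𝒜.vanishing Y).proj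

lemma globalMap_bijective (n : ℤ) {Y : Set X} (hY : Y = Set.univ) :
    Function.Bijective (h.globalMap 𝒜 n Y) := by
  subst hY
  refine h.map_bijective n (A := A) (B := restrictObj 𝒜 Set.univ) _
    ⟨(injective_iff_map_eq_zero _).2 fun a ha => ?_, ClosedIdeal.proj_surjective _⟩
  exact 𝒜.eq_zero_of_mem_vanishing_univ ((ClosedIdeal.proj_eq_zero _).1 ha)

lemma globalMap_res (n : ℤ) {Y Z : Set X} (hYZ : Y ⊆ Z) (x : h.group n (restrictObj 𝒜 Y)) :
    h.globalMap 𝒜 n Z (h.map n (A := restrictObj 𝒜 Z) (B := restrictObj 𝒜 Y) (𝒜.res hYZ) x) =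
      h.globalMap 𝒜 n Y x :=
  (h.map_comp n (A := A) (B := restrictObj 𝒜 Z) (D := restrictObj 𝒜 Y) _ _ x).symm

/-- The sequence of the triple maps to that of the pair `(L, M)` with the identity on the ideal, so
naturality of `δ` applies. It identifies `d¹` with the connecting map of a triple. -/
lemma map_incl_δ {N M L : Set X} (hN : N ⊆ M) (hM : M ⊆ L) {q q' : ℤ} (hq : q + 1 = q')
    (x : h.group q (relObj 𝒜 hM)) :
    h.map q' (A := relObj 𝒜 hN) (B := restrictObj 𝒜 M) (𝒜.relIdeal hN).incl
      (h.δ hq (J := relObj 𝒜 hM) (A := restrictObj 𝒜 L) (B := restrictObj 𝒜 M)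
        (shortExact_rel 𝒜 hM) x) =
      h.δ hq (J := relObj 𝒜 hM) (A := relObj 𝒜 (hN.trans hM)) (B := relObj 𝒜 hN)
        (C0Algebra.shortExact_triple hN hM) x := by
  refine (h.δ_natural hq (J := relObj 𝒜 hM) (A := relObj 𝒜 (hN.trans hM)) (B := relObj 𝒜 hN)
    (J' := relObj 𝒜 hM) (A' := restrictObj 𝒜 L) (B' := restrictObj 𝒜 M)
    (C0Algebra.shortExact_triple hN hM) (shortExact_rel 𝒜 hM)
    (NonUnitalStarAlgHom.id ℂ (relObj 𝒜 hM)) (𝒜.relIdeal (hN.trans hM)).incl (𝒜.relIdeal hN).incl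
    (C0Algebra.incl_relRes_left hN hM) (C0Algebra.incl_relRes_right hN hM) x).trans ?_
  rw [h.map_id]

lemma j_k_eq_δ {F : ℤ → Set X} (hF : Monotone F) {p q q' : ℤ} (hq : q + 1 = q')
    (x : (h.couple 𝒜 F hF).E p q) :
    (h.couple 𝒜 F hF).j (p - 1) q' ((h.couple 𝒜 F hF).k p hq x) =
      h.δ hq (J := relObj 𝒜 (hF (sub_one_lt p).le))
        (A := relObj 𝒜 ((hF (sub_one_lt (p - 1)).le).trans (hF (sub_one_lt p).le)))
        (B := relObj 𝒜 (hF (sub_one_lt (p - 1)).le))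
        (C0Algebra.shortExact_triple (hF (sub_one_lt (p - 1)).le) (hF (sub_one_lt p).le)) x :=
  h.map_incl_δ 𝒜 (hF (sub_one_lt (p - 1)).le) (hF (sub_one_lt p).le) hq x

end Filtration

variable {V : Type v} {K : AbstractSimplicialComplex V} {A : C.Obj}
  {𝒜 : C0Algebra K.Realization A}

lemma skeleton_eq_empty {p : ℤ} (hp : p < 0) : K.skeleton p = ∅ := by
  refine Set.eq_empty_iff_forall_notMem.2 ?_
  rintro x ⟨s, hs, hc, -⟩
  have : 0 < s.card := (Face.nonempty ⟨s, hs⟩).card_pos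
  omega

lemma skeleton_eq_univ {d : ℕ} (hd : ∀ s ∈ K.faces, s.card ≤ d + 1) {p : ℤ} (hp : (d : ℤ) ≤ p) :
    K.skeleton p = Set.univ := by
  refine Set.eq_univ_of_forall fun x => ⟨x.supp.1, x.supp.2, ?_,
    Realization.mem_closedSimplex_iff.2 subset_rfl⟩
  have := hd _ x.supp.2
  omega

variable {h}

section PageTwo

variable (o : K.Orientation) (hK : K.LocallyFinite) (hA : h.IsFibration 𝒜) (n : ℤ)

/-- The chain of coefficients of an element of the first page. -/
def pageChain [DecidableEq V] (hF : Monotone fun p => carrier (skel K p)) (p : ℕ) {P q : ℤ}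
    (hP : P = p) (hq : q + p = n) :
    (h.couple 𝒜 (fun p => carrier (skel K p)) hF).E P q →+ (groupBundle hA n).Chain p :=
  chainMap (𝓗 := h.pairHomology 𝒜 hK) (fun s => constSectionsHom hK s hA n) o (isLayer_skel hP) hq

theorem boundary_pageChain [DecidableEq V] (hF : Monotone fun p => carrier (skel K p)) (p : ℕ)
    {P q q' : ℤ} (hP : P = (p + 1 : ℕ)) (hP' : P - 1 = p) (hq : q + (p + 1 : ℕ) = n)
    (hq' : q' + p = n) (hqq : q + 1 = q')
    (x : (h.couple 𝒜 (fun p => carrier (skel K p)) hF).E P q) :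
    (groupBundle hA n).boundary o hK p (pageChain o hK hA n hF (p + 1) hP hq x) =
      pageChain o hK hA n hF p hP' hq' ((h.couple 𝒜 _ hF).j (P - 1) q'
        ((h.couple 𝒜 _ hF).k P hqq x)) := by
  refine (boundary_chainMap (𝓗 := h.pairHomology 𝒜 hK) o hK
    (fun s t hts z => resConst_constSectionsHom hK s hA n hts z) (isLayer_skel hP')
    (isLayer_skel hP) hq hq' hqq x).trans ?_
  exact congrArg _ (h.j_k_eq_δ 𝒜 hF hqq x).symm

/-- The group `S p` is the image of the identification with chains: the finite chains or all chains.
Both descriptions of the second page are instances. -/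
theorem nonempty_page_two_equiv [DecidableEq V]
    (S : ∀ p, AddSubgroup ((groupBundle hA n).Chain p))
    (hinj : ∀ (p : ℕ) {M L : LowerSet K.Face} (hl : IsLayer p M L) {q : ℤ} (hq : q + p = n),
      Function.Injective (chainMap (𝓗 := h.pairHomology 𝒜 hK)
        (fun s => constSectionsHom hK s hA n) o hl hq))
    (hS : ∀ (p : ℕ) {M L : LowerSet K.Face} (hl : IsLayer p M L) {q : ℤ} (hq : q + p = n),
      (chainMap (𝓗 := h.pairHomology 𝒜 hK) (fun s => constSectionsHom hK s hA n) o hl hq).range =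
        S p)
    (p : ℕ) {q : ℤ} (hq : q + p = n) :
    Nonempty ((h.couple 𝒜 K.skeleton K.skeleton_mono).Page 2 p q ≃+
      ↥((groupBundle hA n).cycles o hK p ⊓ S p) ⧸
        ((S (p + 1)).map ((groupBundle hA n).boundary o hK p)).addSubgroupOf
          ((groupBundle hA n).cycles o hK p ⊓ S p)) := by
  -- The types of the pages depend on the filtration, so the passage from skeleta to carriers of
  -- subcomplexes is made by substituting for a general `F`.
  have key : ∀ (F : ℤ → Set K.Realization) (hF : Monotone F) (e : F = fun p => carrier (skel K p))
      (h0 : ∀ p < 0, F p = ∅), Nonempty ((h.couple 𝒜 F hF).Page 2 p q ≃+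
      ↥((groupBundle hA n).cycles o hK p ⊓ S p) ⧸
        ((S (p + 1)).map ((groupBundle hA n).boundary o hK p)).addSubgroupOf
          ((groupBundle hA n).cycles o hK p ⊓ S p)) := by
    rintro F hF rfl h0
    have hΨ := fun p {P q q'} => boundary_pageChain (P := P) (q := q) (q' := q') o hK hA n hF p
    have hS' := fun (p : ℕ) {P q : ℤ} (hP : P = p) (hq : q + p = n) =>
      hS p (isLayer_skel (K := K) hP) hq
    have hinj' := fun (p : ℕ) {P q : ℤ} (hP : P = p) (hq : q + p = n) =>
      hinj p (isLayer_skel (K := K) hP) hq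
    exact AddMonoidHom.nonempty_subquotient_equiv (pageChain o hK hA n hF p rfl hq)
      (hinj' p rfl hq) _ _ _ _
      (ExactCouple.map_Z_two _ (fun p {P q} => pageChain o hK hA n hF p) hΨ hinj' S hS'
        (fun p hp q => h.subsingleton_group_restrict 𝒜 q (h0 p hp)) p rfl hq)
      (ExactCouple.map_B_two _ (fun p {P q} => pageChain o hK hA n hF p) hΨ S hS' p rfl hq)
  exact key _ K.skeleton_mono skeleton_eq fun p => skeleton_eq_empty

theorem nonempty_page_two_equiv_homologyFin (hc : K.faces.Countable)
    (hs : h.SigmaAdditive ∨ K.faces.Finite) (p : ℕ) {q : ℤ} (hq : q + p = n) :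
    Nonempty ((h.couple 𝒜 K.skeleton K.skeleton_mono).Page 2 p q ≃+
      (groupBundle hA n).HomologyFin o hK p) := by
  classical
  have hac := pairHomology_acyclic (h := h) hK hA
  have hΦ := fun s => constSectionsHom_bijective hK s hA n
  have key : ∀ (p : ℕ) {M L : LowerSet K.Face} (hl : IsLayer p M L) (q : ℤ)
      (x : (h.pairHomology 𝒜 hK).G q hl.le),
      {σ | (h.pairHomology 𝒜 hK).coeff q hl.le (hl.isTop σ) x ≠ 0}.Finite ∧
      ((∀ σ, (h.pairHomology 𝒜 hK).coeff q hl.le (hl.isTop σ) x = 0) → x = 0) := by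
    intro p M L hl q x
    rcases hs with hs | hs
    · exact hs.exists_finite_coeff hK hl hc q x
    · have := Simplex.finite hs p
      exact ⟨Set.toFinite _, eq_zero_of_coeff_eq_zero hl q x⟩
  exact nonempty_page_two_equiv o hK hA n _
    (fun p _ _ hl q hq => chainMap_injective o hl hq hac hΦ fun x => (key p hl q x).2)
    (fun p _ _ hl q hq => range_chainMap_eq_finChain o hl hq hac hΦ fun x => (key p hl q x).1) p hq

theorem nonempty_page_two_equiv_homology (hc : K.faces.Countable) (hm : h.SigmaMultiplicative)
    (p : ℕ) {q : ℤ} (hq : q + p = n) :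
    Nonempty ((h.couple 𝒜 K.skeleton K.skeleton_mono).Page 2 p q ≃+
      (groupBundle hA n).Homology o hK p) := by
  classical
  have hac := pairHomology_acyclic (h := h) hK hA
  have hΦ := fun s => constSectionsHom_bijective hK s hA n
  have := nonempty_page_two_equiv o hK hA n (fun _ => ⊤)
    (fun p _ _ hl q hq => chainMap_injective o hl hq hac hΦ fun x hx =>
      (hm.bijective_coeff hK hl hc q).1 (funext fun σ => (hx σ).trans (map_zero _).symm))
    (fun p _ _ hl q hq => range_chainMap_eq_top o hl hq hac hΦ fun b => by
      obtain ⟨x, hx⟩ := (hm.bijective_coeff hK hl hc q).2 b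
      exact ⟨x, congrFun hx⟩) p hq
  -- For `S = ⊤` the intersection with `S` disappears and the image of `S` is the full range of the
  -- boundary map.
  rwa [inf_top_eq, ← AddMonoidHom.range_eq_map] at this

end PageTwo

end CohomologyTheory

end

/-! ### The Leray–Serre spectral sequence -/

theorem theorem4p16 {C : GoodSubcategory.{u}} (h : CohomologyTheory.{u, w} C)
    {V : Type v} (K : AbstractSimplicialComplex V) (o : K.Orientation)
    (dim : ℕ) (hdim : ∀ s ∈ K.faces, s.card ≤ dim + 1)
    (hcount : K.faces.Countable) (hK : K.LocallyFinite)
    (A : C.Obj) (𝒜 : C0Algebra K.Realization A) (hA : h.IsFibration 𝒜) :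
    -- the spectral sequence of the skeletal filtration
    let T : ExactCouple.{w} := h.couple 𝒜 K.skeleton K.skeleton_mono
    -- the filtration of `h^q(A)`
    let F : ∀ _ q : ℤ, AddSubgroup (h.group q A) := fun p q => h.imageOf 𝒜 (K.skeleton p) q
    -- each page is a complex whose homology is the next page
    (∀ (r : ℕ+) {p₀ p p₁ q₀ q q₁ : ℤ} (hp₀ : p + (r : ℕ) = p₀) (hq₀ : q₀ + 1 = q)
        (hp₁ : p₁ + (r : ℕ) = p) (hq₁ : q + 1 = q₁),
      (∀ x : T.Page r p₀ q₀, T.d hp₁ hq₁ (T.d hp₀ hq₀ x) = 0) ∧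
      ∃ e : T.Page (r + 1) p q ≃+ T.PageHomology r hp₀ hq₀ hp₁ hq₁,
        ∀ x : T.Z (r + 1) p q, ∃ (hx : (x : T.E p q) ∈ T.Z r p q)
          (hd : T.d hp₁ hq₁ (T.toPage r p q ⟨x, hx⟩) = 0),
          e (T.toPage (r + 1) p q x) =
            QuotientAddGroup.mk (⟨T.toPage r p q ⟨x, hx⟩, hd⟩ : (T.d hp₁ hq₁).ker)) ∧
    -- it converges to `h^*(A)`
    (∀ q : ℤ, (∀ p < 0, F p q = ⊥) ∧ (∀ p, (dim : ℤ) ≤ p → F p q = ⊤) ∧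
      (∀ p, F (p - 1) q ≤ F p q) ∧
      ∀ p, ∃ r₀ : ℕ+, ∀ r ≥ r₀,
        Nonempty (T.Page r p q ≃+ F p q ⧸ (F (p - 1) q).addSubgroupOf (F p q))) ∧
    -- the `E²`-term
    (∀ p < 0, ∀ q, Subsingleton (T.Page 2 p q)) ∧
    (h.SigmaAdditive ∨ K.faces.Finite → ∀ (p : ℕ) (q : ℤ),
      Nonempty (T.Page 2 p q ≃+ (CohomologyTheory.groupBundle hA (p + q)).HomologyFin o hK p)) ∧
    (h.SigmaMultiplicative → ∀ (p : ℕ) (q : ℤ),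
      Nonempty (T.Page 2 p q ≃+ (CohomologyTheory.groupBundle hA (p + q)).Homology o hK p)) := by
  refine ⟨fun r p₀ p p₁ q₀ q q₁ hp₀ hq₀ hp₁ hq₁ => ⟨ExactCouple.d_d _ hp₀ hq₀ hp₁ hq₁,
    ExactCouple.exists_page_succ_equiv _ r hp₀ hq₀ hp₁ hq₁⟩, fun q => ?_, fun p hp q => ?_,
    fun hs p q => ?_, fun hm p q => ?_⟩
  · have h0 : ∀ p < 0, ∀ q, Subsingleton (h.group q (CohomologyTheory.restrictObj 𝒜 (K.skeleton p))) :=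
      fun p hp q => h.subsingleton_group_restrict 𝒜 q (CohomologyTheory.skeleton_eq_empty hp)
    have h1 : ∀ p, (dim : ℤ) ≤ p → Function.Bijective (h.globalMap 𝒜 q (K.skeleton p)) :=
      fun p hp => h.globalMap_bijective 𝒜 q (CohomologyTheory.skeleton_eq_univ hdim hp)
    refine ⟨fun p hp => ?_, fun p hp => AddMonoidHom.range_eq_top.2 (h1 p hp).2, fun p => ?_, ?_⟩
    · have := h0 p hp q
      refine (AddSubgroup.eq_bot_iff_forall _).2 ?_
      rintro _ ⟨x, rfl⟩
      rw [Subsingleton.elim x 0, map_zero]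
    · rintro _ ⟨x, rfl⟩
      exact ⟨_, h.globalMap_res 𝒜 q (K.skeleton_mono (sub_one_lt p).le) x⟩
    · exact ExactCouple.exists_forall_page_equiv (h.couple 𝒜 K.skeleton K.skeleton_mono) q
        (fun p => h.globalMap 𝒜 q (K.skeleton p))
        (fun hmn x => h.globalMap_res 𝒜 q (K.skeleton_mono hmn) x) dim (fun p hp => (h1 p hp).1) h0
  · exact ExactCouple.subsingleton_page _ (fun p hp q =>
      h.subsingleton_group_restrict 𝒜 q (CohomologyTheory.skeleton_eq_empty hp)) 2 hp q
  · exact CohomologyTheory.nonempty_page_two_equiv_homologyFin o hK hA _ hcount hs p (add_comm q p)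
  · exact CohomologyTheory.nonempty_page_two_equiv_homology o hK hA _ hcount hm p (add_comm q p)
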